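/- Let $p$ be a prime and $K$ a complete discretely valued field extension of $\mathbb{Q}_p$ (with norm extending that of $\mathbb{Q}_p$). Banach $K$-algebras are non-archimedean, modules are left modules, "noetherian" means left noetherian. **Weights.** Let $V$ be a topological $K$-vector space with a $K$-linear endomorphism $\partial$. For $\lambda\in K$ put $V^\lambda=\{v : (\partial-\lambda)^n v=0 \text{ for } n\gg 0\}$, $\Lambda(V)=\{\lambda : V^\lambda\neq 0\}$ and $V^{\mathrm{ws}}=\bigoplus_{\lambda}V^\lambda$. We say that $V$ admits a weight space decomposition with respect to $I\subset\Lambda(V)$ if every $v\in V$ is a convergent sum $v=\sum_{\lambda\in I}v_\lambda$ with $v_\lambda\in V^\lambda$. It is semi-simple if $\partial$ acts on $V^\lambda$ as multiplication by $\lambda$ for all $\lambda\in I$; it is of finite type if $I$ lies in a finite union of cosets $\lambda_i+\mathbb{Z}$ and $\dim_K V^\lambda<\infty$ for all $\lambda\in I$. **Triangular decompositions.** A triangular decomposition of a noetherian $\mathbb{Z}$-graded $K$-algebra $R$ consists of graded subalgebras $A,B,H\subset R$ and $\partial\in R_0$ such that multiplication $A\otimes_K H\otimes_K B\to R$ is bijective;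 $BH=HB$ and $HA=AH$; $A$ lives in degrees $\geq 0$, $B$ in degrees $\leq 0$, $A_0=B_0=K$, $H\subset R_0$; all $A_n,B_n$ are finite-dimensional; $H$ is a finite-dimensional split semi-simple $K$-algebra; and $R_n=\{x : [\partial,x]=nx\}$ for all $n\in\mathbb{Z}$. A triangular decomposition of a noetherian Banach $K$-algebra $\mathscr{S}$ is a dense graded subalgebra $R\subset\mathscr{S}$ with a triangular decomposition $(A,B,H,\partial)$ such that, for the closures $\mathscr{A},\mathscr{B}$ of $A,B$ in $\mathscr{S}$, multiplication induces an isomorphism of Banach spaces $\mathscr{A}\widehat\otimes_K H\widehat\otimes_K\mathscr{B}\cong\mathscr{S}$, both $\mathscr{A}$ and $\mathscr{B}$ admit semi-simple weight space decompositions for $\mathrm{ad}(\partial)$, and $\mathscr{A}^{\mathrm{ws}}=A$, $\mathscr{B}^{\mathrm{ws}}=B$. In that case $\widehat{\mathcal{O}}$ is the category of finitely generated $\mathscr{S}$-modules, with their canonical Banach topology, which are finitely generated over $\mathscr{A}$ and admit a weight space decomposition for $\partial$. **Fréchet–Stein algebras.** A Fréchet–Stein presentation $\mathscr{R}=\varprojlim_{n\ge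 0}\mathscr{R}(n)$ consists of noetherian Banach $K$-algebras $\mathscr{R}(n)$ and continuous $K$-algebra maps $\mathscr{R}(n+1)\to\mathscr{R}(n)$ with dense image making $\mathscr{R}(n)$ a flat right $\mathscr{R}(n+1)$-module. A co-admissible $\mathscr{R}$-module ($M\in\mathcal{C}(\mathscr{R})$) is $M=\varprojlim M(n)$ for finitely generated $\mathscr{R}(n)$-modules $M(n)$ with isomorphisms $\mathscr{R}(n)\otimes_{\mathscr{R}(n+1)}M(n+1)\cong M(n)$; it carries the inverse limit of the canonical Banach topologies. Let $\mathscr{R}=\varprojlim_n\mathscr{R}(n)$ be such a presentation with a triangular decomposition $(R,A,B,H,\partial)$: $R\subset\mathscr{R}$ is a dense subalgebra such that each $R\to\mathscr{R}(n)$ is injective and makes $(R,A,B,H,\partial)$ a triangular decomposition of $\mathscr{R}(n)$. Let $\mathscr{A}(n),\mathscr{B}(n)$ be the closures of $A,B$ in $\mathscr{R}(n)$, and assume that $\mathscr{A}=\varprojlim\mathscr{A}(n)$ and $\mathscr{B}=\varprojlim\mathscr{B}(n)$ are Fréchet–Stein presentations. Let $\widehat{\mathcal{O}}(n)$ be the category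 $\widehat{\mathcal{O}}$ of $\mathscr{R}(n)$, and let $\wideparen{\mathcal{O}}=\varprojlim\widehat{\mathcal{O}}(n)$ be the full subcategory of those $M=\varprojlim M(n)$ in $\mathcal{C}(\mathscr{R})$ with $M(n)\in\widehat{\mathcal{O}}(n)$ for all $n$. **Theorem.** For $M\in\mathcal{C}(\mathscr{R})$, the following are equivalent: (i) $M\in\wideparen{\mathcal{O}}$. (ii) $M$ admits a weight space decomposition of finite type for $\partial$, and there is a finite set $\{\lambda_1,\dots,\lambda_r\}\subset\Lambda(M)$ with $\Lambda(M)\subset\bigcup_{i=1}^r(\lambda_i+\mathbb{Z}_{\geq 0})$. (iii) $M$ admits a weight space decomposition of finite type for $\partial$, and $B$ acts locally nilpotently on $M^{\mathrm{ws}}$: for every $m\in M^{\mathrm{ws}}$ there is $n\geq 0$ with $B_{-k}m=0$ for all $k>n$. Furthermore, if these conditions hold, then $M$ is a co-admissible $\mathscr{A}$-module. -/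

import Mathlib

open scoped TensorProduct
open Module (End)

namespace TriangularO

universe u v w

/-! ### Extension of scalars over non-commutative rings -/

section ExtendScalars

variable {S : Type*} {T : Type*} [Ring S] [Ring T]

/-- The relations `φ s ⊗ m = 1 ⊗ s • m` in `T ⊗[ℤ] M` (as a left `T`-submodule). -/
def balancedRelations (φ : S →+* T) (M : Type*) [AddCommGroup M] [Module S M] :
    Submodule T (T ⊗[ℤ] M) :=
  Submodule.span T {z | ∃ (s : S) (m : M), z = φ s ⊗ₜ[ℤ] m - (1 : T) ⊗ₜ[ℤ] (s • m)}

/-- The extension of scalars `T ⊗_S M` of a left `S`-module `M` along `φ : S → T`,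
for arbitrary (non-commutative) rings, as a left `T`-module. -/
abbrev ExtendScalars (φ : S →+* T) (M : Type*) [AddCommGroup M] [Module S M] : Type _ :=
  (T ⊗[ℤ] M) ⧸ balancedRelations φ M

/-- The canonical map `M → T ⊗_S M`, `m ↦ 1 ⊗ m`. -/
def ExtendScalars.unit (φ : S →+* T) (M : Type*) [AddCommGroup M] [Module S M] :
    M →ₛₗ[φ] ExtendScalars φ M where
  toFun m := (balancedRelations φ M).mkQ ((1 : T) ⊗ₜ[ℤ] m)
  map_add' x y := by rw [TensorProduct.tmul_add, map_add]
  map_smul' s m := by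
    rw [← map_smul, TensorProduct.smul_tmul', smul_eq_mul, mul_one]
    refine ((Submodule.Quotient.eq _).2 ?_).symm
    exact Submodule.subset_span ⟨s, m, rfl⟩

/-- The `T`-linear map `T ⊗_S M → N`, `t ⊗ m ↦ t • f m`, attached to a `φ`-semilinear map
`f : M → N` into a left `T`-module. -/
def ExtendScalars.lift {φ : S →+* T} {M N : Type*} [AddCommGroup M] [Module S M]
    [AddCommGroup N] [Module T N] (f : M →ₛₗ[φ] N) : ExtendScalars φ M →ₗ[T] N :=
  (balancedRelations φ M).liftQ
    (TensorProduct.AlgebraTensorModule.lift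
      { toFun := fun t =>
          { toFun := fun m => t • f m
            map_add' := fun x y => by rw [map_add, smul_add]
            map_smul' := fun k x => by
              rw [map_zsmul, smul_comm, RingHom.id_apply] }
        map_add' := fun t t' => by ext m; exact add_smul t t' (f m)
        map_smul' := fun r t => by ext m; exact mul_smul r t (f m) })
    (Submodule.span_le.2 (by
      rintro _ ⟨s, m, rfl⟩
      simp))

/-- `T` is flat as a right `S`-module via `φ : S → T`: the functor `T ⊗_S -` from left
`S`-modules to left `T`-modules preserves injective maps. -/
def RightFlat {S : Type u} {T : Type u} [Ring S] [Ring T] (φ : S →+* T) : Prop :=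
  ∀ (N N' : Type u) [AddCommGroup N] [Module S N] [AddCommGroup N'] [Module S N']
    (f : N →ₗ[S] N'), Function.Injective f →
      Function.Injective (ExtendScalars.lift ((ExtendScalars.unit φ N').comp f))

end ExtendScalars

/-! ### Weight spaces -/

section Weights

variable {K : Type*} [Field K] {V : Type*} [AddCommGroup V] [Module K V]

/-- The set `Λ(V)` of weights of an endomorphism: those `μ` with nonzero generalized weight space
`V^μ = {v | (D - μ)^n v = 0 for n ≫ 0}`. -/
def weights (D : End K V) : Set K := {μ | D.maxGenEigenspace μ ≠ ⊥}

/-- `V^ws`, the sum of all the generalized weight spaces (this sum is automatically direct). -/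
def weightPart (D : End K V) : Submodule K V := ⨆ μ : K, D.maxGenEigenspace μ

/-- `V` admits a weight space decomposition for `D` with respect to `I`. -/
def HasWeightDecomposition [TopologicalSpace V] (D : End K V) (I : Set K) : Prop :=
  I ⊆ weights D ∧
    ∀ v : V, ∃ c : I → V, (∀ μ : I, c μ ∈ D.maxGenEigenspace (μ : K)) ∧ HasSum c v

/-- The decomposition is semi-simple: `D` is multiplication by `μ` on each `V^μ`, `μ ∈ I`. -/
def IsSemisimpleOn (D : End K V) (I : Set K) : Prop :=
  ∀ μ ∈ I, ∀ v ∈ D.maxGenEigenspace μ, D v = μ • v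

/-- `I` is contained in finitely many cosets `μ + ℤ`. -/
def IsCompactType (I : Set K) : Prop :=
  ∃ s : Finset K, ∀ μ ∈ I, ∃ ν ∈ s, ∃ n : ℤ, μ = ν + (n : K)

/-- `V` admits a weight space decomposition of finite type for `D`. -/
def HasFiniteTypeWeightDecomposition [TopologicalSpace V] (D : End K V) : Prop :=
  ∃ I : Set K, HasWeightDecomposition D I ∧ IsCompactType I ∧
    ∀ μ ∈ I, FiniteDimensional K (D.maxGenEigenspace μ)

end Weights

/-! ### Triangular decompositions of graded algebras -/

section Algebraic

variable {K : Type*} [Field K] {R : Type*} [Ring R] [Algebra K R]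

/-- The multiplication map `U ⊗ V ⊗ W → R` of three subalgebras of `R`. -/
def tripleMul (U V W : Subalgebra K R) : (U ⊗[K] (V ⊗[K] W)) →ₗ[K] R :=
  LinearMap.mul' K R ∘ₗ TensorProduct.map U.val.toLinearMap
    (LinearMap.mul' K R ∘ₗ TensorProduct.map V.val.toLinearMap W.val.toLinearMap)

/-- A subalgebra is graded if it contains the homogeneous components of its elements. -/
def IsGradedSubalgebra (𝒢 : ℤ → Submodule K R) [GradedAlgebra 𝒢] (U : Subalgebra K R) : Prop :=
  ∀ x ∈ U, ∀ n : ℤ, (DirectSum.decompose 𝒢 x n : R) ∈ U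

/-- `(A, B, H, d)` is a triangular decomposition of the noetherian graded algebra `R = ⨁ 𝒢 n`. -/
structure IsTriangularDecomposition (𝒢 : ℤ → Submodule K R) [GradedAlgebra 𝒢]
    (A B H : Subalgebra K R) (d : R) : Prop where
  noetherian : IsNoetherianRing R
  graded_A : IsGradedSubalgebra 𝒢 A
  graded_B : IsGradedSubalgebra 𝒢 B
  graded_H : IsGradedSubalgebra 𝒢 H
  tensor : Function.Bijective (tripleMul A H B)
  comm_BH : Subalgebra.toSubmodule B * Subalgebra.toSubmodule H =
    Subalgebra.toSubmodule H * Subalgebra.toSubmodule B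
  comm_HA : Subalgebra.toSubmodule H * Subalgebra.toSubmodule A =
    Subalgebra.toSubmodule A * Subalgebra.toSubmodule H
  A_neg : ∀ n : ℤ, n < 0 → Subalgebra.toSubmodule A ⊓ 𝒢 n = ⊥
  B_pos : ∀ n : ℤ, 0 < n → Subalgebra.toSubmodule B ⊓ 𝒢 n = ⊥
  A_zero : Subalgebra.toSubmodule A ⊓ 𝒢 0 = Subalgebra.toSubmodule (⊥ : Subalgebra K R)
  B_zero : Subalgebra.toSubmodule B ⊓ 𝒢 0 = Subalgebra.toSubmodule (⊥ : Subalgebra K R)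
  H_le : Subalgebra.toSubmodule H ≤ 𝒢 0
  A_fin : ∀ n : ℤ, FiniteDimensional K ↥(Subalgebra.toSubmodule A ⊓ 𝒢 n)
  B_fin : ∀ n : ℤ, FiniteDimensional K ↥(Subalgebra.toSubmodule B ⊓ 𝒢 n)
  /-- `H` is a finite-dimensional split semi-simple algebra: a product of matrix algebras. -/
  H_split : ∃ (r : ℕ) (k : Fin r → ℕ),
    Nonempty (H ≃ₐ[K] (∀ i : Fin r, Matrix (Fin (k i)) (Fin (k i)) K))
  d_mem : d ∈ 𝒢 0
  inner : ∀ (n : ℤ) (x : R), x ∈ 𝒢 n ↔ d * x - x * d = (n : K) • x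

/-- The commutator `ad(δ) = [δ, -]`. -/
def adj (δ : R) : End K R := LinearMap.mulLeft K δ - LinearMap.mulRight K δ

theorem adj_apply (δ x : R) : adj (K := K) δ x = δ * x - x * δ := rfl

/-- Under an inner grading, graded subalgebras are stable under `ad(d)`. -/
theorem adj_mem_of_graded {𝒢 : ℤ → Submodule K R} [GradedAlgebra 𝒢] {d : R}
    (hd : ∀ (n : ℤ) (x : R), x ∈ 𝒢 n ↔ d * x - x * d = (n : K) • x)
    {U : Subalgebra K R} (hU : IsGradedSubalgebra 𝒢 U) {x : R} (hx : x ∈ U) :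
    adj (K := K) d x ∈ U := by
  classical
  have h := DirectSum.sum_support_decompose 𝒢 x
  rw [← h, map_sum]
  refine Subalgebra.sum_mem _ fun n _ => ?_
  rw [adj_apply, (hd n _).1 (SetLike.coe_mem _)]
  exact U.smul_mem (hU x hx n) _

end Algebraic

/-! ### Banach algebras -/

section Banach

variable {K : Type*} [NontriviallyNormedField K]

/-- The (non-archimedean projective) tensor product norm on `U ⊗ V ⊗ W`:
the infimum of `max ‖aᵢ‖ ‖hᵢ‖ ‖bᵢ‖` over all expressions `z = ∑ aᵢ ⊗ hᵢ ⊗ bᵢ`. -/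
noncomputable def tensorNorm {U V W : Type*} [NormedAddCommGroup U] [NormedSpace K U]
    [NormedAddCommGroup V] [NormedSpace K V] [NormedAddCommGroup W] [NormedSpace K W]
    (z : U ⊗[K] (V ⊗[K] W)) : ℝ :=
  sInf {c : ℝ | 0 ≤ c ∧ ∃ (r : ℕ) (a : Fin r → U) (h : Fin r → V) (b : Fin r → W),
    z = ∑ i, a i ⊗ₜ[K] (h i ⊗ₜ[K] b i) ∧ ∀ i, ‖a i‖ * ‖h i‖ * ‖b i‖ ≤ c}

variable {X : Type*} [NormedRing X] [NormedAlgebra K X]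

/-- `X = U ⊗̂ V ⊗̂ W` as Banach spaces, for subalgebras `U, V, W` of a Banach algebra `X`.
As `X` is complete, multiplication identifies the completion of `U ⊗ V ⊗ W` for the tensor
product norm with `X` (as topological vector spaces) iff it has dense image and the tensor product
norm is equivalent to the norm induced from `X`; one of the two estimates,
`‖tripleMul z‖ ≤ tensorNorm z`, is automatic over an ultrametric Banach algebra. -/
def IsCompletedTensorDecomposition (U V W : Subalgebra K X) : Prop :=
  DenseRange (tripleMul U V W) ∧ ∃ C : ℝ, ∀ z : U ⊗[K] (V ⊗[K] W),
    tensorNorm z ≤ C * ‖tripleMul U V W z‖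

variable {R : Type*} [Ring R] [Algebra K R]

/-- The closure in `X` of the image of a subalgebra of `R`. -/
noncomputable def closureIn (ι : R →ₐ[K] X) (U : Subalgebra K R) : Subalgebra K X :=
  (U.map ι).topologicalClosure

theorem adj_mem_closureIn {𝒢 : ℤ → Submodule K R} [GradedAlgebra 𝒢] {d : R}
    (hd : ∀ (n : ℤ) (x : R), x ∈ 𝒢 n ↔ d * x - x * d = (n : K) • x)
    {U : Subalgebra K R} (hU : IsGradedSubalgebra 𝒢 U) (ι : R →ₐ[K] X) :
    ∀ x ∈ Subalgebra.toSubmodule (closureIn ι U),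
      adj (K := K) (ι d) x ∈ Subalgebra.toSubmodule (closureIn ι U) := by
  intro x hx
  have hc : Continuous (fun y : X => ι d * y - y * ι d) := by fun_prop
  refine map_mem_closure hc hx ?_
  rintro _ ⟨y, hy, rfl⟩
  refine ⟨d * y - y * d, adj_mem_of_graded hd hU hy, ?_⟩
  simp [adj_apply]

/-- `ad(∂)` as an endomorphism of the closure of a graded subalgebra. -/
noncomputable def adjClosure {𝒢 : ℤ → Submodule K R} [GradedAlgebra 𝒢] {d : R}
    (hd : ∀ (n : ℤ) (x : R), x ∈ 𝒢 n ↔ d * x - x * d = (n : K) • x)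
    {U : Subalgebra K R} (hU : IsGradedSubalgebra 𝒢 U) (ι : R →ₐ[K] X) :
    End K (Subalgebra.toSubmodule (closureIn ι U)) :=
  (adj (ι d)).restrict (adj_mem_closureIn hd hU ι)

/-- `(R, A, B, H, d)` is a triangular decomposition of the Banach algebra `X`, where `R` is
regarded as a subalgebra of `X` through the injection `ι`. -/
structure IsBanachTriangularDecomposition (ι : R →ₐ[K] X) (𝒢 : ℤ → Submodule K R)
    [GradedAlgebra 𝒢] (A B H : Subalgebra K R) (d : R) : Prop where
  algebraic : IsTriangularDecomposition 𝒢 A B H d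
  injective : Function.Injective ι
  dense : DenseRange ι
  tensor : IsCompletedTensorDecomposition (closureIn ι A) (H.map ι) (closureIn ι B)
  decomp_A : ∃ I : Set K,
    HasWeightDecomposition (adjClosure algebraic.inner algebraic.graded_A ι) I ∧
    IsSemisimpleOn (adjClosure algebraic.inner algebraic.graded_A ι) I
  ws_A : (weightPart (adjClosure algebraic.inner algebraic.graded_A ι)).map
    (Submodule.subtype _) = Subalgebra.toSubmodule (A.map ι)
  decomp_B : ∃ I : Set K,
    HasWeightDecomposition (adjClosure algebraic.inner algebraic.graded_B ι) I ∧
    IsSemisimpleOn (adjClosure algebraic.inner algebraic.graded_B ι) I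
  ws_B : (weightPart (adjClosure algebraic.inner algebraic.graded_B ι)).map
    (Submodule.subtype _) = Subalgebra.toSubmodule (B.map ι)

/-- Membership in the category `𝒪^` of a noetherian Banach algebra `X` with a triangular
decomposition, with `𝒜 ⊆ X` the closure of `A` and `δ ∈ X` the grading element: a finitely
generated `X`-module, finite over `𝒜`, which admits a weight space decomposition for `δ`. The
topology is the canonical one, i.e. the quotient topology for any surjection from some `X ^ r`. -/
def InBanachO (𝒜 : Subalgebra K X) (δ : X) (N : Type*) [AddCommGroup N] [Module K N]
    [Module X N] [IsScalarTower K X N] : Prop :=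
  letI : TopologicalSpace N := moduleTopology X N
  Module.Finite X N ∧ (∃ I : Set K, HasWeightDecomposition (Algebra.lsmul K K N δ) I) ∧
    Module.Finite 𝒜 N

end Banach

/-! ### Fréchet–Stein algebras and co-admissible modules -/

section FrechetStein

variable {K : Type w} [NontriviallyNormedField K]
  {X : ℕ → Type u} [∀ n, NormedRing (X n)] [∀ n, NormedAlgebra K (X n)]

/-- The inverse limit of a tower of Banach algebras, with the inverse limit topology (the subspace
topology of the product). -/
def invLim (ρ : ∀ n, X (n + 1) →A[K] X n) : Subalgebra K (∀ n, X n) where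
  carrier := {x | ∀ n, ρ n (x (n + 1)) = x n}
  mul_mem' hx hy n := by simp [hx n, hy n]
  add_mem' hx hy n := by simp [hx n, hy n]
  algebraMap_mem' r n := by
    rw [Pi.algebraMap_apply, Pi.algebraMap_apply]
    exact AlgHomClass.commutes (ρ n) r

/-- The projection of the inverse limit to its `n`-th term. -/
def proj (ρ : ∀ n, X (n + 1) →A[K] X n) (n : ℕ) : invLim ρ →ₐ[K] X n :=
  (Pi.evalAlgHom K X n).comp (invLim ρ).val

/-- `lim X n` is a Fréchet–Stein presentation: the `X n` are (left) noetherian non-archimedean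
Banach algebras, and the transition maps have dense image and are (right) flat. -/
structure IsFrechetStein (ρ : ∀ n, X (n + 1) →A[K] X n) : Prop where
  complete : ∀ n, CompleteSpace (X n)
  ultrametric : ∀ n, IsUltrametricDist (X n)
  noetherian : ∀ n, IsNoetherianRing (X n)
  dense : ∀ n, DenseRange (ρ n)
  flat : ∀ n, RightFlat ((ρ n : X (n + 1) →ₐ[K] X n) : X (n + 1) →+* X n)

/-- A coherent system over the tower `X`: finitely generated `X n`-modules `M n` with
isomorphisms `X n ⊗_{X (n+1)} M (n+1) ≅ M n`; this is an object of the category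
`𝒞(lim X n) = lim Mod(X n)` of co-admissible modules. -/
structure CoherentModule (ρ : ∀ n, X (n + 1) →A[K] X n) where
  obj : ℕ → Type v
  [addCommGroup : ∀ n, AddCommGroup (obj n)]
  [moduleK : ∀ n, Module K (obj n)]
  [module : ∀ n, Module (X n) (obj n)]
  [tower : ∀ n, IsScalarTower K (X n) (obj n)]
  finite : ∀ n, Module.Finite (X n) (obj n)
  transition : ∀ n,
    obj (n + 1) →ₛₗ[((ρ n : X (n + 1) →ₐ[K] X n) : X (n + 1) →+* X n)] obj n
  bijective : ∀ n, Function.Bijective (ExtendScalars.lift (transition n))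

attribute [instance] CoherentModule.addCommGroup CoherentModule.moduleK CoherentModule.module
  CoherentModule.tower

variable {ρ : ∀ n, X (n + 1) →A[K] X n}

/-- The canonical Banach space topology on each term. -/
instance (M : CoherentModule.{u, v, w} ρ) (n : ℕ) : TopologicalSpace (M.obj n) :=
  moduleTopology (X n) (M.obj n)

/-- The co-admissible module `lim M n` over `lim X n`, with the inverse limit topology (the
subspace topology of the product), which is its canonical Fréchet topology. -/
def CoherentModule.limit (M : CoherentModule.{u, v, w} ρ) :
    Submodule (invLim ρ) (∀ n, M.obj n) where
  carrier := {m | ∀ n, M.transition n (m (n + 1)) = m n}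
  add_mem' hx hy n := by simp [hx n, hy n]
  zero_mem' n := by simp
  smul_mem' a m hm n := by
    change M.transition n (a.1 (n + 1) • m (n + 1)) = a.1 n • m n
    rw [LinearMap.map_smulₛₗ, hm n]
    congr 1
    exact a.2 n

/-- A module over `lim X n` is co-admissible if it is isomorphic to the limit of a coherent
system. -/
def IsCoadmissible (ρ : ∀ n, X (n + 1) →A[K] X n) (M : Type v) [AddCommGroup M]
    [Module (invLim ρ) M] : Prop :=
  ∃ N : CoherentModule.{u, v, w} ρ, Nonempty (M ≃ₗ[invLim ρ] N.limit)

variable {R : Type*} [Ring R] [Algebra K R]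

/-- The closures `𝒜(n) ⊆ X n` of a subalgebra `A` of `R ⊆ lim X n`. -/
noncomputable abbrev closureTerm (ι : R →ₐ[K] invLim ρ) (A : Subalgebra K R) (n : ℕ) : Type u :=
  closureIn ((proj ρ n).comp ι) A

/-- The tower formed by the `𝒜(n)`, with the restrictions of the transition maps. -/
noncomputable def closureTower (ι : R →ₐ[K] invLim ρ) (A : Subalgebra K R) (n : ℕ) :
    closureTerm ι A (n + 1) →A[K] closureTerm ι A n :=
  ((ρ n).comp
    (⟨(closureIn ((proj ρ (n + 1)).comp ι) A).val, continuous_subtype_val⟩ :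
      closureTerm ι A (n + 1) →A[K] X (n + 1))).codRestrict
    (closureIn ((proj ρ n).comp ι) A) (by
      intro x
      have hc : Continuous (fun y : X (n + 1) => ρ n y) := (ρ n).continuous
      refine map_mem_closure (f := fun y : X (n + 1) => ρ n y) hc x.2 ?_
      rintro _ ⟨y, hy, rfl⟩
      exact ⟨y, hy, ((ι y).2 n).symm⟩)

/-- The inclusion `𝒜 = lim 𝒜(n) → lim X n`. -/
noncomputable def closureInclusion (ι : R →ₐ[K] invLim ρ) (A : Subalgebra K R) :
    invLim (closureTower ι A) →ₐ[K] invLim ρ where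
  toFun a := ⟨fun n => (a.1 n : X n), fun n => congrArg Subtype.val (a.2 n)⟩
  map_one' := rfl
  map_mul' _ _ := rfl
  map_zero' := rfl
  map_add' _ _ := rfl
  commutes' _ := rfl

/-- `(R, A, B, H, d)` is a triangular decomposition of the Fréchet–Stein algebra `lim X n`,
where `R` is regarded as a subalgebra through the injection `ι`. -/
structure IsFrechetTriangularDecomposition (ι : R →ₐ[K] invLim ρ) (𝒢 : ℤ → Submodule K R)
    [GradedAlgebra 𝒢] (A B H : Subalgebra K R) (d : R) : Prop where
  injective : Function.Injective ι
  dense : DenseRange ι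
  injective_proj : ∀ n, Function.Injective ((proj ρ n).comp ι)
  banach : ∀ n, IsBanachTriangularDecomposition ((proj ρ n).comp ι) 𝒢 A B H d

namespace CoherentModule

variable (M : CoherentModule.{u, v, w} ρ) (ι : R →ₐ[K] invLim ρ)

/-- The action of `r ∈ R` on the co-admissible module `M`. -/
noncomputable def act (r : R) : End K M.limit := Algebra.lsmul K K M.limit (ι r)

/-- `M` belongs to `𝒪⌢ = lim 𝒪^(n)`, i.e. every `M n` belongs to `𝒪^(n)`. -/
def InO (A : Subalgebra K R) (d : R) : Prop :=
  ∀ n, InBanachO (closureIn ((proj ρ n).comp ι) A) (proj ρ n (ι d)) (M.obj n)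

/-- `M` belongs to `𝒪⌢^ws`: it admits a weight space decomposition of finite type for `d`. -/
def InOws (d : R) : Prop := HasFiniteTypeWeightDecomposition (V := M.limit) (M.act ι d)

/-- `B` acts locally nilpotently on `M^ws`: each `m` is killed by `B_{-k}` for all `k > n`,
for some `n`. -/
def LocallyNilpotent (𝒢 : ℤ → Submodule K R) (B : Subalgebra K R) (d : R) : Prop :=
  ∀ m ∈ weightPart (M.act ι d), ∃ n : ℕ, ∀ k : ℕ, n < k →
    ∀ b ∈ B, b ∈ 𝒢 (-(k : ℤ)) → M.act ι b m = 0

/-- `M`, restricted to `𝒜 = lim 𝒜(n)`, is a co-admissible `𝒜`-module. -/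
def CoadmissibleOver (A : Subalgebra K R) : Prop :=
  letI : Module (invLim (closureTower ι A)) M.limit :=
    Module.compHom M.limit (closureInclusion ι A).toRingHom
  IsCoadmissible (closureTower ι A) M.limit

end CoherentModule

end FrechetStein

end TriangularO

namespace TriangularO

open Filter Topology

universe u v w

/-! ### Unconditional sums in ultrametric Banach spaces -/

section Ultrametric

variable {V : Type*} [NormedAddCommGroup V] [IsUltrametricDist V]

/-! The proof rests on two facts: weight components are continuous, and they can be compared between
different Banach completions of R.

Continuity. Let D be the action of ∂ on a Banach module whose vectors are convergent sums of
generalized eigenvectors, all killed by a common exponent e, with eigenvalues in finitely many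
cosets ν + ℤ. For each h these eigenvalues lie in finitely many discs of radius ‖p‖^h, so some
polynomial g is close to 1 at those in the disc about l and small at the others. Then g(D)^(p^k)
converges, as k → ∞, to the projector onto the weights in that disc, and shrinking the disc isolates
l. Hence components are unique (`IsWeightSum.unique`) and, by Banach–Steinhaus, continuous
(`exists_continuous_weight_projection`). A module generated over 𝒜(n) by finitely many weight
vectors is of this kind; as A lives in degrees ≥ 0 with finite-dimensional pieces, its weights are
bounded below and its weight spaces finite-dimensional
(`IsBanachTriangularDecomposition.hasBoundedWeights`).

Generation. Submodules of finite modules over noetherian Banach algebras are closed, so dense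
families of weight vectors generate. If B_{-k} kills w for large k, then H·B·w is finite-dimensional
and generates over 𝒜(n) a module containing R(n)·w
(`IsBanachTriangularDecomposition.smul_mem_span`).

Comparison. The map M(n+1)^μ → M(n)^μ is injective (`eq_zero_of_transition_eq_zero`). Indeed, if w
dies in M(n), flatness shows that the annihilator of w generates the unit left ideal of R(n), so
there are r ∈ R with r → 1 in R(n) while r w → 0 in M(n+1). But the μ-component of r w only sees the
parts of r in A_k·H·B_{-k} for finitely many k. These pieces are finite-dimensional, so the
component is bounded by the norm of r in R(n). Applied to 1 - r this gives w = 0.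

For (i) ⇒ (ii), components at the various levels are compatible by uniqueness, and M^μ embeds in
M(0)^μ. For (ii) ⇒ (iii), λ - k is not a weight for large k. For (iii) ⇒ (i), threads are dense in
M(n) by Mittag-Leffler, so finitely many images of weight vectors of M generate M(n). Finally, an
element of the kernel of 𝒜(n) ⊗ M(n+1) → M(n) is a convergent sum of images of weight vectors of
M(n+1), and injectivity on weight spaces kills each of them; this gives co-admissibility over 𝒜. -/

theorem norm_sum_le_of_forall_le {ι : Type*} (s : Finset ι) {f : ι → V} {C : ℝ} (hC : 0 ≤ C)
    (h : ∀ i ∈ s, ‖f i‖ ≤ C) : ‖∑ i ∈ s, f i‖ ≤ C :=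
  IsUltrametricDist.norm_sum_le_of_forall_le_of_nonneg hC h

theorem norm_add_le_max_norm (x y : V) : ‖x + y‖ ≤ max ‖x‖ ‖y‖ :=
  IsUltrametricDist.norm_add_le_max x y

theorem norm_sub_le_max_norm (x y : V) : ‖x - y‖ ≤ max ‖x‖ ‖y‖ := by
  simpa [sub_eq_add_neg] using norm_add_le_max_norm x (-y)

variable [CompleteSpace V]

theorem summable_of_norm_le {ι : Type*} {W : Type*} [NormedAddCommGroup W] {c : ι → W}
    (hc : Summable c) {f : ι → V} {C : ℝ} (hf : ∀ i, ‖f i‖ ≤ C * ‖c i‖) : Summable f := by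
  refine NonarchimedeanAddGroup.summable_of_tendsto_cofinite_zero ?_
  refine squeeze_zero_norm hf ?_
  simpa using (hc.tendsto_cofinite_zero.norm).const_mul C

/-- Dominated convergence for unconditional sums in ultrametric Banach spaces. -/
theorem tendsto_tsum_of_norm_le {ι : Type*} {W : Type*} [NormedAddCommGroup W] {c : ι → W}
    (hc : Summable c) {f : ℕ → ι → V} {g : ι → V} {C : ℝ}
    (hf : ∀ k i, ‖f k i‖ ≤ C * ‖c i‖) (hg : ∀ i, Tendsto (fun k => f k i) atTop (𝓝 (g i))) :
    Tendsto (fun k => ∑' i, f k i) atTop (𝓝 (∑' i, g i)) := by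
  have hgb : ∀ i, ‖g i‖ ≤ C * ‖c i‖ := fun i =>
    le_of_tendsto (hg i).norm (Eventually.of_forall fun k => hf k i)
  have hsf := fun k => summable_of_norm_le hc (hf k)
  have hsg := summable_of_norm_le hc hgb
  rw [Metric.tendsto_atTop]
  intro ε hε
  have hz : Tendsto (fun i => C * ‖c i‖) cofinite (𝓝 0) := by
    simpa using (hc.tendsto_cofinite_zero.norm).const_mul C
  -- Off this finite set the terms of both series have norm below ε/2; on it, finitely many termwise
  -- limits suffice. The ultrametric inequality bounds the sum by its largest term.
  have hfin : {i | ¬ C * ‖c i‖ < ε / 2}.Finite :=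
    hz.eventually (gt_mem_nhds (half_pos hε))
  have hev : ∀ᶠ k in atTop, ∀ i ∈ hfin.toFinset, ‖f k i - g i‖ < ε / 2 := by
    rw [eventually_all_finset]
    intro i _
    have := (hg i).eventually (Metric.ball_mem_nhds (g i) (half_pos hε))
    filter_upwards [this] with k hk
    simpa [dist_eq_norm] using hk
  obtain ⟨N, hN⟩ := eventually_atTop.1 hev
  refine ⟨N, fun k hk => ?_⟩
  rw [dist_eq_norm, ← (hsf k).tsum_sub hsg]
  refine lt_of_le_of_lt (IsUltrametricDist.norm_tsum_le_of_forall_le_of_nonneg (half_pos hε).le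
    fun i => ?_) (half_lt_self hε)
  by_cases hi : C * ‖c i‖ < ε / 2
  · refine (norm_sub_le_max_norm (f k i) (g i)).trans (max_le ?_ ?_)
    · exact (hf k i).trans hi.le
    · exact (hgb i).trans hi.le
  · exact (hN k hk i (by simpa using hi)).le

end Ultrametric

/-! ### Integers in a p-adic field -/

section PadicField

variable (p : ℕ) [Fact p.Prime] {K : Type*} [NontriviallyNormedField K] [NormedAlgebra ℚ_[p] K]

include p in
theorem norm_intCast_le_one (n : ℤ) : ‖(n : K)‖ ≤ 1 := by
  have : ((n : ℚ_[p]) • (1 : K)) = n := by simp [Algebra.smul_def]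
  rw [← this, norm_smul, norm_one, mul_one]
  exact_mod_cast Padic.norm_int_le_one n

include p in
theorem norm_natCast_le_one (n : ℕ) : ‖(n : K)‖ ≤ 1 := by
  exact_mod_cast norm_intCast_le_one p (K := K) n

include p in
theorem charZero_of_padic : CharZero K :=
  charZero_of_injective_algebraMap (algebraMap ℚ_[p] K).injective

theorem norm_prime_lt_one : ‖(p : K)‖ < 1 := by
  have : ((p : ℚ_[p]) • (1 : K)) = p := by simp [Algebra.smul_def]
  rw [← this, norm_smul, norm_one, mul_one]
  exact Padic.norm_p_lt_one

end PadicField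

/-! ### Powers of an operator on a generalized eigenvector -/

section NilpotentPerturbation

variable {K : Type*} [NontriviallyNormedField K] {V : Type*} [NormedAddCommGroup V]
  [NormedSpace K V]

-- Binomial expansion of G = γ + (G - γ), cut off at e. The range of summation is independent of m,
-- so limits in m can be taken termwise. The truncated exponent m - j is harmless, as the binomial
-- coefficient vanishes for j > m.
omit [NontriviallyNormedField K] [NormedAddCommGroup V] [NormedSpace K V] in
theorem end_pow_apply_eq_sum [Field K] [AddCommGroup V] [Module K V] (G : End K V) (γ : K)
    {e : ℕ} {v : V} (h : ((G - γ • 1) ^ e) v = 0) (m : ℕ) :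
    (G ^ m) v = ∑ j ∈ Finset.range e, ((m.choose j : K) * γ ^ (m - j)) • ((G - γ • 1) ^ j) v := by
  have hc : Commute (G - γ • 1) (γ • (1 : End K V)) := (Commute.one_right _).smul_right γ
  have h1 : (G ^ m) v = ∑ j ∈ Finset.range (m + 1),
      ((m.choose j : K) * γ ^ (m - j)) • ((G - γ • 1) ^ j) v := by
    conv_lhs => rw [← sub_add_cancel G (γ • 1), hc.add_pow]
    rw [LinearMap.sum_apply]
    refine Finset.sum_congr rfl fun j _ => ?_
    rw [smul_pow, one_pow, mul_smul_comm, mul_one, smul_mul_assoc, LinearMap.smul_apply,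
      ← Nat.cast_comm, ← nsmul_eq_mul, LinearMap.smul_apply, mul_comm, mul_smul, Nat.cast_smul_eq_nsmul]
  rw [h1]
  have h2 : Finset.range (m + 1) ⊆ Finset.range (max (m + 1) e) :=
    Finset.range_mono (le_max_left _ _)
  have h3 : Finset.range e ⊆ Finset.range (max (m + 1) e) := Finset.range_mono (le_max_right _ _)
  rw [Finset.sum_subset h2, ← Finset.sum_subset h3]
  · intro j _ hj
    have hj : e ≤ j := by simpa using hj
    rw [← Nat.sub_add_cancel hj, pow_add, Module.End.mul_apply, h, map_zero, smul_zero]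
  · intro j _ hj
    have hj : m < j := by simpa using hj
    rw [Nat.choose_eq_zero_of_lt hj, Nat.cast_zero, zero_mul, zero_smul]

theorem norm_pow_apply_le {G : End K V} {C : ℝ} (hC : 0 ≤ C) (hG : ∀ v, ‖G v‖ ≤ C * ‖v‖)
    (j : ℕ) (v : V) : ‖(G ^ j) v‖ ≤ C ^ j * ‖v‖ := by
  induction j with
  | zero => simp
  | succ j ih =>
    rw [pow_succ', Module.End.mul_apply]
    refine (hG _).trans ?_
    rw [pow_succ', mul_assoc]
    gcongr

theorem norm_sub_smul_one_pow_apply_le {G : End K V} {C : ℝ} (hC : 0 ≤ C)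
    (hG : ∀ v, ‖G v‖ ≤ C * ‖v‖) {γ : K} (hγ : ‖γ‖ ≤ 1) {e j : ℕ} (hj : j ≤ e) (v : V) :
    ‖((G - γ • 1) ^ j) v‖ ≤ (C + 1) ^ e * ‖v‖ := by
  have h1 : ∀ v, ‖(G - γ • 1) v‖ ≤ (C + 1) * ‖v‖ := by
    intro v
    rw [LinearMap.sub_apply, LinearMap.smul_apply, Module.End.one_apply, add_mul]
    refine (norm_sub_le _ _).trans (add_le_add (hG v) ?_)
    rw [norm_smul]
    gcongr
  refine (norm_pow_apply_le (by positivity) h1 j v).trans ?_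
  gcongr
  linarith

variable [IsUltrametricDist V]

/-- Binomial coefficients and powers of γ have norm at most 1, so the bound is uniform in m. This is
the domination needed to pass to the limit in sums over all weights at once. -/
theorem norm_end_pow_apply_le (p : ℕ) [Fact p.Prime] [NormedAlgebra ℚ_[p] K] {G : End K V} {C : ℝ}
    (hC : 0 ≤ C) (hG : ∀ v, ‖G v‖ ≤ C * ‖v‖) {γ : K} (hγ : ‖γ‖ ≤ 1) {e : ℕ} {v : V}
    (h : ((G - γ • 1) ^ e) v = 0) (m : ℕ) : ‖(G ^ m) v‖ ≤ (C + 1) ^ e * ‖v‖ := by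
  rw [end_pow_apply_eq_sum G γ h]
  refine norm_sum_le_of_forall_le _ (by positivity) fun j hj => ?_
  rw [norm_smul, norm_mul, norm_pow]
  have h1 := norm_natCast_le_one p (K := K) (m.choose j)
  have h2 : ‖γ‖ ^ (m - j) ≤ 1 := pow_le_one₀ (norm_nonneg _) hγ
  have h3 := norm_sub_smul_one_pow_apply_le hC hG hγ (Finset.mem_range.1 hj).le v
  calc _ ≤ 1 * 1 * ((C + 1) ^ e * ‖v‖) := by gcongr
    _ = _ := by ring

omit [IsUltrametricDist V] in
theorem tendsto_pow_apply_of_norm_lt_one (p : ℕ) [Fact p.Prime] [NormedAlgebra ℚ_[p] K]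
    {G : End K V} {γ : K} (hγ : ‖γ‖ < 1) {e : ℕ} {v : V} (h : ((G - γ • 1) ^ e) v = 0) :
    Tendsto (fun m => (G ^ m) v) atTop (𝓝 0) := by
  simp_rw [end_pow_apply_eq_sum G γ h]
  rw [← Finset.sum_const_zero (s := Finset.range e)]
  refine tendsto_finsetSum _ fun j _ => ?_
  rw [← zero_smul K (((G - γ • 1) ^ j) v)]
  refine Tendsto.smul ?_ tendsto_const_nhds
  refine squeeze_zero_norm (a := fun m => ‖γ‖ ^ (m - j)) (fun m => ?_) ?_
  · rw [norm_mul, norm_pow]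
    exact mul_le_of_le_one_left (by positivity) (norm_natCast_le_one p _)
  · exact (tendsto_pow_atTop_nhds_zero_of_lt_one (norm_nonneg _) hγ).comp
      (tendsto_sub_atTop_nat j)

end NilpotentPerturbation

/-! ### Limits along powers with exponent p^k -/

section PrimePowers

variable (p : ℕ) [Fact p.Prime] {K : Type*} [NontriviallyNormedField K] [NormedAlgebra ℚ_[p] K]

/-- From j · C(p^k, j) = p^k · C(p^k - 1, j - 1): the factor j is fixed while p^k tends to 0. -/
theorem norm_prime_pow_choose_tendsto {j : ℕ} (hj : j ≠ 0) :
    Tendsto (fun k : ℕ => (((p ^ k).choose j : ℕ) : K)) atTop (𝓝 0) := by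
  have := charZero_of_padic p (K := K)
  have hj0 : (j : K) ≠ 0 := Nat.cast_ne_zero.2 hj
  refine squeeze_zero_norm (a := fun k => ‖(j : K)‖⁻¹ * ‖(p : K)‖ ^ k) (fun k => ?_) ?_
  · obtain ⟨i, rfl⟩ := Nat.exists_eq_succ_of_ne_zero hj
    obtain ⟨q, hq⟩ := Nat.exists_eq_succ_of_ne_zero
      (pow_pos (Fact.out : p.Prime).pos k).ne'
    have h := Nat.add_one_mul_choose_eq q i
    rw [← Nat.succ_eq_add_one, ← hq] at h
    have h' := congrArg (fun n : ℕ => ‖(n : K)‖) h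
    simp only [Nat.cast_mul, norm_mul, Nat.cast_pow, norm_pow] at h'
    rw [inv_mul_eq_div, le_div_iff₀ (norm_pos_iff.2 hj0), Nat.succ_eq_add_one, ← h']
    exact mul_le_of_le_one_right (by positivity) (norm_natCast_le_one p _)
  · simpa using (tendsto_pow_atTop_nhds_zero_of_lt_one (norm_nonneg _)
      (norm_prime_lt_one p (K := K))).const_mul ‖(j : K)‖⁻¹

variable [IsUltrametricDist K]

/-- The middle binomial coefficients are divisible by p, and the top term y^p contains y² because p
≥ 2. -/
theorem norm_one_add_pow_prime_sub_one_le {y : K} (hy : ‖y‖ ≤ 1) :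
    ‖(1 + y) ^ p - 1‖ ≤ ‖y‖ * max ‖(p : K)‖ ‖y‖ := by
  have hp := (Fact.out : p.Prime)
  rw [add_comm, add_pow, Finset.sum_range_succ', add_sub_assoc]
  simp only [pow_zero, one_pow, mul_one, Nat.choose_zero_right, Nat.cast_one, sub_self, add_zero]
  refine norm_sum_le_of_forall_le _ (by positivity) fun j hj => ?_
  have hj := Finset.mem_range.1 hj
  rw [norm_mul, norm_pow, pow_succ', mul_assoc]
  gcongr
  rcases Nat.lt_or_ge (j + 1) p with hlt | hge
  · refine le_max_of_le_left ?_
    obtain ⟨q, hq⟩ := hp.dvd_choose_self (Nat.succ_ne_zero j) hlt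
    rw [hq, Nat.cast_mul, norm_mul]
    have h1 : ‖y‖ ^ j ≤ 1 := pow_le_one₀ (norm_nonneg _) hy
    have h2 := norm_natCast_le_one p (K := K) q
    calc _ ≤ 1 * (‖(p : K)‖ * 1) := by gcongr
      _ = _ := by ring
  · refine le_max_of_le_right ?_
    obtain rfl : j + 1 = p := by omega
    have h1 := norm_natCast_le_one (j + 1) (K := K) ((j + 1).choose (j + 1))
    have hj0 : j ≠ 0 := by rintro rfl; exact hp.one_lt.ne' rfl
    calc _ ≤ ‖y‖ ^ 1 * 1 := by
          refine mul_le_mul (pow_le_pow_of_le_one (norm_nonneg _) hy (by omega)) h1 (by positivity)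
            (by positivity)
      _ = _ := by simp

/-- Each p-th power shrinks the distance to 1 by the factor θ = max ‖p‖ ‖x - 1‖ < 1. -/
theorem tendsto_pow_prime_pow_one {x : K} (hx : ‖x - 1‖ < 1) :
    Tendsto (fun k : ℕ => x ^ p ^ k) atTop (𝓝 1) := by
  set θ := max ‖(p : K)‖ ‖x - 1‖ with hθ
  have hθ1 : θ < 1 := max_lt (norm_prime_lt_one p) hx
  have hθ0 : 0 ≤ θ := (norm_nonneg _).trans (le_max_right _ _)
  have key : ∀ k : ℕ, ‖x ^ p ^ k - 1‖ ≤ θ ^ k * ‖x - 1‖ := by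
    intro k
    induction k with
    | zero => simp
    | succ k ih =>
      have hle : ‖x ^ p ^ k - 1‖ ≤ ‖x - 1‖ :=
        ih.trans (mul_le_of_le_one_left (norm_nonneg _) (pow_le_one₀ hθ0 hθ1.le))
      have h := norm_one_add_pow_prime_sub_one_le p (hle.trans hx.le)
      rw [add_sub_cancel, ← pow_mul, ← pow_succ] at h
      calc _ ≤ _ := h
        _ ≤ (θ ^ k * ‖x - 1‖) * θ := by
          gcongr
          exact max_le_max le_rfl hle
        _ = _ := by ring
  rw [tendsto_iff_norm_sub_tendsto_zero]
  refine squeeze_zero (fun _ => norm_nonneg _) key ?_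
  simpa using (tendsto_pow_atTop_nhds_zero_of_lt_one hθ0 hθ1).mul_const ‖x - 1‖

/-- In the binomial expansion of G^(p^k) v the coefficients with j > 0 tend to 0 and the one with j
= 0 tends to 1. -/
theorem tendsto_pow_prime_pow_apply {V : Type*} [NormedAddCommGroup V] [NormedSpace K V]
    {G : End K V} {γ : K} (hγ : ‖γ - 1‖ < 1) {e : ℕ} {v : V} (h : ((G - γ • 1) ^ e) v = 0) :
    Tendsto (fun k : ℕ => (G ^ p ^ k) v) atTop (𝓝 v) := by
  rcases Nat.eq_zero_or_pos e with rfl | he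
  · obtain rfl : v = 0 := by simpa using h
    simp
  have hγ1 : ‖γ‖ ≤ 1 := by
    have := norm_add_le_max_norm (γ - 1) 1
    rw [sub_add_cancel, norm_one] at this
    exact this.trans (max_le hγ.le le_rfl)
  simp_rw [end_pow_apply_eq_sum G γ h]
  have hv : v = ∑ j ∈ Finset.range e, (if j = 0 then (1 : K) else 0) • ((G - γ • 1) ^ j) v := by
    simp [Finset.mem_range, he]
  conv => enter [3]; rw [hv]
  refine tendsto_finsetSum _ fun j _ => Tendsto.smul ?_ tendsto_const_nhds
  split_ifs with hj
  · subst hj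
    simpa using tendsto_pow_prime_pow_one p hγ
  · refine squeeze_zero_norm (fun k => ?_) (tendsto_zero_iff_norm_tendsto_zero.1 <|
      norm_prime_pow_choose_tendsto p (K := K) hj)
    rw [norm_mul, norm_pow]
    exact mul_le_of_le_one_right (by positivity) (pow_le_one₀ (norm_nonneg _) hγ1)

end PrimePowers

section

open Polynomial

/-! ### Polynomials separating ultrametric discs -/

section Separation

variable {K : Type*} [NontriviallyNormedField K]

theorem exists_norm_eval_le (g : K[X]) (B : ℝ) : ∃ C : ℝ, 0 ≤ C ∧ ∀ μ : K, ‖μ‖ ≤ B → ‖g.eval μ‖ ≤ C := by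
  induction g using Polynomial.induction_on' with
  | add f g hf hg =>
    obtain ⟨C, hC0, hC⟩ := hf
    obtain ⟨C', hC0', hC'⟩ := hg
    refine ⟨C + C', by positivity, fun μ hμ => ?_⟩
    rw [eval_add]
    exact (norm_add_le _ _).trans (add_le_add (hC μ hμ) (hC' μ hμ))
  | monomial n a =>
    refine ⟨‖a‖ * (max B 0) ^ n, by positivity, fun μ hμ => ?_⟩
    rw [eval_monomial, norm_mul, norm_pow]
    gcongr
    exact hμ.trans (le_max_left _ _)

variable [IsUltrametricDist K]

theorem norm_le_one_of_norm_sub_one_lt {a : K} (ha : ‖a - 1‖ < 1) : ‖a‖ ≤ 1 := by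
  have := norm_add_le_max_norm (a - 1) 1
  rw [sub_add_cancel, norm_one] at this
  exact this.trans (max_le ha.le le_rfl)

theorem norm_mul_sub_one_lt {a b : K} (ha : ‖a - 1‖ < 1) (hb : ‖b - 1‖ < 1) :
    ‖a * b - 1‖ < 1 := by
  have h : a * b - 1 = (a - 1) * b + (b - 1) := by ring
  rw [h]
  refine (norm_add_le_max_norm _ _).trans_lt (max_lt ?_ hb)
  rw [norm_mul]
  exact mul_lt_one_of_nonneg_of_lt_one_left (norm_nonneg _) ha (norm_le_one_of_norm_sub_one_lt hb)

theorem norm_pow_sub_one_lt {a : K} (ha : ‖a - 1‖ < 1) (n : ℕ) : ‖a ^ n - 1‖ < 1 := by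
  induction n with
  | zero => simp
  | succ n ih => rw [pow_succ]; exact norm_mul_sub_one_lt ih ha

/-- A polynomial close to `1` on a disc and small on finitely many disjoint discs of the same
radius. -/
theorem exists_polynomial_separating (l : K) (r : ℝ) (T : Finset K) (hT : ∀ c ∈ T, r < ‖c - l‖) :
    ∃ g : K[X], (∀ μ, ‖μ - l‖ ≤ r → ‖g.eval μ - 1‖ < 1) ∧
      ∀ c ∈ T, ∀ μ, ‖μ - c‖ ≤ r → ‖g.eval μ‖ < 1 := by
  classical
  -- The new centre a is the farthest from l. The factor (X - a)/(l - a) is within distance < 1 of 1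
  -- near l, has norm at most 1 on the earlier discs because their centres are no farther from l,
  -- and has norm at most q < 1 on the disc about a. There its n-th power beats the bound B for g.
  induction T using Finset.induction_on_max_value (fun c => ‖c - l‖) with
  | empty => exact ⟨1, by simp, by simp⟩
  | insert a T _ hmax ih =>
    obtain ⟨g, hg1, hg2⟩ := ih fun c hc => hT c (Finset.mem_insert_of_mem hc)
    have ha : r < ‖a - l‖ := hT a (Finset.mem_insert_self _ _)
    rcases lt_or_ge r 0 with hr | hr
    · exact ⟨0, fun μ hμ => absurd (hμ.trans_lt hr) (not_lt.2 (norm_nonneg _)),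
        fun c _ μ hμ => absurd (hμ.trans_lt hr) (not_lt.2 (norm_nonneg _))⟩
    have ha0 : 0 < ‖a - l‖ := hr.trans_lt ha
    have hal : l - a ≠ 0 := by
      rw [← norm_pos_iff, norm_sub_rev]; exact ha0
    set f : K[X] := C (l - a)⁻¹ * (X - C a) with hf
    have hfe : ∀ μ, f.eval μ = (l - a)⁻¹ * (μ - a) := by simp [hf]
    obtain ⟨B, hB0, hB⟩ := exists_norm_eval_le g (‖a‖ + r)
    set q := r / ‖a - l‖
    have hq1 : q < 1 := (div_lt_one ha0).2 ha
    have hq0 : 0 ≤ q := by positivity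
    obtain ⟨n, hn⟩ : ∃ n : ℕ, q ^ n * B < 1 := by
      have := (tendsto_pow_atTop_nhds_zero_of_lt_one hq0 hq1).mul_const B
      rw [zero_mul] at this
      exact (this.eventually (gt_mem_nhds one_pos)).exists
    refine ⟨f ^ n * g, fun μ hμ => ?_, fun c hc μ hμ => ?_⟩
    · rw [eval_mul, eval_pow]
      refine norm_mul_sub_one_lt (norm_pow_sub_one_lt ?_ n) (hg1 μ hμ)
      have : (l - a)⁻¹ * (μ - a) - 1 = (l - a)⁻¹ * (μ - l) := by field_simp; ring
      rw [hfe, this, norm_mul, norm_inv, norm_sub_rev l a, inv_mul_lt_iff₀ ha0, mul_one]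
      exact hμ.trans_lt ha
    · rw [eval_mul, eval_pow, norm_mul, norm_pow, hfe, norm_mul, norm_inv, norm_sub_rev l a]
      rcases Finset.mem_insert.1 hc with rfl | hcT
      · have h1 : ‖c - l‖⁻¹ * ‖μ - c‖ ≤ q := by
          rw [inv_mul_eq_div]; exact div_le_div_of_nonneg_right hμ ha0.le
        have h2 : ‖g.eval μ‖ ≤ B := hB μ (by
          calc ‖μ‖ = ‖c + (μ - c)‖ := by rw [add_sub_cancel]
            _ ≤ _ := (norm_add_le _ _).trans (by gcongr))
        calc _ ≤ q ^ n * B := by gcongr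
          _ < 1 := hn
      · have h1 : ‖a - l‖⁻¹ * ‖μ - a‖ ≤ 1 := by
          rw [inv_mul_le_iff₀ ha0, mul_one]
          have : μ - a = (μ - c) + ((c - l) - (a - l)) := by ring
          rw [this]
          refine (norm_add_le_max_norm _ _).trans (max_le (hμ.trans ha.le) ?_)
          exact (norm_sub_le_max_norm _ _).trans (max_le (hmax c hcT) le_rfl)
        exact mul_lt_one_of_nonneg_of_lt_one_right (pow_le_one₀ (by positivity) h1) (norm_nonneg _)
          (hg2 c hcT μ hμ)

/-- Reduction modulo p^h places the infinite set s + ℤ in the finitely many discs of radius ‖p‖^h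
about ν + j with 0 ≤ j < p^h. Two such discs coincide or are disjoint, so a point outside the disc
about l has its whole disc outside. -/
theorem exists_polynomial_separating_cosets (p : ℕ) [Fact p.Prime] [NormedAlgebra ℚ_[p] K]
    (s : Finset K) (l : K) (h : ℕ) :
    ∃ g : K[X], ∀ ν ∈ s, ∀ n : ℤ,
      (‖ν + n - l‖ ≤ ‖(p : K)‖ ^ h → ‖g.eval (ν + n) - 1‖ < 1) ∧
      (¬ ‖ν + n - l‖ ≤ ‖(p : K)‖ ^ h → ‖g.eval (ν + n)‖ < 1) := by
  classical
  set r := ‖(p : K)‖ ^ h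
  let T : Finset K := ((s ×ˢ Finset.range (p ^ h)).image fun x => x.1 + (x.2 : K)).filter
    fun c => r < ‖c - l‖
  obtain ⟨g, hg1, hg2⟩ := exists_polynomial_separating l r T fun c hc => (Finset.mem_filter.1 hc).2
  refine ⟨g, fun ν hν n => ⟨fun hn => hg1 _ hn, fun hn => ?_⟩⟩
  have hp : (0 : ℤ) < (p : ℤ) ^ h := pow_pos (by exact_mod_cast (Fact.out : p.Prime).pos) h
  obtain ⟨j, hj⟩ := Int.eq_ofNat_of_zero_le (Int.emod_nonneg n hp.ne')
  have hjlt : j < p ^ h := by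
    have := Int.emod_lt_of_pos n hp
    rw [hj] at this
    exact_mod_cast this
  have hdist : ‖(ν + n) - (ν + j)‖ ≤ r := by
    have h1 : (n : K) - j = (p : K) ^ h * ((n / (p : ℤ) ^ h : ℤ) : K) := by
      have h2 := Int.emod_add_mul_ediv n ((p : ℤ) ^ h)
      rw [hj] at h2
      have h3 := congrArg (fun z : ℤ => (z : K)) h2
      push_cast at h3
      rw [← h3, add_sub_cancel_left]
    rw [add_sub_add_left_eq_sub, h1, norm_mul, norm_pow]
    exact mul_le_of_le_one_right (by positivity) (norm_intCast_le_one p _)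
  refine hg2 (ν + j) ?_ _ hdist
  refine Finset.mem_filter.2 ⟨Finset.mem_image.2 ⟨(ν, j), ?_, rfl⟩, ?_⟩
  · simp [hν, hjlt]
  · by_contra hcon
    refine hn ?_
    have : ν + n - l = ((ν + n) - (ν + j)) + (ν + j - l) := by ring
    rw [this]
    exact (norm_add_le_max_norm _ _).trans (max_le hdist (not_lt.1 hcon))

end Separation

/-! ### Uniqueness and continuity of weight components -/

section WeightSum

variable {K : Type*} [NontriviallyNormedField K] {V : Type*}

/-- `v` is the sum of the `c μ`, where `c μ` is killed by `(D - μ)^e` and vanishes unless `μ` lies in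
one of the cosets `ν + ℤ` with `ν ∈ s`. -/
structure IsWeightSum [AddCommGroup V] [Module K V] [TopologicalSpace V] (D : End K V)
    (s : Finset K) (e : ℕ) (c : K → V) (v : V) : Prop where
  hasSum : HasSum c v
  ker : ∀ μ, ((D - μ • (1 : End K V)) ^ e : End K V) (c μ) = 0
  supp : ∀ μ, c μ ≠ 0 → ∃ ν ∈ s, ∃ n : ℤ, μ = ν + (n : K)

theorem IsWeightSum.mono [AddCommGroup V] [Module K V] [TopologicalSpace V] {D : End K V}
    {s s' : Finset K} {e e' : ℕ} {c : K → V} {v : V} (h : IsWeightSum D s e c v) (hs : s ⊆ s')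
    (he : e ≤ e') : IsWeightSum D s' e' c v where
  hasSum := h.hasSum
  ker μ := by
    rw [← Nat.sub_add_cancel he, pow_add, Module.End.mul_apply, h.ker, map_zero]
  supp μ hμ := by
    obtain ⟨ν, hν, n, hn⟩ := h.supp μ hμ
    exact ⟨ν, hs hν, n, hn⟩

/-- X - μ divides g - g(μ), so the exponent e is inherited by g(D). -/
theorem aeval_sub_eval_pow_apply [AddCommGroup V] [Module K V] {D : End K V} {μ : K} {e : ℕ}
    {v : V} (h : ((D - μ • 1) ^ e) v = 0) (g : K[X]) :
    ((aeval D g - g.eval μ • 1) ^ e) v = 0 := by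
  obtain ⟨q, hq⟩ := pow_dvd_pow_of_dvd (X_sub_C_dvd_sub_C_eval (a := μ) (p := g)) e
  have h1 := congrArg (aeval D) hq
  rw [mul_comm] at h1
  simp only [map_mul, map_pow, map_sub, aeval_X, aeval_C, Algebra.algebraMap_eq_smul_one] at h1
  rw [h1, Module.End.mul_apply, h, map_zero]

variable [NormedAddCommGroup V] [NormedSpace K V]

theorem continuous_aeval {D : End K V} (hD : Continuous D) (g : K[X]) :
    Continuous (aeval D g : End K V) := by
  induction g using Polynomial.induction_on with
  | C a =>
      rw [aeval_C, Algebra.algebraMap_eq_smul_one]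
      exact continuous_const_smul a
  | add f g hf hg => rw [map_add]; exact hf.add hg
  | monomial n a ih =>
    rw [pow_succ, ← mul_assoc, map_mul, aeval_X]
    exact ih.comp hD

theorem norm_apply_le_opNorm {D : End K V} (hD : Continuous D) (v : V) :
    ‖D v‖ ≤ ‖(⟨D, hD⟩ : V →L[K] V)‖ * ‖v‖ :=
  (⟨D, hD⟩ : V →L[K] V).le_opNorm v

variable [IsUltrametricDist V] [CompleteSpace V] [IsUltrametricDist K]
  (p : ℕ) [Fact p.Prime] [NormedAlgebra ℚ_[p] K]

/-- The part of a weight sum in a disc is a limit of polynomials in `D`. -/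
theorem exists_polynomial_tendsto_tsum_indicator {D : End K V} (hD : Continuous D) (s : Finset K)
    (e : ℕ) (l : K) (h : ℕ) : ∃ g : K[X], ∀ c v, IsWeightSum D s e c v →
      Tendsto (fun k : ℕ => (aeval D (g ^ p ^ k)) v) atTop
        (𝓝 (∑' μ, {μ | ‖μ - l‖ ≤ ‖(p : K)‖ ^ h}.indicator c μ)) := by
  classical
  obtain ⟨g, hg⟩ := exists_polynomial_separating_cosets p s l h
  refine ⟨g, fun c v hv => ?_⟩
  set G : End K V := aeval D g with hG
  have hGc : Continuous G := continuous_aeval hD g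
  set C : ℝ := ‖(⟨G, hGc⟩ : V →L[K] V)‖
  have hC : ∀ v, ‖G v‖ ≤ C * ‖v‖ := norm_apply_le_opNorm hGc
  have hC0 : 0 ≤ C := norm_nonneg _
  have hGk : ∀ k, Continuous (G ^ p ^ k) := fun k => by
    rw [hG, ← map_pow]; exact continuous_aeval hD _
  have h1 : ∀ k, (aeval D (g ^ p ^ k)) v = ∑' μ, (G ^ p ^ k) (c μ) := fun k => by
    rw [map_pow, ← hG]
    exact ((hv.hasSum.mapL (⟨G ^ p ^ k, hGk k⟩ : V →L[K] V)).tsum_eq).symm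
  simp_rw [h1]
  have hker : ∀ μ, ((G - g.eval μ • 1) ^ e) (c μ) = 0 := fun μ =>
    aeval_sub_eval_pow_apply (hv.ker μ) g
  have hle : ∀ μ, c μ ≠ 0 → ‖g.eval μ‖ ≤ 1 := by
    intro μ hμ
    obtain ⟨ν, hν, n, rfl⟩ := hv.supp μ hμ
    by_cases hn : ‖ν + n - l‖ ≤ ‖(p : K)‖ ^ h
    · exact norm_le_one_of_norm_sub_one_lt ((hg ν hν n).1 hn)
    · exact ((hg ν hν n).2 hn).le
  -- Since ‖g(μ)‖ ≤ 1 at every weight that occurs, (C + 1)^e dominates uniformly in k. Termwise, the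
  -- powers tend to the identity inside the disc and to 0 outside.
  refine tendsto_tsum_of_norm_le (C := (C + 1) ^ e) hv.hasSum.summable (fun k μ => ?_) fun μ => ?_
  · by_cases hμ : c μ = 0
    · simp [hμ]
    · exact norm_end_pow_apply_le p hC0 hC (hle μ hμ) (hker μ) _
  · by_cases hμ : c μ = 0
    · simp [Set.indicator_apply, hμ]
    obtain ⟨ν, hν, n, rfl⟩ := hv.supp μ hμ
    by_cases hn : ‖ν + n - l‖ ≤ ‖(p : K)‖ ^ h
    · rw [Set.indicator_of_mem (by exact hn)]
      exact tendsto_pow_prime_pow_apply p ((hg ν hν n).1 hn) (hker _)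
    · rw [Set.indicator_of_notMem (by exact hn)]
      exact (tendsto_pow_apply_of_norm_lt_one p ((hg ν hν n).2 hn) (hker _)).comp
        (tendsto_pow_atTop_atTop_of_one_lt (Fact.out : p.Prime).one_lt)

omit [NormedSpace K V] [IsUltrametricDist K] in
theorem tendsto_tsum_indicator_closedBall {c : K → V} (hc : Summable c) (l : K) :
    Tendsto (fun h : ℕ => ∑' μ, {μ | ‖μ - l‖ ≤ ‖(p : K)‖ ^ h}.indicator c μ) atTop (𝓝 (c l)) := by
  classical
  have h1 : c l = ∑' μ, (if μ = l then c μ else 0) := by simp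
  rw [h1]
  refine tendsto_tsum_of_norm_le (C := 1) hc (fun h μ => ?_) fun μ => ?_
  · rw [one_mul]
    exact norm_indicator_le_norm_self _ _
  · split_ifs with hμ
    · subst hμ
      simp
    · have hpos : 0 < ‖μ - l‖ := norm_pos_iff.2 (sub_ne_zero.2 hμ)
      have := (tendsto_pow_atTop_nhds_zero_of_lt_one (norm_nonneg _)
        (norm_prime_lt_one p (K := K))).eventually (gt_mem_nhds hpos)
      refine tendsto_const_nhds.congr' ?_
      filter_upwards [this] with h hh
      rw [Set.indicator_of_notMem]
      exact not_le.2 hh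

-- For every disc, both partial sums are the limit of the same polynomials in D applied to v, and
-- these do not depend on the decomposition. Letting the disc shrink isolates the component at l.
include p in
theorem IsWeightSum.unique {D : End K V} (hD : Continuous D) {s s' : Finset K} {e e' : ℕ}
    {c c' : K → V} {v : V} (h : IsWeightSum D s e c v) (h' : IsWeightSum D s' e' c' v) (l : K) :
    c l = c' l := by
  classical
  have h1 := h.mono (Finset.subset_union_left (s₂ := s')) (le_max_left e e')
  have h2 := h'.mono (Finset.subset_union_right (s₁ := s)) (le_max_right e e')
  refine tendsto_nhds_unique (tendsto_tsum_indicator_closedBall p h.hasSum.summable l) ?_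
  refine (tendsto_tsum_indicator_closedBall p h'.hasSum.summable l).congr fun i => ?_
  obtain ⟨g, hg⟩ := exists_polynomial_tendsto_tsum_indicator p hD (s ∪ s') (max e e') l i
  exact tendsto_nhds_unique (hg _ _ h2) (hg _ _ h1)

include p in
/-- The projections to the weight spaces are continuous. -/
theorem exists_continuous_weight_projection {D : End K V} (hD : Continuous D) {s : Finset K}
    {e : ℕ} (hs : ∀ v, ∃ c, IsWeightSum D s e c v) (l : K) :
    ∃ P : V →L[K] V, ∀ c v, IsWeightSum D s e c v → P v = c l := by
  -- Banach–Steinhaus is applied twice: here as k → ∞ for a fixed disc, and below as the discs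
  -- shrink to l.
  have h1 : ∀ h : ℕ, ∃ Q : V →L[K] V, ∀ c v, IsWeightSum D s e c v →
      Q v = ∑' μ, {μ | ‖μ - l‖ ≤ ‖(p : K)‖ ^ h}.indicator c μ := by
    intro h
    obtain ⟨g, hg⟩ := exists_polynomial_tendsto_tsum_indicator p hD s e l h
    choose c hc using hs
    let f : V → V := fun v => ∑' μ, {μ | ‖μ - l‖ ≤ ‖(p : K)‖ ^ h}.indicator (c v) μ
    refine ⟨continuousLinearMapOfTendsto (σ₁₂ := RingHom.id K) (l := atTop) (f := f)
      (fun k : ℕ => (⟨aeval D (g ^ p ^ k), continuous_aeval hD _⟩ : V →L[K] V))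
      (tendsto_pi_nhds.2 fun v => hg _ _ (hc v)), fun c' v hv => ?_⟩
    exact tendsto_nhds_unique (hg _ _ (hc v)) (hg _ _ hv)
  choose Q hQ using h1
  choose c hc using hs
  have h2 : ∀ c v, IsWeightSum D s e c v → Tendsto (fun h => Q h v) atTop (𝓝 (c l)) := by
    intro c v hv
    simp_rw [hQ _ c v hv]
    exact tendsto_tsum_indicator_closedBall p hv.hasSum.summable l
  refine ⟨continuousLinearMapOfTendsto (σ₁₂ := RingHom.id K) (l := atTop) (f := fun v => c v l)
      Q (tendsto_pi_nhds.2 fun v => h2 _ _ (hc v)), fun c' v hv => ?_⟩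
  exact tendsto_nhds_unique (h2 _ _ (hc v)) (h2 _ _ hv)

end WeightSum

end

/-! ### Finitely generated modules over noetherian Banach algebras -/

section BanachModules

variable {K : Type*} [NontriviallyNormedField K] {S : Type*} [NormedRing S] [NormedAlgebra K S]
  [CompleteSpace S] [IsNoetherianRing S]

variable (K) in
include K in
/-- Submodules of finite free modules over a noetherian Banach algebra are closed. -/
theorem isClosed_submodule_pi {t : ℕ} (L : Submodule S (Fin t → S)) :
    IsClosed (L : Set (Fin t → S)) := by
  set Lc := L.topologicalClosure with hLc
  have hcl : IsClosed (Lc : Set (Fin t → S)) := L.isClosed_topologicalClosure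
  have : CompleteSpace Lc := hcl.completeSpace_coe
  obtain ⟨r, f, hf⟩ := Module.Finite.exists_fin' S Lc
  have hfc : Continuous f := IsModuleTopology.continuous_of_linearMap f
  obtain ⟨C, hC0, hC⟩ := ContinuousLinearMap.exists_preimage_norm_le
    (⟨f.restrictScalars K, hfc⟩ : (Fin r → S) →L[K] Lc) hf
  -- The generators f(e_i) of the closure are moved into L by corrections f(x_i). This η makes the
  -- operator E built from the x_i have norm at most r/(r + 1) < 1. Then 1 - E is invertible, and
  -- the corrected generators y_i ∈ L still generate the closure.
  set η : ℝ := 1 / (C * (r + 1)) with hη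
  have hη0 : 0 < η := by positivity
  have h1 : ∀ i : Fin r, ∃ y ∈ L, ∃ x : Fin r → S,
      ((f x : Lc) : Fin t → S) = (f (Pi.single i 1) : Lc) - y ∧ ‖x‖ ≤ C * η := by
    intro i
    have hmem : ((f (Pi.single i 1) : Lc) : Fin t → S) ∈ closure (L : Set (Fin t → S)) :=
      (f (Pi.single i 1)).2
    obtain ⟨y, hy, hd⟩ := Metric.mem_closure_iff.1 hmem η hη0
    obtain ⟨x, hx, hxn⟩ := hC (f (Pi.single i 1) - ⟨y, L.le_topologicalClosure hy⟩)
    refine ⟨y, hy, x, congrArg Subtype.val hx, hxn.trans ?_⟩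
    gcongr
    rw [dist_eq_norm] at hd
    exact hd.le
  choose y hy x hx hxn using h1
  let E₀ : (Fin r → S) →ₗ[K] (Fin r → S) :=
    { toFun := fun a => ∑ i, a i • x i
      map_add' := fun a b => by simp [add_smul, Finset.sum_add_distrib]
      map_smul' := fun k a => by simp [Finset.smul_sum] }
  have hE : ∀ a, ‖E₀ a‖ ≤ (r * (C * η)) * ‖a‖ := by
    intro a
    change ‖∑ i, a i • x i‖ ≤ _
    refine (norm_sum_le _ _).trans ?_
    have : ∀ i ∈ Finset.univ, ‖a i • x i‖ ≤ (C * η) * ‖a‖ := fun i _ => by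
      refine (norm_smul_le _ _).trans ?_
      rw [mul_comm]
      gcongr
      · exact hxn i
      · exact norm_le_pi_norm a i
    refine (Finset.sum_le_card_nsmul _ _ _ this).trans ?_
    simp [mul_assoc]
  set E := E₀.mkContinuous _ hE
  have hE1 : ‖E‖ < 1 := by
    refine (LinearMap.mkContinuous_norm_le _ (by positivity) _).trans_lt ?_
    rw [hη]
    have : (r : ℝ) * (C * (1 / (C * (r + 1)))) = r / (r + 1) := by field_simp
    rw [this, div_lt_one (by positivity)]
    linarith
  refine isClosed_of_closure_subset fun z hz => ?_
  obtain ⟨a, ha⟩ := hf ⟨z, hz⟩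
  set b := ((Units.oneSub E hE1)⁻¹ : ((Fin r → S) →L[K] (Fin r → S))ˣ).val a
  have hb : a = b - ∑ i, b i • x i := by
    have h2 : (Units.oneSub E hE1).val b = a := by
      change ((Units.oneSub E hE1).val * ((Units.oneSub E hE1)⁻¹).val) a = a
      rw [Units.mul_inv]; rfl
    rw [← h2]; rfl
  have hfb : ∀ b : Fin r → S, f b = ∑ i, b i • f (Pi.single i 1) := by
    intro b
    conv_lhs => rw [← Finset.univ_sum_single b]
    rw [map_sum]
    refine Finset.sum_congr rfl fun i _ => ?_
    rw [← map_smul, ← Pi.single_smul, smul_eq_mul, mul_one]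
  have hz' : z = ∑ i, b i • y i := by
    have h3 := congrArg Subtype.val ha
    rw [hb, map_sub, map_sum, hfb b] at h3
    simp only [map_smul, Submodule.coe_sub, Submodule.coe_sum, Submodule.coe_smul, hx] at h3
    rw [← h3, ← Finset.sum_sub_distrib]
    refine Finset.sum_congr rfl fun i _ => ?_
    rw [smul_sub, sub_sub_cancel]
  rw [SetLike.mem_coe, hz']
  exact L.sum_mem fun i _ => L.smul_mem _ (hy i)

variable (K S) in
include K S in
/-- Submodules of finitely generated Banach modules over a noetherian Banach algebra are closed. -/
theorem isClosed_submodule_of_finite {N : Type*} [NormedAddCommGroup N] [NormedSpace K N]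
    [CompleteSpace N] [Module S N] [IsScalarTower K S N] [ContinuousSMul S N] [Module.Finite S N]
    (P : Submodule S N) : IsClosed (P : Set N) := by
  obtain ⟨r, f, hf⟩ := Module.Finite.exists_fin' S N
  have hfc : Continuous f := IsModuleTopology.continuous_of_linearMap f
  have hop : IsOpenMap f := ContinuousLinearMap.isOpenMap
    (⟨f.restrictScalars K, hfc⟩ : (Fin r → S) →L[K] N) hf
  rw [← (hop.isQuotientMap hfc hf).isClosed_preimage]
  exact isClosed_submodule_pi K (P.comap f)

omit [CompleteSpace S] [IsNoetherianRing S] in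
theorem isUltrametricDist_quotient {M : Type*} [NormedAddCommGroup M] [Module S M]
    [IsUltrametricDist M] (L : Submodule S M) : IsUltrametricDist (M ⧸ L) := by
  refine IsUltrametricDist.isUltrametricDist_of_forall_norm_add_le_max_norm fun x y => ?_
  refine le_of_forall_pos_le_add fun ε hε => ?_
  obtain ⟨a, rfl, ha⟩ := Submodule.Quotient.norm_mk_lt x hε
  obtain ⟨b, rfl, hb⟩ := Submodule.Quotient.norm_mk_lt y hε
  rw [← Submodule.Quotient.mk_add]
  refine (Submodule.Quotient.norm_mk_le L _).trans ((norm_add_le_max_norm a b).trans ?_)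
  exact max_le (ha.le.trans (by gcongr; exact le_max_left _ _))
    (hb.le.trans (by gcongr; exact le_max_right _ _))

omit [CompleteSpace S] [IsNoetherianRing S] in
theorem norm_smul_quotient_le {M : Type*} [NormedAddCommGroup M] [Module S M] [IsBoundedSMul S M]
    (L : Submodule S M) (s : S) (x : M ⧸ L) : ‖s • x‖ ≤ ‖s‖ * ‖x‖ := by
  refine le_of_forall_pos_le_add fun ε hε => ?_
  obtain ⟨a, rfl, ha⟩ := Submodule.Quotient.norm_mk_lt x
    (show 0 < ε / (‖s‖ + 1) by positivity)
  rw [← Submodule.Quotient.mk_smul]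
  refine (Submodule.Quotient.norm_mk_le L _).trans ((norm_smul_le s a).trans ?_)
  calc ‖s‖ * ‖a‖ ≤ ‖s‖ * (‖(Submodule.Quotient.mk a : M ⧸ L)‖ + ε / (‖s‖ + 1)) := by gcongr
    _ = ‖s‖ * ‖(Submodule.Quotient.mk a : M ⧸ L)‖ + ε * (‖s‖ / (‖s‖ + 1)) := by ring
    _ ≤ _ := by
      gcongr
      refine mul_le_of_le_one_right hε.le ?_
      rw [div_le_one (by positivity)]
      linarith

variable (K S) in
/-- The canonical topology of a finitely generated module over a noetherian Banach algebra is
given by a complete norm. -/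
theorem exists_banach_norm [IsUltrametricDist S] (N : Type*) [ag : AddCommGroup N] [Module K N]
    [Module S N] [IsScalarTower K S N] [τ : TopologicalSpace N] [IsModuleTopology S N]
    [Module.Finite S N] :
    ∃ nag : NormedAddCommGroup N, nag.toAddCommGroup = ag ∧
      nag.toMetricSpace.toPseudoMetricSpace.toUniformSpace.toTopologicalSpace = τ ∧
      @CompleteSpace N nag.toMetricSpace.toPseudoMetricSpace.toUniformSpace ∧
      @IsUltrametricDist N nag.toMetricSpace.toPseudoMetricSpace.toDist ∧
      (∀ (k : K) (v : N), nag.toNorm.norm (k • v) ≤ ‖k‖ * nag.toNorm.norm v) ∧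
      (∀ (s : S) (v : N), nag.toNorm.norm (s • v) ≤ ‖s‖ * nag.toNorm.norm v) := by
  obtain ⟨r, f, hf⟩ := Module.Finite.exists_fin' S N
  have hcl : IsClosed ((LinearMap.ker f : Submodule S (Fin r → S)) : Set (Fin r → S)) :=
    isClosed_submodule_pi K _
  let Q := (Fin r → S) ⧸ LinearMap.ker f
  let e : N ≃ₗ[S] Q := (f.quotKerEquivOfSurjective hf).symm
  have hQ : IsModuleTopology S Q := inferInstance
  have : ContinuousAdd N := IsModuleTopology.toContinuousAdd S N
  have he : Continuous e := IsModuleTopology.continuous_of_linearMap e.toLinearMap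
  have he' : Continuous e.symm := IsModuleTopology.continuous_of_linearMap e.symm.toLinearMap
  have heK : ∀ (k : K) (v : N), e (k • v) = k • e v := fun k v => by
    rw [← algebraMap_smul S k v, map_smul, algebraMap_smul]
  have hind : Topology.IsInducing e := (Homeomorph.mk e.toEquiv he he').isInducing
  -- The norm is pulled back from S^r / ker f, which is complete because ker f is closed. Its group
  -- structure and topology are equal to the given ones, so they can be substituted wherever a norm
  -- is needed.
  let nag : NormedAddCommGroup N := NormedAddCommGroup.induced N Q e.toLinearMap e.injective
  have hnorm : ∀ v : N, nag.toNorm.norm v = ‖e v‖ := fun _ => rfl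
  refine ⟨nag, rfl, ?_, ?_, ?_, ?_, ?_⟩
  · exact hind.eq_induced.symm
  · have hiso : Isometry e := Isometry.of_dist_eq fun _ _ => rfl
    exact (hiso.isUniformInducing.completeSpace_congr e.surjective).2 inferInstance
  · have := isUltrametricDist_quotient (LinearMap.ker f)
    exact ⟨fun x y z => dist_triangle_max (e x) (e y) (e z)⟩
  · intro k v
    rw [hnorm, hnorm, heK]
    exact norm_smul_le k (e v)
  · intro s v
    rw [hnorm, hnorm, map_smul]
    exact norm_smul_quotient_le _ s (e v)

end BanachModules

/-! ### Density of threads in towers of complete metric spaces -/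

section MittagLeffler

theorem exists_partial_thread {E : ℕ → Type*} [∀ n, Nonempty (E n)] (T : ∀ n, E (n + 1) → E n)
    (n : ℕ) (y : E n) : ∃ m : ∀ k, E k, (∀ k < n, T k (m (k + 1)) = m k) ∧ m n = y := by
  classical
  induction n with
  | zero => exact ⟨Function.update (fun k => Classical.arbitrary _) 0 y, by simp, by simp⟩
  | succ n ih =>
    obtain ⟨m, hm, hmn⟩ := ih (T n y)
    refine ⟨Function.update m (n + 1) y, fun k hk => ?_, by simp⟩
    rcases Nat.lt_succ_iff_lt_or_eq.1 hk with hlt | rfl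
    · rw [Function.update_of_ne (by omega), Function.update_of_ne (by omega)]
      exact hm k hlt
    · rw [Function.update_self, Function.update_of_ne (by omega), hmn]

/-- A small change of the n-th coordinate propagates downwards through finitely many continuous
maps. Coordinates above n carry no condition. -/
theorem exists_partial_thread_near {E : ℕ → Type*} [∀ n, MetricSpace (E n)]
    (T : ∀ n, E (n + 1) → E n) (hc : ∀ n, Continuous (T n)) (n : ℕ) (m : ∀ k, E k)
    (hm : ∀ k < n, T k (m (k + 1)) = m k) {ε : ℝ} (hε : 0 < ε) :
    ∃ δ > 0, ∀ y : E n, dist y (m n) < δ → ∃ m' : ∀ k, E k,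
      (∀ k < n, T k (m' (k + 1)) = m' k) ∧ m' n = y ∧ ∀ k ≤ n, dist (m k) (m' k) < ε := by
  classical
  induction n with
  | zero =>
    refine ⟨ε, hε, fun y hy => ⟨Function.update m 0 y, by simp, by simp, fun k hk => ?_⟩⟩
    obtain rfl : k = 0 := by omega
    rwa [Function.update_self, dist_comm]
  | succ n ih =>
    obtain ⟨δ, hδ, h⟩ := ih fun k hk => hm k (by omega)
    obtain ⟨δ', hδ', h'⟩ := Metric.continuous_iff.1 (hc n) (m (n + 1)) δ hδ
    refine ⟨min δ' ε, lt_min hδ' hε, fun y hy => ?_⟩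
    have h1 := h' y (hy.trans_le (min_le_left _ _))
    rw [hm n (by omega)] at h1
    obtain ⟨m', hm', hm'n, hd⟩ := h (T n y) h1
    refine ⟨Function.update m' (n + 1) y, fun k hk => ?_, by simp, fun k hk => ?_⟩
    · rcases Nat.lt_succ_iff_lt_or_eq.1 hk with hlt | rfl
      · rw [Function.update_of_ne (by omega), Function.update_of_ne (by omega)]
        exact hm' k hlt
      · rw [Function.update_self, Function.update_of_ne (by omega), hm'n]
    · rcases Nat.le_succ_iff.1 hk with hle | rfl
      · rw [Function.update_of_ne (by omega)]
        exact hd k hle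
      · rw [Function.update_self, dist_comm]
        exact hy.trans_le (min_le_right _ _)

/-- A partial thread is prolonged one level at a time, each time at the cost of moving the earlier
coordinates by at most ε/2^(i+1). These corrections are summable with total ε, so the coordinates
converge, and the limit is a full thread by continuity. -/
theorem exists_thread_near {E : ℕ → Type*} [∀ n, MetricSpace (E n)] [∀ n, CompleteSpace (E n)]
    [∀ n, Nonempty (E n)] (T : ∀ n, E (n + 1) → E n) (hc : ∀ n, Continuous (T n))
    (hd : ∀ n, DenseRange (T n)) (n : ℕ) (x : E n) {ε : ℝ} (hε : 0 < ε) :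
    ∃ m : ∀ k, E k, (∀ k, T k (m (k + 1)) = m k) ∧ dist x (m n) ≤ ε := by
  have step : ∀ (i : ℕ) (m : {m : ∀ k, E k // ∀ k < n + i, T k (m (k + 1)) = m k}),
      ∃ m' : {m : ∀ k, E k // ∀ k < n + (i + 1), T k (m (k + 1)) = m k},
        ∀ k ≤ n + i, dist (m.1 k) (m'.1 k) ≤ ε / 2 / 2 ^ i := by
    intro i m
    obtain ⟨δ, hδ, h⟩ := exists_partial_thread_near T hc (n + i) m.1 m.2
      (show 0 < ε / 2 / 2 ^ i by positivity)
    obtain ⟨z, hz⟩ := (hd (n + i)).exists_dist_lt (m.1 (n + i)) hδ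
    rw [dist_comm] at hz
    obtain ⟨m', hm', hm'n, hm'd⟩ := h _ hz
    classical
    refine ⟨⟨Function.update m' (n + i + 1) z, fun k hk => ?_⟩, fun k hk => ?_⟩
    · rcases Nat.lt_succ_iff_lt_or_eq.1 (show k < (n + i) + 1 from hk) with hlt | rfl
      · rw [Function.update_of_ne (by omega), Function.update_of_ne (by omega)]
        exact hm' k hlt
      · rw [Function.update_self, Function.update_of_ne (by omega), hm'n]
    · dsimp only
      rw [Function.update_of_ne (by omega)]
      exact (hm'd k hk).le
  choose f hf using step
  obtain ⟨m₀, hm₀, hm₀n⟩ := exists_partial_thread T n x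
  let u : ∀ i, {m : ∀ k, E k // ∀ k < n + i, T k (m (k + 1)) = m k} :=
    fun i => Nat.rec ⟨m₀, hm₀⟩ f i
  have hu : ∀ i, ∀ k ≤ n + i, dist ((u i).1 k) ((u (i + 1)).1 k) ≤ ε / 2 / 2 ^ i :=
    fun i k hk => hf i (u i) k hk
  have hlim : ∀ k, ∃ a, Tendsto (fun i => (u (i + k)).1 k) atTop (𝓝 a) := by
    intro k
    -- Coordinate k is controlled only once k ≤ n + i, hence the shift by k.
    refine cauchySeq_tendsto_of_complete (cauchySeq_of_le_geometric_two (C := ε) fun i => ?_)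
    have h1 := hu (i + k) k (by omega)
    rw [show i + 1 + k = i + k + 1 by ring]
    refine h1.trans ?_
    gcongr
    · norm_num
    · omega
  choose a ha using hlim
  have ha' : ∀ k, Tendsto (fun i => (u i).1 k) atTop (𝓝 (a k)) := fun k =>
    (tendsto_add_atTop_iff_nat (f := fun i => (u i).1 k) k).1 (ha k)
  refine ⟨a, fun k => ?_, ?_⟩
  · refine tendsto_nhds_unique (((hc k).tendsto _).comp (ha' (k + 1))) ((ha' k).congr' ?_)
    filter_upwards [eventually_gt_atTop k] with i hi
    exact ((u i).2 k (by omega)).symm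
  · have h0 : (u 0).1 n = x := hm₀n
    rw [← h0]
    exact dist_le_of_le_geometric_two_of_tendsto₀ (fun i => hu i n (by omega)) (ha' n)

/-- The projections of a tower of completely metrizable spaces whose transition maps have dense
image have dense image. -/
theorem dense_thread_values {E : ℕ → Type*} [∀ n, TopologicalSpace (E n)]
    [∀ n, TopologicalSpace.IsCompletelyMetrizableSpace (E n)]
    [∀ n, Nonempty (E n)] (T : ∀ n, E (n + 1) → E n) (hc : ∀ n, Continuous (T n))
    (hd : ∀ n, DenseRange (T n)) (n : ℕ) :
    Dense {x : E n | ∃ m : ∀ k, E k, (∀ k, T k (m (k + 1)) = m k) ∧ m n = x} := by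
  let _ := fun n => TopologicalSpace.upgradeIsCompletelyMetrizable (E n)
  rw [Metric.dense_iff]
  intro x r hr
  obtain ⟨m, hm, hmn⟩ := exists_thread_near T hc hd n x (half_pos hr)
  refine ⟨m n, ?_, m, hm, rfl⟩
  rw [Metric.mem_ball, dist_comm]
  linarith

end MittagLeffler

/-! ### Bounded maps out of the completed tensor product -/

section TensorNorm

variable {K : Type*} [NontriviallyNormedField K]

theorem exists_tensor_presentation {U V W : Type*} [NormedAddCommGroup U] [NormedSpace K U]
    [NormedAddCommGroup V] [NormedSpace K V] [NormedAddCommGroup W] [NormedSpace K W]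
    (z : U ⊗[K] (V ⊗[K] W)) : ∃ (r : ℕ) (a : Fin r → U) (h : Fin r → V) (b : Fin r → W),
      z = ∑ i, a i ⊗ₜ[K] (h i ⊗ₜ[K] b i) := by
  have hadd : ∀ z z' : U ⊗[K] (V ⊗[K] W),
      (∃ (r : ℕ) (a : Fin r → U) (h : Fin r → V) (b : Fin r → W),
        z = ∑ i, a i ⊗ₜ[K] (h i ⊗ₜ[K] b i)) →
      (∃ (r : ℕ) (a : Fin r → U) (h : Fin r → V) (b : Fin r → W),
        z' = ∑ i, a i ⊗ₜ[K] (h i ⊗ₜ[K] b i)) →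
      ∃ (r : ℕ) (a : Fin r → U) (h : Fin r → V) (b : Fin r → W),
        z + z' = ∑ i, a i ⊗ₜ[K] (h i ⊗ₜ[K] b i) := by
    rintro _ _ ⟨r, a, h, b, rfl⟩ ⟨r', a', h', b', rfl⟩
    refine ⟨r + r', Fin.append a a', Fin.append h h', Fin.append b b', ?_⟩
    simp [Fin.sum_univ_add]
  induction z using TensorProduct.induction_on with
  | zero => exact ⟨0, 0, 0, 0, by simp⟩
  | tmul a y =>
    induction y using TensorProduct.induction_on with
    | zero => exact ⟨0, 0, 0, 0, by simp⟩
    | tmul h b => exact ⟨1, fun _ => a, fun _ => h, fun _ => b, by simp⟩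
    | add y y' hy hy' => rw [TensorProduct.tmul_add]; exact hadd _ _ hy hy'
  | add z z' hz hz' => exact hadd _ _ hz hz'

theorem exists_tensor_presentation_lt {U V W : Type*} [NormedAddCommGroup U] [NormedSpace K U]
    [NormedAddCommGroup V] [NormedSpace K V] [NormedAddCommGroup W] [NormedSpace K W]
    (z : U ⊗[K] (V ⊗[K] W)) {B : ℝ} (hB : tensorNorm z < B) :
    ∃ (r : ℕ) (a : Fin r → U) (h : Fin r → V) (b : Fin r → W),
      z = ∑ i, a i ⊗ₜ[K] (h i ⊗ₜ[K] b i) ∧ ∀ i, ‖a i‖ * ‖h i‖ * ‖b i‖ ≤ B := by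
  have hne : {c : ℝ | 0 ≤ c ∧ ∃ (r : ℕ) (a : Fin r → U) (h : Fin r → V) (b : Fin r → W),
    z = ∑ i, a i ⊗ₜ[K] (h i ⊗ₜ[K] b i) ∧ ∀ i, ‖a i‖ * ‖h i‖ * ‖b i‖ ≤ c}.Nonempty := by
    obtain ⟨r, a, h, b, rfl⟩ := exists_tensor_presentation z
    refine ⟨∑ i, ‖a i‖ * ‖h i‖ * ‖b i‖, by positivity, r, a, h, b, rfl, fun i => ?_⟩
    exact Finset.single_le_sum (f := fun i => ‖a i‖ * ‖h i‖ * ‖b i‖)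
      (fun i _ => by positivity) (Finset.mem_univ i)
  obtain ⟨c, ⟨_, r, a, h, b, hz, hc⟩, hlt⟩ := exists_lt_of_csInf_lt hne hB
  exact ⟨r, a, h, b, hz, fun i => (hc i).trans hlt.le⟩

theorem tensorNorm_nonneg {U V W : Type*} [NormedAddCommGroup U] [NormedSpace K U]
    [NormedAddCommGroup V] [NormedSpace K V] [NormedAddCommGroup W] [NormedSpace K W]
    (z : U ⊗[K] (V ⊗[K] W)) : 0 ≤ tensorNorm z :=
  Real.sInf_nonneg fun _ hc => hc.1

variable {X : Type*} [NormedRing X] [NormedAlgebra K X]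

/-- A trilinear map which is bounded on pure tensors is bounded for the norm of the image under
multiplication. -/
theorem IsCompletedTensorDecomposition.exists_norm_le {U V W : Subalgebra K X}
    (hX : IsCompletedTensorDecomposition U V W) {N : Type*} [NormedAddCommGroup N]
    [IsUltrametricDist N] [NormedSpace K N] (Φ : (U ⊗[K] (V ⊗[K] W)) →ₗ[K] N) {C : ℝ} (hC0 : 0 ≤ C)
    (hC : ∀ a h b, ‖Φ (a ⊗ₜ[K] (h ⊗ₜ[K] b))‖ ≤ C * (‖a‖ * ‖h‖ * ‖b‖)) :
    ∃ C' : ℝ, ∀ z, ‖Φ z‖ ≤ C' * ‖tripleMul U V W z‖ := by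
  obtain ⟨-, C', hC'⟩ := hX
  refine ⟨C * C', fun z => ?_⟩
  have h1 : ‖Φ z‖ ≤ C * tensorNorm z := by
    refine le_of_forall_pos_le_add fun ε hε => ?_
    obtain ⟨r, a, h, b, hz, hb⟩ := exists_tensor_presentation_lt z
      (lt_add_of_pos_right (tensorNorm z) (show 0 < ε / (C + 1) by positivity))
    have h2 : ‖Φ z‖ ≤ C * (tensorNorm z + ε / (C + 1)) := by
      conv_lhs => rw [hz, map_sum]
      refine norm_sum_le_of_forall_le _ ?_ fun i _ => ?_
      · have := tensorNorm_nonneg z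
        positivity
      · exact (hC _ _ _).trans (mul_le_mul_of_nonneg_left (hb i) hC0)
    refine h2.trans ?_
    rw [mul_add]
    gcongr
    rw [mul_div_assoc', div_le_iff₀ (by positivity)]
    nlinarith
  calc _ ≤ _ := h1
    _ ≤ C * (C' * ‖tripleMul U V W z‖) := by gcongr; exact hC' z
    _ = _ := by ring

end TensorNorm

/-! ### From finite-dimensional spans to finite generation over a closure -/

section Lifting

variable {K : Type*} [NontriviallyNormedField K] [CompleteSpace K]

/-- A linear section of K^t → span(u) is automatically continuous, the span being finite-dimensional
over the complete field K. -/
theorem exists_bounded_coordinates {N : Type*} [NormedAddCommGroup N] [NormedSpace K N] {t : ℕ}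
    (u : Fin t → N) : ∃ C : ℝ, 0 ≤ C ∧ ∀ x ∈ Submodule.span K (Set.range u), ∃ c : Fin t → K,
      ∑ l, c l • u l = x ∧ ∀ l, ‖c l‖ ≤ C * ‖x‖ := by
  let π : (Fin t → K) →ₗ[K] N := Fintype.linearCombination K u
  have hr : LinearMap.range π = Submodule.span K (Set.range u) := Fintype.range_linearCombination K u
  obtain ⟨σ, hσ⟩ := π.rangeRestrict.exists_rightInverse_of_surjective π.range_rangeRestrict
  refine ⟨‖σ.toContinuousLinearMap‖, norm_nonneg _, fun x hx => ?_⟩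
  rw [← hr] at hx
  refine ⟨σ ⟨x, hx⟩, ?_, fun l => ?_⟩
  · exact congrArg Subtype.val (LinearMap.congr_fun hσ ⟨x, hx⟩)
  · exact (norm_le_pi_norm _ l).trans (σ.toContinuousLinearMap.le_opNorm ⟨x, hx⟩)

variable {S : Type*} [NormedRing S] [NormedAlgebra K S] [CompleteSpace S] [IsUltrametricDist S]

/-- If `V · W · w` lies in the span of finitely many vectors, then these generate a `U`-submodule
containing `S · w`. -/
theorem IsCompletedTensorDecomposition.smul_mem_span {U V W : Subalgebra K S} [CompleteSpace U]
    (hX : IsCompletedTensorDecomposition U V W) {N : Type*} [NormedAddCommGroup N]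
    [NormedSpace K N] [Module S N] [IsScalarTower K S N] (hN : ∀ (s : S) (v : N), ‖s • v‖ ≤ ‖s‖ * ‖v‖)
    {w : N} {t : ℕ} {u : Fin t → N}
    (hw : ∀ h ∈ V, ∀ b ∈ W, h • b • w ∈ Submodule.span K (Set.range u)) (s : S) :
    s • w ∈ Submodule.span U (Set.range u) := by
  obtain ⟨C₁, hC₁0, hC₁⟩ := exists_bounded_coordinates (K := K) u
  obtain ⟨hdense, C₂, hC₂⟩ := hX
  have hC₂' : 0 ≤ |C₂| := abs_nonneg _
  have hbs : IsBoundedSMul S N := IsBoundedSMul.of_norm_smul_le hN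
  let φ : (Fin t → U) → N := fun y => ∑ l, (y l : S) • u l
  have hφc : Continuous φ := by fun_prop
  -- The relation ∑ y_l u_l = s w is closed, so G is complete. Its projection to S hits the dense
  -- image of U ⊗ V ⊗ W with control of norms. Successive approximation, as in the open mapping
  -- theorem, then makes the projection surjective.
  let G : AddSubgroup ((Fin t → U) × S) :=
    { carrier := {x | φ x.1 = x.2 • w}
      add_mem' := fun {x y} hx hy => by
        simp only [Set.mem_ofPred_eq, φ] at hx hy ⊢
        simp [add_smul, Finset.sum_add_distrib, hx, hy]
      zero_mem' := by simp [φ]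
      neg_mem' := fun {x} hx => by
        simp only [Set.mem_ofPred_eq, φ] at hx ⊢
        simp [neg_smul, hx] }
  have hGcl : IsClosed (G : Set ((Fin t → U) × S)) :=
    isClosed_eq (hφc.comp continuous_fst) (continuous_snd.smul continuous_const)
  have : CompleteSpace G := hGcl.completeSpace_coe
  let f : NormedAddGroupHom G S :=
    { toFun := fun x => x.1.2
      map_add' := fun _ _ => rfl
      bound' := ⟨1, fun x => by rw [one_mul]; exact norm_snd_le x.1⟩ }
  set D : AddSubgroup S := (LinearMap.range (tripleMul U V W)).toAddSubgroup
  -- The product bounds the coefficients y, and the added 1 bounds the coordinate s. Using |C₂| + 1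
  -- in place of C₂ leaves room to choose a presentation that nearly attains the infimum.
  set C : ℝ := C₁ * ‖w‖ * (|C₂| + 1) + 1
  have hC0 : 0 < C := by positivity
  have hsurj : f.SurjectiveOnWith D C := by
    rintro s ⟨z, rfl⟩
    rcases eq_or_ne (tripleMul U V W z) 0 with h0 | h0
    · exact ⟨0, by simp [h0], by simp [h0]⟩
    set s := tripleMul U V W z with hs
    have hs0 : 0 < ‖s‖ := norm_pos_iff.2 h0
    have hlt : tensorNorm z < (|C₂| + 1) * ‖s‖ := by
      refine (hC₂ z).trans_lt ?_
      rw [← hs]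
      have := mul_le_mul_of_nonneg_right (le_abs_self C₂) hs0.le
      linarith
    obtain ⟨r, a, h, b, hz, hb⟩ := exists_tensor_presentation_lt z hlt
    have hmem := fun i => hC₁ _ (hw (h i) (h i).2 (b i) (b i).2)
    choose c hc hcn using hmem
    let y : Fin t → U := fun l => ∑ i, c i l • a i
    have hy : φ y = s • w := by
      have h1 : s = ∑ i, (a i : S) * ((h i : S) * (b i : S)) := by
        rw [hs, hz, map_sum]; rfl
      simp only [φ, y]
      rw [h1, Finset.sum_smul]
      simp only [AddSubmonoidClass.coe_finsetSum, Finset.sum_smul]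
      rw [Finset.sum_comm]
      refine Finset.sum_congr rfl fun i _ => ?_
      rw [mul_smul, mul_smul, ← hc i, Finset.smul_sum]
      refine Finset.sum_congr rfl fun l _ => ?_
      rw [Subalgebra.coe_smul, smul_assoc, smul_comm]
    refine ⟨⟨(y, s), hy⟩, rfl, ?_⟩
    have hyn : ‖y‖ ≤ C₁ * ‖w‖ * (|C₂| + 1) * ‖s‖ := by
      refine (pi_norm_le_iff_of_nonneg (by positivity)).2 fun l => ?_
      refine norm_sum_le_of_forall_le (V := U) _ (by positivity) fun i _ => ?_
      rw [norm_smul]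
      have h2 : ‖c i l‖ ≤ C₁ * (‖(h i : S)‖ * (‖(b i : S)‖ * ‖w‖)) := by
        refine (hcn i l).trans ?_
        gcongr
        refine (hN _ _).trans ?_
        gcongr
        exact hN _ _
      calc _ ≤ C₁ * (‖(h i : S)‖ * (‖(b i : S)‖ * ‖w‖)) * ‖a i‖ := by gcongr
        _ = C₁ * ‖w‖ * (‖a i‖ * ‖h i‖ * ‖b i‖) := by
            change _ = C₁ * ‖w‖ * (‖a i‖ * ‖(h i : S)‖ * ‖(b i : S)‖)
            ring
        _ ≤ C₁ * ‖w‖ * ((|C₂| + 1) * ‖s‖) :=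
            mul_le_mul_of_nonneg_left (hb i) (by positivity)
        _ = _ := by ring
    change max ‖y‖ ‖s‖ ≤ C * ‖s‖
    refine max_le ?_ ?_
    · refine hyn.trans ?_
      simp only [C]; linarith
    · refine le_mul_of_one_le_left hs0.le ?_
      have : 0 ≤ C₁ * ‖w‖ * (|C₂| + 1) := by positivity
      simp only [C]; linarith
  have hcl := controlled_closure_of_complete hC0 one_pos hsurj
  obtain ⟨⟨⟨y, s'⟩, hy⟩, rfl, -⟩ := hcl s (by
    have : closure (Set.range (tripleMul U V W)) = Set.univ := hdense.closure_range
    change s ∈ closure (Set.range (tripleMul U V W))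
    rw [this]; trivial)
  have hy' : φ y = s' • w := hy
  change s' • w ∈ _
  rw [← hy']
  exact Submodule.sum_mem _ fun l _ => Submodule.smul_mem _ (y l) (Submodule.subset_span ⟨l, rfl⟩)

end Lifting

/-! ### Homogeneous elements shift weights -/

section WeightAlgebra

variable {K : Type*} [Field K]

theorem map_sub_smul_one_pow {V W : Type*} [AddCommGroup V] [Module K V] [AddCommGroup W]
    [Module K W] {D : End K V} {D' : End K W} {f : V →ₗ[K] W} {μ μ' : K}
    (h : ∀ v, f ((D - μ • (1 : End K V)) v) = (D' - μ' • (1 : End K W)) (f v)) (e : ℕ) (v : V) :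
    f (((D - μ • (1 : End K V)) ^ e) v) = ((D' - μ' • (1 : End K W)) ^ e) (f v) := by
  induction e generalizing v with
  | zero => simp
  | succ e ih => rw [pow_succ, Module.End.mul_apply, ih, h, pow_succ, Module.End.mul_apply]

theorem map_mem_maxGenEigenspace {V W : Type*} [AddCommGroup V] [Module K V] [AddCommGroup W]
    [Module K W] {D : End K V} {D' : End K W} {f : V →ₗ[K] W} (h : ∀ v, f (D v) = D' (f v)) {μ : K}
    {v : V} (hv : v ∈ D.maxGenEigenspace μ) : f v ∈ D'.maxGenEigenspace μ := by
  rw [Module.End.mem_maxGenEigenspace] at hv ⊢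
  obtain ⟨k, hk⟩ := hv
  exact ⟨k, by rw [← map_sub_smul_one_pow (f := f) (D := D) (μ := μ) (by simp [h]), hk, map_zero]⟩

variable {S : Type*} [Ring S] [Algebra K S] {N : Type*} [AddCommGroup N] [Module K N] [Module S N]
  [IsScalarTower K S N]

/-- The relation [δ, x] = n x amounts to (δ - μ - n) x = x (δ - μ), which is then iterated. -/
theorem lsmul_sub_pow_smul {δ x : S} {n : K} (hx : δ * x - x * δ = n • x) (μ : K) (e : ℕ) (v : N) :
    ((Algebra.lsmul K K N δ - (μ + n) • (1 : End K N)) ^ e) (x • v) =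
      x • ((Algebra.lsmul K K N δ - μ • (1 : End K N)) ^ e) v := by
  refine (map_sub_smul_one_pow (f := Algebra.lsmul K K N x) (D := Algebra.lsmul K K N δ)
    (D' := Algebra.lsmul K K N δ) (fun v => ?_) e v).symm
  simp only [LinearMap.sub_apply, LinearMap.smul_apply, Module.End.one_apply, Algebra.lsmul_coe,
    smul_sub]
  have h1 : δ * x = x * δ + n • x := by rw [← hx]; abel
  rw [← mul_smul δ, h1, add_smul, mul_smul, smul_assoc, add_smul, smul_comm x μ]
  abel

theorem smul_mem_maxGenEigenspace {δ x : S} {n : K} (hx : δ * x - x * δ = n • x) {μ : K} {v : N}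
    (hv : v ∈ (Algebra.lsmul K K N δ : End K N).maxGenEigenspace μ) :
    x • v ∈ (Algebra.lsmul K K N δ : End K N).maxGenEigenspace (μ + n) := by
  rw [Module.End.mem_maxGenEigenspace] at hv ⊢
  obtain ⟨k, hk⟩ := hv
  exact ⟨k, by rw [lsmul_sub_pow_smul hx, hk, smul_zero]⟩

end WeightAlgebra

/-! ### Homogeneous components in the closure of a graded subalgebra -/

section GradedClosure

variable {K : Type*} [NontriviallyNormedField K] {X : Type*} [NormedRing X] [NormedAlgebra K X]
  {R : Type*} [Ring R] [Algebra K R] {𝒢 : ℤ → Submodule K R} [GradedAlgebra 𝒢] {d : R}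
  {U : Subalgebra K R} {ι : R →ₐ[K] X}

/-- An element which is an eigenvector for an inner grading is homogeneous. -/
theorem exists_int_of_eigenvector [CharZero K]
    (hd : ∀ (n : ℤ) (x : R), x ∈ 𝒢 n ↔ d * x - x * d = (n : K) • x) {x : R} (hx : x ≠ 0) {μ : K}
    (h : d * x - x * d = μ • x) : ∃ i : ℤ, μ = i ∧ x ∈ 𝒢 i := by
  classical
  have hcomp : ∀ i : ℤ, μ • (DirectSum.decompose 𝒢 x i : R) = (i : K) • (DirectSum.decompose 𝒢 x i : R) := by
    have h1 := DirectSum.sum_support_decompose 𝒢 x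
    have h2 : ∑ i ∈ (DirectSum.decompose 𝒢 x).support, (i : K) • (DirectSum.decompose 𝒢 x i : R)
        = μ • x := by
      rw [← h, ← adj_apply (K := K)]
      conv_rhs => rw [← h1, map_sum]
      refine Finset.sum_congr rfl fun i _ => ?_
      rw [adj_apply, (hd i _).1 (SetLike.coe_mem _)]
    intro i
    have h3 : (DirectSum.decompose 𝒢 (μ • x) i : R) = μ • (DirectSum.decompose 𝒢 x i : R) := by
      rw [DirectSum.decompose_smul]; rfl
    rw [← h3, ← h2, DirectSum.decompose_sum, DFinsupp.finsetSum_apply,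
      AddSubmonoidClass.coe_finsetSum]
    rw [Finset.sum_eq_single i]
    · rw [DirectSum.decompose_smul, DirectSum.decompose_coe, DirectSum.smul_apply,
        Submodule.coe_smul, DirectSum.of_eq_same]
    · intro j _ hj
      rw [DirectSum.decompose_of_mem_ne 𝒢 ((𝒢 j).smul_mem _ (SetLike.coe_mem _)) hj]
    · intro hi
      rw [DFinsupp.notMem_support_iff.1 hi]
      simp
  obtain ⟨i, hi⟩ : ∃ i, (DirectSum.decompose 𝒢 x i : R) ≠ 0 := by
    by_contra! hcon
    refine hx ?_
    rw [← DirectSum.sum_support_decompose 𝒢 x]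
    exact Finset.sum_eq_zero fun i _ => hcon i
  have hμ : μ = i := by
    have := hcomp i
    rw [← sub_eq_zero, ← sub_smul] at this
    exact sub_eq_zero.1 ((smul_eq_zero.1 this).resolve_right hi)
  exact ⟨i, hμ, (hd i x).2 (by rw [h, hμ])⟩

/-- Elements of the closure of a graded subalgebra are convergent sums of homogeneous elements. -/
theorem exists_graded_hasSum [CharZero K]
    (hd : ∀ (n : ℤ) (x : R), x ∈ 𝒢 n ↔ d * x - x * d = (n : K) • x) (hU : IsGradedSubalgebra 𝒢 U)
    (hι : Function.Injective ι)
    (hI : ∃ I : Set K, HasWeightDecomposition (adjClosure hd hU ι) I ∧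
      IsSemisimpleOn (adjClosure hd hU ι) I)
    (hws : (weightPart (adjClosure hd hU ι)).map (Submodule.subtype _) =
      Subalgebra.toSubmodule (U.map ι)) (a : closureIn ι U) :
    ∃ c : K → R, (∀ μ, c μ ≠ 0 → ∃ i : ℤ, μ = i ∧ c μ ∈ U ∧ c μ ∈ 𝒢 i) ∧
      HasSum (fun μ => ι (c μ)) (a : X) := by
  classical
  obtain ⟨I, ⟨_, hdec⟩, hss⟩ := hI
  obtain ⟨c, hc, hsum⟩ := hdec ⟨a.1, a.2⟩
  -- By `hws` each weight component comes from an element of U; by semi-simplicity and injectivity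
  -- of ι this element is an eigenvector of ad(d), hence homogeneous when nonzero.
  have h1 : ∀ μ : I, ∃ x : R, x ∈ U ∧ ι x = (c μ : X) ∧ d * x - x * d = (μ : K) • x := by
    intro μ
    have hmem : (c μ : X) ∈ Subalgebra.toSubmodule (U.map ι) := by
      rw [← hws]
      exact ⟨c μ, Submodule.mem_iSup_of_mem (μ : K) (hc μ), rfl⟩
    obtain ⟨x, hx, hxc⟩ := hmem
    refine ⟨x, hx, hxc, hι ?_⟩
    have h2 := congrArg Subtype.val (hss μ μ.2 _ (hc μ))
    have h3 : ι d * (c μ : X) - (c μ : X) * ι d = (μ : K) • (c μ : X) := h2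
    have hxc' : ι x = (c μ : X) := hxc
    rw [map_sub, map_mul, map_mul, map_smul, hxc', h3]
  choose x hxU hxc hxd using h1
  refine ⟨fun μ => if h : μ ∈ I then x ⟨μ, h⟩ else 0, fun μ hμ => ?_, ?_⟩
  · by_cases h : μ ∈ I
    · simp only [h, dif_pos] at hμ ⊢
      obtain ⟨i, hi, hxi⟩ := exists_int_of_eigenvector hd hμ (hxd ⟨μ, h⟩)
      exact ⟨i, hi, hxU _, hxi⟩
    · simp [h] at hμ
  · have hs : HasSum (fun μ : I => (c μ : X)) (a : X) :=
      hsum.map (Submodule.subtype _).toAddMonoidHom continuous_subtype_val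
    rw [← hasSum_subtype_iff_of_support_subset (s := I)]
    · convert hs using 2 with μ
      simp [hxc]
    · intro μ hμ
      by_contra h
      simp [h] at hμ

variable [CompleteSpace X] [IsUltrametricDist X] [IsUltrametricDist K]

/-- The projections of the closure of a graded subalgebra onto its homogeneous components. -/
theorem exists_graded_projection (p : ℕ) [Fact p.Prime] [NormedAlgebra ℚ_[p] K]
    (hd : ∀ (n : ℤ) (x : R), x ∈ 𝒢 n ↔ d * x - x * d = (n : K) • x) (hU : IsGradedSubalgebra 𝒢 U)
    (hι : Function.Injective ι)
    (hI : ∃ I : Set K, HasWeightDecomposition (adjClosure hd hU ι) I ∧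
      IsSemisimpleOn (adjClosure hd hU ι) I)
    (hws : (weightPart (adjClosure hd hU ι)).map (Submodule.subtype _) =
      Subalgebra.toSubmodule (U.map ι)) (i : ℤ) :
    ∃ q : closureIn ι U →ₗ[K] R, (∀ a, q a ∈ Subalgebra.toSubmodule U ⊓ 𝒢 i) ∧
      (∃ C : ℝ, 0 ≤ C ∧ ∀ a, ‖ι (q a)‖ ≤ C * ‖a‖) ∧
      ∀ (j : ℤ) (x : R) (hx : ι x ∈ closureIn ι U), x ∈ U → x ∈ 𝒢 j →
        q ⟨ι x, hx⟩ = if j = i then x else 0 := by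
  classical
  have := charZero_of_padic p (K := K)
  set V := Subalgebra.toSubmodule (closureIn ι U) with hV
  set D : End K V := adjClosure hd hU ι with hD
  have hcl : IsClosed (V : Set X) := Subalgebra.isClosed_topologicalClosure _
  have : CompleteSpace V := hcl.completeSpace_coe
  have hDc : Continuous D := by
    refine Continuous.subtype_mk (f := fun v : V => ι d * (v : X) - (v : X) * ι d) ?_ _
    fun_prop
  have hclos : ∀ x ∈ U, ι x ∈ V := fun x hx =>
    subset_closure (s := ((U.map ι : Subalgebra K X) : Set X)) ⟨x, hx, rfl⟩
  -- On the closure, ad(∂) acts semi-simply with integer weights. The general projection theorem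
  -- therefore applies with the single coset 0 + ℤ and exponent 1.
  have key : ∀ v : V, ∃ c : K → V, IsWeightSum D {0} 1 c v ∧
      ∀ i : ℤ, ∃ x ∈ Subalgebra.toSubmodule U ⊓ 𝒢 i, ι x = c i := by
    intro v
    obtain ⟨c, hc, hs⟩ := exists_graded_hasSum hd hU hι hI hws ⟨v.1, v.2⟩
    have hcU : ∀ μ, c μ ∈ U := fun μ => by
      by_cases h : c μ = 0
      · rw [h]; exact U.zero_mem
      · exact (hc μ h).choose_spec.2.1
    refine ⟨fun μ => ⟨ι (c μ), hclos _ (hcU μ)⟩, ⟨?_, fun μ => ?_, fun μ hμ => ?_⟩, fun j => ?_⟩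
    · exact (Topology.IsInducing.subtypeVal.hasSum_iff (g := V.subtype.toAddMonoidHom) _ _).1 hs
    · rw [pow_one]
      ext
      change (ι d * ι (c μ) - ι (c μ) * ι d) - μ • ι (c μ) = 0
      by_cases h : c μ = 0
      · simp [h]
      · obtain ⟨k, hk, -, hk'⟩ := hc μ h
        have h2 := (hd k _).1 hk'
        rw [← map_mul, ← map_mul, ← map_sub, h2, map_smul, hk, sub_self]
    · have h : c μ ≠ 0 := by
        rintro h
        exact hμ (Subtype.ext (by simp [h]))
      obtain ⟨k, hk, -⟩ := hc μ h
      exact ⟨0, by simp, k, by simpa using hk⟩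
    · refine ⟨c j, ⟨hcU _, ?_⟩, rfl⟩
      by_cases h : c j = 0
      · rw [h]; exact Submodule.zero_mem _
      · obtain ⟨k, hk, -, hk'⟩ := hc j h
        rw [show j = k by exact_mod_cast hk]
        rwa [show ((k : ℤ) : K) = (j : K) from hk.symm]
  obtain ⟨P, hP⟩ := exists_continuous_weight_projection p hDc (s := {0}) (e := 1)
    (fun v => (key v).imp fun c hc => hc.1) (i : K)
  -- An arbitrary linear retraction onto R; only its values on ι(R), where the projection P lands,
  -- matter.
  obtain ⟨g, hg⟩ := ι.toLinearMap.exists_leftInverse_of_injective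
    (LinearMap.ker_eq_bot.2 hι)
  have hg' : ∀ x, g (ι x) = x := fun x => LinearMap.congr_fun hg x
  let e : closureIn ι U →ₗ[K] V := (Subalgebra.toSubmoduleEquiv (closureIn ι U)).symm.toLinearMap
  have hPv : ∀ v : V, ∃ x ∈ Subalgebra.toSubmodule U ⊓ 𝒢 i, ι x = P v := by
    intro v
    obtain ⟨c, hc, hx⟩ := key v
    rw [hP c v hc]
    exact hx i
  refine ⟨g ∘ₗ V.subtype ∘ₗ P.toLinearMap ∘ₗ e, fun a => ?_, ⟨‖P‖, norm_nonneg _, fun a => ?_⟩,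
    fun j x hx hxU hxj => ?_⟩
  · obtain ⟨x, hx, hxa⟩ := hPv (e a)
    change g (P (e a) : X) ∈ _
    rwa [← hxa, hg']
  · obtain ⟨x, hx, hxa⟩ := hPv (e a)
    change ‖ι (g (P (e a) : X))‖ ≤ _
    rw [← hxa, hg', hxa]
    exact P.le_opNorm (e a)
  · change g (P (⟨ι x, hx⟩ : V) : X) = _
    have hw : IsWeightSum D {0} 1 (Pi.single (j : K) (⟨ι x, hx⟩ : V)) ⟨ι x, hx⟩ := by
      refine ⟨hasSum_pi_single _ _, fun μ => ?_, fun μ hμ => ?_⟩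
      · rw [pow_one]
        by_cases h : μ = j
        · subst h
          rw [Pi.single_eq_same]
          ext
          change (ι d * ι x - ι x * ι d) - (j : K) • ι x = 0
          rw [← map_mul, ← map_mul, ← map_sub, (hd j x).1 hxj, map_smul, sub_self]
        · rw [Pi.single_eq_of_ne h, map_zero]
      · refine ⟨0, by simp, j, ?_⟩
        by_contra h
        exact hμ (Pi.single_eq_of_ne (by simpa using h) _)
    rw [hP _ _ hw]
    split_ifs with h
    · subst h
      rw [Pi.single_eq_same, hg']
    · rw [Pi.single_eq_of_ne (by exact_mod_cast Ne.symm h)]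
      simp

end GradedClosure

/-! ### Modules with weights bounded below -/

section BoundedWeights

variable {K : Type*} [Field K] {V : Type*}

/-- The weights are bounded below, the weight spaces are finite-dimensional, every vector is a
convergent sum of weight vectors, and its components depend continuously on it. -/
structure HasBoundedWeights [AddCommGroup V] [Module K V] [TopologicalSpace V] (D : End K V) :
    Prop where
  bounded : ∃ s : Finset K, ∀ μ ∈ weights D, ∃ ν ∈ s, ∃ n : ℕ, μ = ν + (n : K)
  finite : ∀ μ, FiniteDimensional K (D.maxGenEigenspace μ)
  decomp : ∀ v, ∃ c : K → V, (∀ μ, c μ ∈ D.maxGenEigenspace μ) ∧ HasSum c v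
  proj : ∀ l, ∃ P : V →L[K] V, ∀ c v, (∀ μ, c μ ∈ D.maxGenEigenspace μ) → HasSum c v → P v = c l

theorem mem_weights_of_ne_zero [AddCommGroup V] [Module K V] {D : End K V} {μ : K} {v : V}
    (hv : v ∈ D.maxGenEigenspace μ) (h0 : v ≠ 0) : μ ∈ weights D :=
  fun hbot => h0 (by rwa [hbot, Submodule.mem_bot] at hv)

theorem hasWeightDecomposition_of_hasSum [AddCommGroup V] [Module K V] [TopologicalSpace V]
    {D : End K V} (h : ∀ v, ∃ c : K → V, (∀ μ, c μ ∈ D.maxGenEigenspace μ) ∧ HasSum c v) :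
    HasWeightDecomposition D (weights D) := by
  refine ⟨subset_rfl, fun v => ?_⟩
  obtain ⟨c, hc, hs⟩ := h v
  refine ⟨fun μ => c μ, fun μ => hc μ, ?_⟩
  refine (hasSum_subtype_iff_of_support_subset fun μ hμ => ?_).2 hs
  exact mem_weights_of_ne_zero (hc μ) hμ

theorem HasBoundedWeights.eq_zero [AddCommGroup V] [Module K V] [TopologicalSpace V]
    {D : End K V} (h : HasBoundedWeights D) {c : K → V} (hc : ∀ μ, c μ ∈ D.maxGenEigenspace μ)
    (hs : HasSum c 0) (μ : K) : c μ = 0 := by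
  obtain ⟨P, hP⟩ := h.proj μ
  rw [← hP c 0 hc hs, map_zero]

theorem exists_fin_generators {A N : Type*} [Ring A] [AddCommGroup N] [Module A N]
    [Module.Finite A N] {Z : Set N} (hZ : Submodule.span A Z = ⊤) :
    ∃ (t : ℕ) (w : Fin t → N), (∀ l, w l ∈ Z) ∧ Submodule.span A (Set.range w) = ⊤ := by
  have hfg : (Submodule.span A Z).FG := by rw [hZ]; exact Module.Finite.fg_top
  obtain ⟨s, hs, hsp⟩ := (Submodule.fg_span_iff_fg_span_finset_subset Z).1 hfg
  refine ⟨s.card, fun l => (s.equivFin.symm l : N), fun l => hs (s.equivFin.symm l).2, ?_⟩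
  rw [← hZ, hsp]
  congr 1
  ext x
  refine ⟨?_, fun hx => ⟨s.equivFin ⟨x, hx⟩, by simp⟩⟩
  rintro ⟨l, rfl⟩
  exact (s.equivFin.symm l).2

/-- If `D` has nilpotent part of bounded order on weight vectors, there is a common exponent. -/
theorem exists_common_exponent [AddCommGroup V] [Module K V] {D : End K V} {t : ℕ} {w : Fin t → V}
    {lam : Fin t → K} (hw : ∀ l, w l ∈ D.maxGenEigenspace (lam l)) :
    ∃ e : ℕ, ∀ l, ((D - lam l • (1 : End K V)) ^ e) (w l) = 0 := by
  have h := fun l => (Module.End.mem_maxGenEigenspace _ _ _).1 (hw l)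
  choose k hk using h
  refine ⟨Finset.univ.sup k, fun l => ?_⟩
  rw [← Nat.sub_add_cancel (Finset.le_sup (f := k) (Finset.mem_univ l)), pow_add,
    Module.End.mul_apply, hk, map_zero]

end BoundedWeights

/-! ### Modules generated by weight vectors over the closure of A -/

section Generators

variable {K : Type*} [NontriviallyNormedField K] {X : Type*} [NormedRing X] [NormedAlgebra K X]
  {R : Type*} [Ring R] [Algebra K R] {𝒢 : ℤ → Submodule K R} [GradedAlgebra 𝒢] {d : R}
  {A B H : Subalgebra K R} {ι : R →ₐ[K] X}

theorem IsBanachTriangularDecomposition.mem_nonneg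
    (hX : IsBanachTriangularDecomposition ι 𝒢 A B H d) {x : R} (hx0 : x ≠ 0) (hxA : x ∈ A) {i : ℤ}
    (hi : x ∈ 𝒢 i) : 0 ≤ i := by
  by_contra hneg
  have h : x ∈ Subalgebra.toSubmodule A ⊓ 𝒢 i := ⟨hxA, hi⟩
  rw [hX.algebraic.A_neg i (not_le.1 hneg)] at h
  exact hx0 (by simpa using h)

/-- If `N` is generated over `𝒜` by weight vectors, every vector is a convergent sum of weight
vectors of the expected shape. -/
theorem IsBanachTriangularDecomposition.exists_isWeightSum [CharZero K]
    (hX : IsBanachTriangularDecomposition ι 𝒢 A B H d) {N : Type*} [NormedAddCommGroup N]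
    [NormedSpace K N] [Module X N] [IsScalarTower K X N] [ContinuousSMul X N] {t : ℕ}
    {w : Fin t → N} {lam : Fin t → K} {e : ℕ} {s : Finset K} (hs : ∀ l, lam l ∈ s)
    (he : ∀ l, ((Algebra.lsmul K K N (ι d) - lam l • (1 : End K N)) ^ e) (w l) = 0)
    (hspan : Submodule.span (closureIn ι A) (Set.range w) = ⊤) (v : N) :
    ∃ c : K → N, IsWeightSum (Algebra.lsmul K K N (ι d)) s e c v ∧
      ∀ μ, (c μ ≠ 0 → ∃ ν ∈ s, ∃ n : ℕ, μ = ν + (n : K)) ∧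
        ∃ x : Fin t → R, (∀ l, x l ∈ A) ∧ (∀ l, x l ≠ 0 → ∃ i : ℤ, μ = lam l + i ∧ x l ∈ 𝒢 i) ∧
          c μ = ∑ l, ι (x l) • w l := by
  have hv : v ∈ Submodule.span (closureIn ι A) (Set.range w) := by rw [hspan]; trivial
  obtain ⟨a, ha⟩ := (Submodule.mem_span_range_iff_exists_fun _).1 hv
  choose c hc hcs using fun l => exists_graded_hasSum hX.algebraic.inner hX.algebraic.graded_A
    hX.injective hX.decomp_A hX.ws_A (a l)
  have hA : ∀ l μ, c l μ ∈ A := fun l μ => by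
    by_cases h : c l μ = 0
    · rw [h]; exact A.zero_mem
    · exact (hc l μ h).choose_spec.2.1
  have hsupp : ∀ μ, (∑ l, ι (c l (μ - lam l)) • w l) ≠ 0 → ∃ ν ∈ s, ∃ n : ℕ, μ = ν + (n : K) := by
    intro μ hμ
    obtain ⟨l, -, hl⟩ := Finset.exists_ne_zero_of_sum_ne_zero hμ
    have h0 : c l (μ - lam l) ≠ 0 := fun h => hl (by rw [h, map_zero, zero_smul])
    obtain ⟨i, hi, hiA, hi'⟩ := hc l _ h0
    obtain ⟨n, rfl⟩ := Int.eq_ofNat_of_zero_le (hX.mem_nonneg h0 hiA hi')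
    exact ⟨lam l, hs l, n, by simpa using sub_eq_iff_eq_add'.1 hi⟩
  -- Writing v = ∑ a_l w_l, the part of weight μ collects from each a_l its component of degree μ -
  -- lam l.
  refine ⟨fun μ => ∑ l, ι (c l (μ - lam l)) • w l, ⟨?_, fun μ => ?_, fun μ hμ => ?_⟩, fun μ =>
    ⟨hsupp μ, fun l => c l (μ - lam l), fun l => hA _ _, fun l hl => ?_, rfl⟩⟩
  · rw [← ha]
    refine hasSum_sum fun l _ => ?_
    have h1 : HasSum (fun κ => ι (c l κ) • w l) ((a l : X) • w l) := (hcs l).smul_const (w l)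
    exact (Equiv.subRight (lam l)).hasSum_iff.2 h1
  · rw [map_sum]
    refine Finset.sum_eq_zero fun l _ => ?_
    by_cases h : c l (μ - lam l) = 0
    · simp [h]
    obtain ⟨i, hi, -, hi'⟩ := hc l _ h
    have hd : ι d * ι (c l (μ - lam l)) - ι (c l (μ - lam l)) * ι d
        = (i : K) • ι (c l (μ - lam l)) := by
      rw [← map_mul, ← map_mul, ← map_sub, (hX.algebraic.inner i _).1 hi', map_smul]
    rw [sub_eq_iff_eq_add'.1 hi, add_sub_cancel_left] at *
    rw [lsmul_sub_pow_smul hd, he, smul_zero]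
  · obtain ⟨ν, hν, n, hn⟩ := hsupp μ hμ
    exact ⟨ν, hν, n, by simpa using hn⟩
  · obtain ⟨i, hi, -, hi'⟩ := hc l _ hl
    exact ⟨i, sub_eq_iff_eq_add'.1 hi, hi'⟩

theorem isClosed_closureIn (U : Subalgebra K R) : IsClosed (closureIn ι U : Set X) :=
  Subalgebra.isClosed_topologicalClosure _

variable (p : ℕ) [Fact p.Prime] [NormedAlgebra ℚ_[p] K] [IsUltrametricDist K]

-- Expanding the coefficients of generators exhibits each vector as a weight sum whose μ-part lies
-- in F μ, a sum of finitely many finite-dimensional images of pieces A_i. By uniqueness of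
-- components F μ contains the whole weight space. Uniqueness also shows that the exponent e kills
-- every generalized eigenvector, so the continuous projections apply to any weight decomposition.
include p in
theorem IsBanachTriangularDecomposition.hasBoundedWeights_of_norm
    (hX : IsBanachTriangularDecomposition ι 𝒢 A B H d) {N : Type*} [NormedAddCommGroup N]
    [NormedSpace K N] [Module X N] [IsScalarTower K X N] [ContinuousSMul X N] [CompleteSpace N]
    [IsUltrametricDist N] {t : ℕ}
    {w : Fin t → N} {lam : Fin t → K}
    (hw : ∀ l, w l ∈ (Algebra.lsmul K K N (ι d) : End K N).maxGenEigenspace (lam l))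
    (hspan : Submodule.span (closureIn ι A) (Set.range w) = ⊤) :
    HasBoundedWeights (Algebra.lsmul K K N (ι d) : End K N) := by
  classical
  have := charZero_of_padic p (K := K)
  set D : End K N := Algebra.lsmul K K N (ι d) with hD
  have hDc : Continuous D := by
    change Continuous fun v : N => ι d • v
    fun_prop
  obtain ⟨e, he⟩ := exists_common_exponent hw
  set s : Finset K := Finset.univ.image lam
  have hs : ∀ l, lam l ∈ s := fun l => Finset.mem_image_of_mem _ (Finset.mem_univ l)
  have hsum := hX.exists_isWeightSum hs he hspan
  let F : K → Submodule K N := fun μ => ⨆ l, (if h : ∃ i : ℤ, μ = lam l + i then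
    (Subalgebra.toSubmodule A ⊓ 𝒢 h.choose) else ⊥).map
      ((LinearMap.toSpanSingleton X N (w l)).restrictScalars K ∘ₗ ι.toLinearMap)
  have hFfin : ∀ μ, FiniteDimensional K (F μ) := by
    intro μ
    have : ∀ l, FiniteDimensional K ((if h : ∃ i : ℤ, μ = lam l + i then
        (Subalgebra.toSubmodule A ⊓ 𝒢 h.choose) else ⊥ : Submodule K R)) := by
      intro l
      by_cases h : ∃ i : ℤ, μ = lam l + i
      · rw [dif_pos h]; exact hX.algebraic.A_fin _
      · rw [dif_neg h]; infer_instance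
    exact Submodule.finiteDimensional_iSup _
  have hxF : ∀ μ (x : Fin t → R), (∀ l, x l ∈ A) →
      (∀ l, x l ≠ 0 → ∃ i : ℤ, μ = lam l + i ∧ x l ∈ 𝒢 i) → ∑ l, ι (x l) • w l ∈ F μ := by
    intro μ x hxA hx
    refine Submodule.sum_mem _ fun l _ => ?_
    by_cases h0 : x l = 0
    · simp [h0]
    obtain ⟨i, hi, hxi⟩ := hx l h0
    refine Submodule.mem_iSup_of_mem l ⟨x l, ?_, rfl⟩
    have h : ∃ i : ℤ, μ = lam l + i := ⟨i, hi⟩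
    have hch : h.choose = i := by
      have h1 := h.choose_spec.symm.trans hi
      exact_mod_cast add_left_cancel h1
    rw [dif_pos h, hch]
    exact ⟨hxA l, hxi⟩
  -- A weight vector x has two weight sums, the trivial one and its expansion in the generators; by
  -- uniqueness they agree.
  have hkey : ∀ μ, ∀ x ∈ D.maxGenEigenspace μ, ∃ c, IsWeightSum D s e c x ∧ c μ = x := by
    intro μ x hx
    obtain ⟨e', he'⟩ := (Module.End.mem_maxGenEigenspace _ _ _).1 hx
    obtain ⟨c, hc, -⟩ := hsum x
    refine ⟨c, hc, ?_⟩
    have h1 : IsWeightSum D {μ} e' (Pi.single μ x) x := by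
      refine ⟨hasSum_pi_single _ _, fun κ => ?_, fun κ hκ => ⟨μ, by simp, 0, ?_⟩⟩
      · by_cases h : κ = μ
        · subst h; rwa [Pi.single_eq_same]
        · rw [Pi.single_eq_of_ne h, map_zero]
      · by_contra h
        exact hκ (Pi.single_eq_of_ne (by simpa using h) _)
    rw [hc.unique p hDc h1, Pi.single_eq_same]
  have hFle : ∀ μ, D.maxGenEigenspace μ ≤ F μ := by
    intro μ x hx
    obtain ⟨c', hc', hcx⟩ := hkey μ x hx
    obtain ⟨c, hc, hcF⟩ := hsum x
    obtain ⟨-, y, hyA, hy, hcy⟩ := hcF μ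
    rw [← hcx, hc'.unique p hDc hc, hcy]
    exact hxF μ y hyA hy
  have hbd : ∀ μ ∈ weights D, ∃ ν ∈ s, ∃ n : ℕ, μ = ν + (n : K) := by
    intro μ hμ
    obtain ⟨x, hx, hx0⟩ := (Submodule.ne_bot_iff _).1 hμ
    obtain ⟨c', hc', hcx⟩ := hkey μ x hx
    obtain ⟨c, hc, hcF⟩ := hsum x
    refine (hcF μ).1 ?_
    rwa [← hc'.unique p hDc hc, hcx]
  have hnil : ∀ μ, ∀ x ∈ D.maxGenEigenspace μ, ((D - μ • (1 : End K N)) ^ e) x = 0 := by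
    intro μ x hx
    obtain ⟨c', hc', hcx⟩ := hkey μ x hx
    rw [← hcx]; exact hc'.ker μ
  refine ⟨⟨s, hbd⟩, fun μ => ?_, fun v => ?_, fun l => ?_⟩
  · have := hFfin μ
    exact Submodule.finiteDimensional_of_le (hFle μ)
  · obtain ⟨c, hc, -⟩ := hsum v
    exact ⟨c, fun μ => (Module.End.mem_maxGenEigenspace _ _ _).2 ⟨e, hc.ker μ⟩, hc.hasSum⟩
  · obtain ⟨P, hP⟩ := exists_continuous_weight_projection p hDc
      (fun v => (hsum v).imp fun c hc => hc.1) l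
    refine ⟨P, fun c v hc hcv => hP c v ⟨hcv, fun μ => hnil μ _ (hc μ), fun μ hμ => ?_⟩⟩
    obtain ⟨ν, hν, n, hn⟩ := hbd μ (mem_weights_of_ne_zero (hc μ) hμ)
    exact ⟨ν, hν, n, by simpa using hn⟩

variable [CompleteSpace X] [IsUltrametricDist X] [IsNoetherianRing X]

include p in
/-- A finitely generated module generated over `𝒜` by finitely many weight vectors has bounded
weights. -/
theorem IsBanachTriangularDecomposition.hasBoundedWeights
    (hX : IsBanachTriangularDecomposition ι 𝒢 A B H d) {N : Type*} [ag : AddCommGroup N]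
    [Module K N] [Module X N] [IsScalarTower K X N] [τ : TopologicalSpace N] [IsModuleTopology X N]
    [Module.Finite X N] {t : ℕ} {w : Fin t → N} {lam : Fin t → K}
    (hw : ∀ l, w l ∈ (Algebra.lsmul K K N (ι d) : End K N).maxGenEigenspace (lam l))
    (hspan : Submodule.span (closureIn ι A) (Set.range w) = ⊤) :
    HasBoundedWeights (Algebra.lsmul K K N (ι d) : End K N) := by
  obtain ⟨nag, rfl, rfl, hcomp, hult, hK, -⟩ := exists_banach_norm K X N
  let _ : NormedSpace K N := { norm_smul_le := hK }
  exact hX.hasBoundedWeights_of_norm p hw hspan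

variable [IsNoetherianRing (closureIn ι A)]

omit [IsUltrametricDist K] in
/-- A module in the category `𝒪^` is generated over `𝒜` by finitely many weight vectors. -/
theorem exists_weight_generators {N : Type*} [ag : AddCommGroup N] [Module K N] [Module X N]
    [IsScalarTower K X N] [τ : TopologicalSpace N] [IsModuleTopology X N] [Module.Finite X N]
    [Module.Finite (closureIn ι A) N] {δ : X} {I : Set K}
    (hI : HasWeightDecomposition (Algebra.lsmul K K N δ) I) :
    ∃ (t : ℕ) (w : Fin t → N) (lam : Fin t → K),
      (∀ l, w l ∈ (Algebra.lsmul K K N δ : End K N).maxGenEigenspace (lam l)) ∧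
      Submodule.span (closureIn ι A) (Set.range w) = ⊤ := by
  obtain ⟨nag, rfl, rfl, hcomp, hult, hK, -⟩ := exists_banach_norm K X N
  let _ : NormedSpace K N := { norm_smul_le := hK }
  have : CompleteSpace (closureIn ι A) := (isClosed_closureIn A).completeSpace_coe
  have : ContinuousSMul (closureIn ι A) N :=
    ⟨by
      change Continuous fun x : closureIn ι A × N => (x.1 : X) • x.2
      fun_prop⟩
  have : IsScalarTower K (closureIn ι A) N :=
    ⟨fun k a v => by
      change ((k • a : closureIn ι A) : X) • v = k • ((a : X) • v)
      rw [Subalgebra.coe_smul, smul_assoc]⟩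
  let Z : Set N := {v | ∃ μ, v ∈ (Algebra.lsmul K K N δ : End K N).maxGenEigenspace μ}
  -- The span of the weight vectors over the noetherian algebra 𝒜 is closed and contains the partial
  -- sums of every decomposition, hence every vector.
  have hcl := isClosed_submodule_of_finite K (closureIn ι A)
    (Submodule.span (closureIn ι A) Z)
  have htop : Submodule.span (closureIn ι A) Z = ⊤ := by
    refine eq_top_iff.2 fun v _ => ?_
    obtain ⟨c, hc, hs⟩ := hI.2 v
    refine hcl.mem_of_tendsto hs (Eventually.of_forall fun F => ?_)
    exact Submodule.sum_mem _ fun μ _ => Submodule.subset_span ⟨μ, hc μ⟩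
  obtain ⟨t, w, hwZ, hspan⟩ := exists_fin_generators htop
  choose lam hlam using hwZ
  exact ⟨t, w, lam, hlam, hspan⟩

end Generators

/-! ### Finiteness of the products H · B_{-k}, and lower bounds on weights -/

section GradedInduction

variable {K : Type*} [Field K] {R : Type*} [Ring R] [Algebra K R] {𝒢 : ℤ → Submodule K R}
  [GradedAlgebra 𝒢] {d : R} {A B H : Subalgebra K R}

theorem IsGradedSubalgebra.induction {U : Subalgebra K R} (hU : IsGradedSubalgebra 𝒢 U)
    {P : R → Prop} (zero : P 0) (add : ∀ x ∈ U, ∀ y ∈ U, P x → P y → P (x + y))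
    (hom : ∀ (i : ℤ) (x : R), x ∈ U → x ∈ 𝒢 i → P x) {x : R} (hx : x ∈ U) : P x := by
  classical
  rw [← DirectSum.sum_support_decompose 𝒢 x]
  have key : ∀ s : Finset ℤ, P (∑ i ∈ s, (DirectSum.decompose 𝒢 x i : R)) := by
    intro s
    induction s using Finset.induction_on with
    | empty => simpa using zero
    | insert i s hi ih =>
      rw [Finset.sum_insert hi]
      exact add _ (hU x hx i) _ (U.sum_mem fun j _ => hU x hx j)
        (hom i _ (hU x hx i) (SetLike.coe_mem _)) ih
  exact key _

theorem IsTriangularDecomposition.finiteDimensional_H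
    (h : IsTriangularDecomposition 𝒢 A B H d) : FiniteDimensional K H := by
  obtain ⟨r, k, ⟨e⟩⟩ := h.H_split
  exact Module.Finite.equiv e.symm.toLinearEquiv

/-- The products `H · B_{-k}` with `k ≤ k₀` are spanned by finitely many homogeneous elements. -/
theorem IsTriangularDecomposition.exists_homogeneous_span
    (h : IsTriangularDecomposition 𝒢 A B H d) (k₀ : ℕ) : ∃ (t : ℕ) (r : Fin t → R),
      (∀ l, ∃ m : ℤ, r l ∈ 𝒢 m) ∧ ∀ x ∈ H, ∀ k ≤ k₀, ∀ b ∈ B, b ∈ 𝒢 (-(k : ℤ)) →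
        x * b ∈ Submodule.span K (Set.range r) := by
  let Z : Set R := {y | ∃ x ∈ H, ∃ k ≤ k₀, ∃ b ∈ B, b ∈ 𝒢 (-(k : ℤ)) ∧ x * b = y}
  let Q : Submodule K R := ⨆ k : Fin (k₀ + 1),
    Subalgebra.toSubmodule H * (Subalgebra.toSubmodule B ⊓ 𝒢 (-((k : ℕ) : ℤ)))
  have hQ : FiniteDimensional K Q := by
    have hH : (Subalgebra.toSubmodule H).FG := by
      have := h.finiteDimensional_H
      exact Module.Finite.iff_fg.1 (show Module.Finite K (Subalgebra.toSubmodule H) from this)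
    have : ∀ k : Fin (k₀ + 1), FiniteDimensional K ↥(Subalgebra.toSubmodule H *
        (Subalgebra.toSubmodule B ⊓ 𝒢 (-((k : ℕ) : ℤ)))) := fun k =>
      Module.Finite.iff_fg.2 (hH.mul (Module.Finite.iff_fg.1 (h.B_fin _)))
    exact Submodule.finiteDimensional_iSup _
  have hle : Submodule.span K Z ≤ Q := by
    refine Submodule.span_le.2 ?_
    rintro _ ⟨x, hx, k, hk, b, hb, hbk, rfl⟩
    exact Submodule.mem_iSup_of_mem (⟨k, by omega⟩ : Fin (k₀ + 1))
      (Submodule.mul_mem_mul hx ⟨hb, hbk⟩)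
  have hfin : FiniteDimensional K (Submodule.span K Z) := Submodule.finiteDimensional_of_le hle
  -- Elements of Z are homogeneous, so a finite spanning set is chosen inside Z itself.
  obtain ⟨s, hs, hsp⟩ := (Submodule.fg_span_iff_fg_span_finset_subset Z).1
    (Module.Finite.iff_fg.1 hfin)
  refine ⟨s.card, fun l => (s.equivFin.symm l : R), fun l => ?_, fun x hx k hk b hb hbk => ?_⟩
  · obtain ⟨x, hx, k, hk, b, hb, hbk, hxb⟩ := hs (s.equivFin.symm l).2
    refine ⟨0 + -(k : ℤ), ?_⟩
    change (s.equivFin.symm l : R) ∈ _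
    rw [← hxb]
    exact SetLike.mul_mem_graded (h.H_le hx) hbk
  · have hmem : x * b ∈ Submodule.span K Z := Submodule.subset_span ⟨x, hx, k, hk, b, hb, hbk, rfl⟩
    rw [hsp] at hmem
    convert hmem
    ext y
    refine ⟨?_, fun hy => ⟨s.equivFin ⟨y, hy⟩, by simp⟩⟩
    rintro ⟨l, rfl⟩
    exact (s.equivFin.symm l).2

/-- If l - k = ν + n, then l - ν is the natural number k + n, which bounds k. Each ν thus gives one
bound, and a ν for which l - ν is not a natural number imposes none and contributes 0. -/
theorem exists_maxGenEigenspace_sub_eq_bot [CharZero K] {V : Type*} [AddCommGroup V] [Module K V]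
    {D : End K V}
    (hb : ∃ s : Finset K, ∀ μ ∈ weights D, ∃ ν ∈ s, ∃ n : ℕ, μ = ν + (n : K)) (l : K) :
    ∃ k₀ : ℕ, ∀ k : ℕ, k₀ < k → D.maxGenEigenspace (l - k) = ⊥ := by
  classical
  obtain ⟨s, hs⟩ := hb
  refine ⟨s.sup fun ν => if h : ∃ N : ℕ, l - ν = N then h.choose else 0, fun k hk => ?_⟩
  by_contra hne
  obtain ⟨ν, hν, n, hn⟩ := hs _ hne
  have h : ∃ N : ℕ, l - ν = N := ⟨k + n, by push_cast; linear_combination hn⟩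
  have h1 := Finset.le_sup (f := fun ν => if h : ∃ N : ℕ, l - ν = N then h.choose else 0) hν
  simp only [dif_pos h] at h1
  have h2 : ((h.choose : ℕ) : K) = ((k + n : ℕ) : K) := by
    rw [← h.choose_spec]; push_cast; linear_combination hn
  have h3 : h.choose = k + n := by exact_mod_cast h2
  omega

end GradedInduction

/-! ### Generation over the closure of A from nilpotency of B -/

section Generation

variable {K : Type*} [NontriviallyNormedField K] [CompleteSpace K] {X : Type*} [NormedRing X]
  [NormedAlgebra K X] [CompleteSpace X] [IsUltrametricDist X] [IsNoetherianRing X]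
  {R : Type*} [Ring R] [Algebra K R] {𝒢 : ℤ → Submodule K R} [GradedAlgebra 𝒢] {d : R}
  {A B H : Subalgebra K R} {ι : R →ₐ[K] X}

/-- A vector on which `B` acts nilpotently generates a module which is finitely generated over
`𝒜`. -/
theorem IsBanachTriangularDecomposition.smul_mem_span
    (hX : IsBanachTriangularDecomposition ι 𝒢 A B H d) {N : Type*} [ag : AddCommGroup N]
    [Module K N] [Module X N] [IsScalarTower K X N] [τ : TopologicalSpace N] [IsModuleTopology X N]
    [Module.Finite X N] {k₀ t : ℕ} {r : Fin t → R}
    (hr : ∀ x ∈ H, ∀ k ≤ k₀, ∀ b ∈ B, b ∈ 𝒢 (-(k : ℤ)) → x * b ∈ Submodule.span K (Set.range r))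
    {w : N} (hw : ∀ k : ℕ, k₀ < k → ∀ b ∈ B, b ∈ 𝒢 (-(k : ℤ)) → ι b • w = 0) (s : X) :
    s • w ∈ Submodule.span (closureIn ι A) (Set.range fun l => ι (r l) • w) := by
  obtain ⟨nag, rfl, rfl, hcomp, hult, hK, hN⟩ := exists_banach_norm K X N
  let _ : NormedSpace K N := { norm_smul_le := hK }
  have : CompleteSpace (closureIn ι A) := (isClosed_closureIn A).completeSpace_coe
  refine hX.tensor.smul_mem_span hN ?_ s
  set P := Submodule.span K (Set.range fun l => ι (r l) • w) with hP
  -- P is finite-dimensional over K, hence closed, so membership need only be checked for b in B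
  -- rather than in its closure.
  have hPcl : IsClosed (P : Set N) := by
    have : FiniteDimensional K P := FiniteDimensional.span_of_finite K (Set.finite_range _)
    exact P.closed_of_finiteDimensional
  let f : R →ₗ[K] N := (LinearMap.toSpanSingleton X N w).restrictScalars K ∘ₗ ι.toLinearMap
  have hf : ∀ y ∈ Submodule.span K (Set.range r), ι y • w ∈ P := by
    intro y hy
    have h1 : f y ∈ (Submodule.span K (Set.range r)).map f := ⟨y, hy, rfl⟩
    rw [Submodule.map_span, ← Set.range_comp] at h1
    exact h1
  rintro _ ⟨x, hx, rfl⟩ b hb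
  have hcl : IsClosed {b : X | ι x • b • w ∈ P} := hPcl.preimage (by fun_prop)
  refine hcl.closure_subset_iff.2 ?_ hb
  rintro _ ⟨y, hy, rfl⟩
  refine hX.algebraic.graded_B.induction (P := fun y => ι x • ι y • w ∈ P) ?_ ?_ ?_ hy
  · simp [P.zero_mem]
  · intro y _ y' _ h h'
    rw [map_add, add_smul, smul_add]
    exact P.add_mem h h'
  · intro i y hy hyi
    rcases lt_or_ge 0 i with hi | hi
    · have h0 : y ∈ Subalgebra.toSubmodule B ⊓ 𝒢 i := ⟨hy, hyi⟩
      rw [hX.algebraic.B_pos i hi, Submodule.mem_bot] at h0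
      simp [h0, P.zero_mem]
    · obtain ⟨k, hk⟩ := Int.eq_ofNat_of_zero_le (neg_nonneg.2 hi)
      obtain rfl : i = -(k : ℤ) := by omega
      rcases Nat.lt_or_ge k₀ k with hlt | hge
      · rw [hw k hlt y hy hyi, smul_zero]; exact P.zero_mem
      · rw [← mul_smul, ← map_mul]
        exact hf _ (hr x hx k hge y hy hyi)

end Generation

/-! ### Comparing weight components across two completions of R -/

section Comparison

variable {K : Type*} [NontriviallyNormedField K] [CompleteSpace K]

/-- Linear maps out of a finite-dimensional space are bounded. This compares two completions of R on
a homogeneous piece of A or B, although no comparison is available on all of R. -/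
theorem exists_norm_le_of_finiteDimensional {R X X' : Type*} [AddCommGroup R] [Module K R]
    [NormedAddCommGroup X] [NormedSpace K X] [NormedAddCommGroup X'] [NormedSpace K X']
    {ι : R →ₗ[K] X} (hι : Function.Injective ι) (ι' : R →ₗ[K] X') (Q : Submodule K R)
    [FiniteDimensional K Q] : ∃ C : ℝ, 0 ≤ C ∧ ∀ x ∈ Q, ‖ι' x‖ ≤ C * ‖ι x‖ := by
  let e := Submodule.equivMapOfInjective ι hι Q
  have : FiniteDimensional K (Q.map ι) := Module.Finite.equiv e
  let g : (Q.map ι) →ₗ[K] X' := ι' ∘ₗ Q.subtype ∘ₗ e.symm.toLinearMap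
  refine ⟨‖g.toContinuousLinearMap‖, norm_nonneg _, fun x hx => ?_⟩
  have h1 := g.toContinuousLinearMap.le_opNorm (e ⟨x, hx⟩)
  have h2 : g (e ⟨x, hx⟩) = ι' x := by simp [g]
  rw [LinearMap.coe_toContinuousLinearMap', h2] at h1
  exact h1

omit [NontriviallyNormedField K] [CompleteSpace K] in
theorem tensor_triple_ext [Field K] {U V W N : Type*} [AddCommGroup U] [Module K U]
    [AddCommGroup V] [Module K V] [AddCommGroup W] [Module K W] [AddCommGroup N] [Module K N]
    {f g : U ⊗[K] (V ⊗[K] W) →ₗ[K] N}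
    (h : ∀ a b c, f (a ⊗ₜ[K] (b ⊗ₜ[K] c)) = g (a ⊗ₜ[K] (b ⊗ₜ[K] c))) : f = g := by
  refine TensorProduct.ext' fun a y => ?_
  induction y using TensorProduct.induction_on with
  | zero => simp
  | tmul b c => exact h a b c
  | add y y' hy hy' => rw [TensorProduct.tmul_add, map_add, map_add, hy, hy']

variable {X X' : Type*} [NormedRing X] [NormedAlgebra K X] [NormedRing X'] [NormedAlgebra K X']
  {R : Type*} [Ring R] [Algebra K R] {𝒢 : ℤ → Submodule K R} [GradedAlgebra 𝒢] {d : R}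
  {A B H : Subalgebra K R} {ι : R →ₐ[K] X} {ι' : R →ₐ[K] X'}

omit [CompleteSpace K] in
theorem decompose_eq_of_homogeneous_eq {U : Subalgebra K R} (hU : IsGradedSubalgebra 𝒢 U) {i : ℤ}
    {q : closureIn ι U →ₗ[K] R}
    (hq : ∀ (j : ℤ) (x : R) (hx : ι x ∈ closureIn ι U), x ∈ U → x ∈ 𝒢 j →
        q ⟨ι x, hx⟩ = if j = i then x else 0)
    (hmem : ∀ x ∈ U, ι x ∈ closureIn ι U) {x : R} (hx : x ∈ U) :
    q ⟨ι x, hmem x hx⟩ = DirectSum.decompose 𝒢 x i := by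
  classical
  refine hU.induction (P := fun x => ∀ hx : ι x ∈ closureIn ι U,
    q ⟨ι x, hx⟩ = DirectSum.decompose 𝒢 x i) ?_ ?_ ?_ hx _
  · intro hx
    have : (⟨ι 0, hx⟩ : closureIn ι U) = 0 := Subtype.ext (map_zero ι)
    rw [this, map_zero, DirectSum.decompose_zero]
    rfl
  · intro x hxU y hyU h h' hxy
    have : (⟨ι (x + y), hxy⟩ : closureIn ι U) = ⟨ι x, hmem x hxU⟩ + ⟨ι y, hmem y hyU⟩ :=
      Subtype.ext (map_add ι x y)
    rw [this, map_add, h, h', DirectSum.decompose_add]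
    rfl
  · intro j x hxU hxj hx
    rw [hq j x hx hxU hxj]
    split_ifs with h
    · subst h; rw [DirectSum.decompose_of_mem_same 𝒢 hxj]
    · rw [DirectSum.decompose_of_mem_ne 𝒢 hxj h]

omit [CompleteSpace K] in
theorem mem_closureIn {U : Subalgebra K R} {x : R} (hx : x ∈ U) : ι x ∈ closureIn ι U :=
  subset_closure (s := ((U.map ι : Subalgebra K X) : Set X)) ⟨x, hx, rfl⟩

variable [IsUltrametricDist K] [CompleteSpace X] [IsUltrametricDist X]

/-- For a weight vector `w` on which `B` acts nilpotently, the component of `r • w` in the weight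
space of `w` is bounded in terms of the norm of `r` in any Banach completion of `R`. -/
theorem IsBanachTriangularDecomposition.exists_norm_proj_smul_le (p : ℕ) [Fact p.Prime]
    [NormedAlgebra ℚ_[p] K]
    (hX : IsBanachTriangularDecomposition ι 𝒢 A B H d) {N : Type*} [NormedAddCommGroup N]
    [NormedSpace K N] [Module X' N] [IsScalarTower K X' N] [IsUltrametricDist N]
    (hN : ∀ (s : X') (v : N), ‖s • v‖ ≤ ‖s‖ * ‖v‖) {l : K} {w : N}
    (hwl : w ∈ (Algebra.lsmul K K N (ι' d) : End K N).maxGenEigenspace l) {k₀ : ℕ}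
    (hw : ∀ k : ℕ, k₀ < k → ∀ b ∈ B, b ∈ 𝒢 (-(k : ℤ)) → ι' b • w = 0) {P : N →L[K] N}
    (hP : ∀ c v, (∀ μ, c μ ∈ (Algebra.lsmul K K N (ι' d) : End K N).maxGenEigenspace μ) →
      HasSum c v → P v = c l) :
    ∃ C : ℝ, ∀ r : R, ‖P (ι' r • w)‖ ≤ C * ‖ι r‖ := by
  classical
  have := charZero_of_padic p (K := K)
  have halg := hX.algebraic
  have hPs : ∀ (μ : K) (v : N),
      v ∈ (Algebra.lsmul K K N (ι' d) : End K N).maxGenEigenspace μ →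
      P v = if μ = l then v else 0 := by
    intro μ v hv
    rw [hP (Pi.single μ v) v (fun κ => ?_) (hasSum_pi_single _ _)]
    · rw [Pi.single_apply]; simp only [eq_comm]
    · by_cases h : κ = μ
      · subst h; rwa [Pi.single_eq_same]
      · rw [Pi.single_eq_of_ne h]; exact Submodule.zero_mem _
  choose qA hqA hqAn hqAh using fun k : ℕ => exists_graded_projection p halg.inner halg.graded_A
    hX.injective hX.decomp_A hX.ws_A (k : ℤ)
  choose qB hqB hqBn hqBh using fun k : ℕ => exists_graded_projection p halg.inner halg.graded_B
    hX.injective hX.decomp_B hX.ws_B (-(k : ℤ))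
  have hHfin : FiniteDimensional K (Subalgebra.toSubmodule H) := halg.finiteDimensional_H
  obtain ⟨g, hg⟩ := ι.toLinearMap.exists_leftInverse_of_injective
    (LinearMap.ker_eq_bot.2 hX.injective)
  have hg' : ∀ x, g (ι x) = x := fun x => LinearMap.congr_fun hg x
  let qH : H.map ι →ₗ[K] R := g ∘ₗ (H.map ι).val.toLinearMap
  let f : R →ₗ[K] N := (LinearMap.toSpanSingleton X' N w).restrictScalars K ∘ₗ ι'.toLinearMap
  let m : R ⊗[K] (R ⊗[K] R) →ₗ[K] R :=
    LinearMap.mul' K R ∘ₗ TensorProduct.map LinearMap.id (LinearMap.mul' K R)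
  -- Φ k sends a ⊗ h ⊗ b to a_k h b_{-k} w, where a_k and b_{-k} are homogeneous components taken in
  -- X while the action on w goes through X'. It factors through finite-dimensional pieces, so it is
  -- bounded in terms of X.
  let Φ : ℕ → (closureIn ι A ⊗[K] (H.map ι ⊗[K] closureIn ι B)) →ₗ[K] N := fun k =>
    f ∘ₗ m ∘ₗ TensorProduct.map (qA k) (TensorProduct.map qH (qB k))
  have hΦ : ∀ k a h b, Φ k (a ⊗ₜ[K] (h ⊗ₜ[K] b)) = ι' (qA k a * (qH h * qB k b)) • w :=
    fun _ _ _ _ => rfl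
  have hbound : ∀ k, ∃ C : ℝ, ∀ z, ‖Φ k z‖ ≤ C * ‖tripleMul _ _ _ z‖ := by
    intro k
    have hAf := halg.A_fin k
    have hBf := halg.B_fin (-(k : ℤ))
    obtain ⟨CA, hCA0, hCA⟩ := exists_norm_le_of_finiteDimensional (ι := ι.toLinearMap) hX.injective
      ι'.toLinearMap (Subalgebra.toSubmodule A ⊓ 𝒢 k)
    obtain ⟨CB, hCB0, hCB⟩ := exists_norm_le_of_finiteDimensional (ι := ι.toLinearMap) hX.injective
      ι'.toLinearMap (Subalgebra.toSubmodule B ⊓ 𝒢 (-(k : ℤ)))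
    obtain ⟨CH, hCH0, hCH⟩ := exists_norm_le_of_finiteDimensional (ι := ι.toLinearMap) hX.injective
      ι'.toLinearMap (Subalgebra.toSubmodule H)
    obtain ⟨DA, hDA0, hDA⟩ := hqAn k
    obtain ⟨DB, hDB0, hDB⟩ := hqBn k
    refine hX.tensor.exists_norm_le (Φ k) (C := (CA * DA) * CH * (CB * DB) * ‖w‖) (by positivity)
      fun a h b => ?_
    have ha : ‖ι' (qA k a)‖ ≤ CA * (DA * ‖a‖) :=
      (hCA _ (hqA k a)).trans (mul_le_mul_of_nonneg_left (hDA a) hCA0)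
    have hb : ‖ι' (qB k b)‖ ≤ CB * (DB * ‖b‖) :=
      (hCB _ (hqB k b)).trans (mul_le_mul_of_nonneg_left (hDB b) hCB0)
    have hh : ‖ι' (qH h)‖ ≤ CH * ‖h‖ := by
      obtain ⟨_, x, hx, rfl⟩ := h
      have h1 := hCH x hx
      change ‖ι' (g (ι x))‖ ≤ CH * ‖ι x‖
      rwa [hg']
    rw [hΦ, map_mul, map_mul]
    refine (hN _ _).trans ?_
    have h1 : ‖ι' (qA k a) * (ι' (qH h) * ι' (qB k b))‖ ≤
        (CA * (DA * ‖a‖)) * ((CH * ‖h‖) * (CB * (DB * ‖b‖))) := by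
      refine (norm_mul_le _ _).trans (mul_le_mul ha ?_ (norm_nonneg _) (by positivity))
      exact (norm_mul_le _ _).trans (mul_le_mul hh hb (norm_nonneg _) (by positivity))
    calc _ ≤ (CA * (DA * ‖a‖)) * ((CH * ‖h‖) * (CB * (DB * ‖b‖))) * ‖w‖ := by gcongr
      _ = _ := by ring
  choose C hC using hbound
  -- The product a_i h b_{-k} shifts weights by i - k, so only i = k contributes to weight l, and
  -- b_{-k} w = 0 for k > k₀.
  have hident : ∀ a ∈ A, ∀ h ∈ H, ∀ b ∈ B, P (ι' (a * (h * b)) • w) =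
      ∑ k ∈ Finset.range (k₀ + 1), ι' ((DirectSum.decompose 𝒢 a (k : ℤ) : R) *
        (h * (DirectSum.decompose 𝒢 b (-(k : ℤ)) : R))) • w := by
    intro a ha h hh b hb
    refine halg.graded_A.induction (P := fun a => P (ι' (a * (h * b)) • w) =
      ∑ k ∈ Finset.range (k₀ + 1), ι' ((DirectSum.decompose 𝒢 a (k : ℤ) : R) *
        (h * (DirectSum.decompose 𝒢 b (-(k : ℤ)) : R))) • w) (by simp) ?_ ?_ ha
    · intro x _ y _ hx hy
      simp only [add_mul, map_add, add_smul, DirectSum.decompose_add, DirectSum.add_apply,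
        Submodule.coe_add, Finset.sum_add_distrib, hx, hy]
    intro i a haA hai
    refine halg.graded_B.induction (P := fun b => P (ι' (a * (h * b)) • w) =
      ∑ k ∈ Finset.range (k₀ + 1), ι' ((DirectSum.decompose 𝒢 a (k : ℤ) : R) *
        (h * (DirectSum.decompose 𝒢 b (-(k : ℤ)) : R))) • w) (by simp) ?_ ?_ hb
    · intro x _ y _ hx hy
      simp only [mul_add, map_add, add_smul, DirectSum.decompose_add, DirectSum.add_apply,
        Submodule.coe_add, Finset.sum_add_distrib, hx, hy]
    intro j b hbB hbj
    rcases lt_or_ge 0 j with hj | hj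
    · have h0 : b ∈ Subalgebra.toSubmodule B ⊓ 𝒢 j := ⟨hbB, hbj⟩
      rw [halg.B_pos j hj, Submodule.mem_bot] at h0
      simp [h0]
    obtain ⟨k, hk⟩ := Int.eq_ofNat_of_zero_le (neg_nonneg.2 hj)
    obtain rfl : j = -(k : ℤ) := by omega
    have hne : ∀ k' ∈ Finset.range (k₀ + 1), k' ≠ k →
        ι' ((DirectSum.decompose 𝒢 a (k' : ℤ) : R) *
        (h * (DirectSum.decompose 𝒢 b (-(k' : ℤ)) : R))) • w = 0 := by
      intro k' _ hk'
      rw [DirectSum.decompose_of_mem_ne 𝒢 hbj (by omega), mul_zero, mul_zero, map_zero, zero_smul]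
    rcases Nat.lt_or_ge k₀ k with hlt | hge
    · rw [Finset.sum_eq_zero fun k' hk' => hne k' hk' (by
        have := Finset.mem_range.1 hk'; omega)]
      rw [map_mul, map_mul, mul_smul, mul_smul, hw k hlt b hbB hbj, smul_zero, smul_zero, map_zero]
    · rw [Finset.sum_eq_single_of_mem k (Finset.mem_range.2 (by omega)) hne,
        DirectSum.decompose_of_mem_same 𝒢 hbj]
      have hgr : a * (h * b) ∈ 𝒢 (i + (0 + -(k : ℤ))) :=
        SetLike.mul_mem_graded hai (SetLike.mul_mem_graded (halg.H_le hh) hbj)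
      have hcomm : ι' d * ι' (a * (h * b)) - ι' (a * (h * b)) * ι' d
          = ((i - k : ℤ) : K) • ι' (a * (h * b)) := by
        rw [← map_mul, ← map_mul, ← map_sub, (halg.inner _ _).1 hgr, map_smul]
        congr 2
        ring
      rw [hPs _ _ (smul_mem_maxGenEigenspace hcomm hwl)]
      by_cases hik : i = k
      · subst hik
        rw [if_pos (by simp), DirectSum.decompose_of_mem_same 𝒢 hai]
      · rw [if_neg, DirectSum.decompose_of_mem_ne 𝒢 hai hik, zero_mul, map_zero, zero_smul]
        intro h
        refine hik ?_
        have h1 : ((i - k : ℤ) : K) = 0 := by simpa using h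
        have h2 : (i - k : ℤ) = 0 := by exact_mod_cast h1
        omega
  let j : (A ⊗[K] (H ⊗[K] B)) →ₗ[K] (closureIn ι A ⊗[K] (H.map ι ⊗[K] closureIn ι B)) :=
    TensorProduct.map
      ((ι.comp A.val).codRestrict (closureIn ι A) fun x => mem_closureIn x.2).toLinearMap
      (TensorProduct.map
        ((ι.comp H.val).codRestrict (H.map ι) fun x => ⟨x, x.2, rfl⟩).toLinearMap
        ((ι.comp B.val).codRestrict (closureIn ι B) fun x => mem_closureIn x.2).toLinearMap)
  have hj : ∀ z, tripleMul _ _ _ (j z) = ι (tripleMul A H B z) := by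
    intro z
    have : tripleMul _ _ _ ∘ₗ j = ι.toLinearMap ∘ₗ tripleMul A H B := by
      refine tensor_triple_ext fun a h b => ?_
      change ι a * (ι h * ι b) = ι (a * (h * b))
      rw [map_mul, map_mul]
    exact LinearMap.congr_fun this z
  have hPz : ∀ z, P (ι' (tripleMul A H B z) • w) = ∑ k ∈ Finset.range (k₀ + 1), Φ k (j z) := by
    intro z
    have : P.toLinearMap ∘ₗ f ∘ₗ tripleMul A H B = ∑ k ∈ Finset.range (k₀ + 1), Φ k ∘ₗ j := by
      refine tensor_triple_ext fun a h b => ?_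
      have h1 := hident a a.2 h h.2 b b.2
      rw [LinearMap.sum_apply]
      refine h1.trans (Finset.sum_congr rfl fun k _ => ?_)
      have h2 : qH ⟨ι h, ⟨h, h.2, rfl⟩⟩ = h := hg' h
      have h3 : (Φ k ∘ₗ j) (a ⊗ₜ[K] (h ⊗ₜ[K] b)) = ι' (qA k ⟨ι a, mem_closureIn a.2⟩ *
        (qH ⟨ι h, ⟨h, h.2, rfl⟩⟩ * qB k ⟨ι b, mem_closureIn b.2⟩)) • w := rfl
      rw [h3, h2,
        decompose_eq_of_homogeneous_eq halg.graded_A (hqAh k) (fun x hx => mem_closureIn hx) a.2,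
        decompose_eq_of_homogeneous_eq halg.graded_B (hqBh k) (fun x hx => mem_closureIn hx) b.2]
    have h1 := LinearMap.congr_fun this z
    rw [LinearMap.sum_apply] at h1
    exact h1
  refine ⟨∑ k ∈ Finset.range (k₀ + 1), C k, fun r => ?_⟩
  obtain ⟨z, rfl⟩ := halg.tensor.2 r
  rw [hPz, Finset.sum_mul]
  refine (norm_sum_le _ _).trans (Finset.sum_le_sum fun k _ => ?_)
  rw [← hj]
  exact hC k (j z)

/-- A weight vector on which `B` acts nilpotently vanishes if it can be approximated by zero through
elements of `R` which tend to one in another Banach completion. -/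
theorem IsBanachTriangularDecomposition.eq_zero_of_mem_closure [CompleteSpace X']
    [IsUltrametricDist X'] [IsNoetherianRing X'] (p : ℕ) [Fact p.Prime]
    [NormedAlgebra ℚ_[p] K]
    (hX : IsBanachTriangularDecomposition ι 𝒢 A B H d) {N : Type*} [ag : AddCommGroup N]
    [Module K N] [Module X' N] [IsScalarTower K X' N] [τ : TopologicalSpace N]
    [IsModuleTopology X' N] [Module.Finite X' N]
    (hD : HasBoundedWeights (Algebra.lsmul K K N (ι' d) : End K N)) {l : K} {w : N}
    (hwl : w ∈ (Algebra.lsmul K K N (ι' d) : End K N).maxGenEigenspace l)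
    (hcl : ((1, 0) : X × N) ∈ closure (Set.range fun r : R => (ι r, ι' r • w))) : w = 0 := by
  have := charZero_of_padic p (K := K)
  obtain ⟨k₀, hk₀⟩ := exists_maxGenEigenspace_sub_eq_bot hD.bounded l
  have hw : ∀ k : ℕ, k₀ < k → ∀ b ∈ B, b ∈ 𝒢 (-(k : ℤ)) → ι' b • w = 0 := by
    intro k hk b _ hbk
    have hcomm : ι' d * ι' b - ι' b * ι' d = (-(k : K)) • ι' b := by
      rw [← map_mul, ← map_mul, ← map_sub, (hX.algebraic.inner _ _).1 hbk, map_smul]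
      simp
    have h1 := smul_mem_maxGenEigenspace hcomm hwl
    rwa [← sub_eq_add_neg, hk₀ k hk, Submodule.mem_bot] at h1
  obtain ⟨P, hP⟩ := hD.proj l
  obtain ⟨nag, rfl, rfl, hcomp, hult, hK, hN⟩ := exists_banach_norm K X' N
  let _ : NormedSpace K N := { norm_smul_le := hK }
  obtain ⟨C, hC⟩ := hX.exists_norm_proj_smul_le p hN hwl hw hP
  classical
  have hPw : P w = w := by
    rw [hP (Pi.single l w) w (fun κ => ?_) (hasSum_pi_single _ _), Pi.single_eq_same]
    by_cases h : κ = l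
    · subst h; rwa [Pi.single_eq_same]
    · rw [Pi.single_eq_of_ne h]; exact Submodule.zero_mem _
  -- The estimate for (1 - r) w reads ‖w - P(r w)‖ ≤ C ‖1 - r‖. It is a closed condition on the pair
  -- (r, r w), and at the limit point (1, 0) it says w = 0.
  have hle : ∀ x ∈ Set.range fun r : R => (ι r, ι' r • w),
      ‖w - P x.2‖ ≤ C * ‖1 - x.1‖ := by
    rintro _ ⟨r, rfl⟩
    have h1 := hC (1 - r)
    rwa [map_sub, map_one, sub_smul, one_smul, map_sub, hPw, map_sub, map_one] at h1
  have hclosed : IsClosed {x : X × N | ‖w - P x.2‖ ≤ C * ‖1 - x.1‖} :=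
    isClosed_le (by fun_prop) (by fun_prop)
  have h0 := hclosed.closure_subset_iff.2 hle hcl
  simpa using h0

end Comparison

/-! ### Extension of scalars and flatness -/

section ExtendScalarsLemmas

variable {S T : Type*} [Ring S] [Ring T] {φ : S →+* T} {M N : Type*} [AddCommGroup M] [Module S M]
  [AddCommGroup N] [Module T N]

theorem ExtendScalars.lift_unit (f : M →ₛₗ[φ] N) (m : M) :
    ExtendScalars.lift f (ExtendScalars.unit φ M m) = f m :=
  one_smul T (f m)

theorem ExtendScalars.span_range_unit :
    Submodule.span T (Set.range (ExtendScalars.unit φ M)) = ⊤ := by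
  refine eq_top_iff.2 fun x _ => ?_
  obtain ⟨z, rfl⟩ := (balancedRelations φ M).mkQ_surjective x
  induction z using TensorProduct.induction_on with
  | zero => rw [map_zero]; exact Submodule.zero_mem _
  | tmul t m =>
    have : (t ⊗ₜ[ℤ] m : T ⊗[ℤ] M) = t • ((1 : T) ⊗ₜ[ℤ] m) := by
      rw [TensorProduct.smul_tmul', smul_eq_mul, mul_one]
    rw [this, map_smul]
    exact Submodule.smul_mem _ _ (Submodule.subset_span ⟨m, rfl⟩)
  | add z z' hz hz' => rw [map_add]; exact Submodule.add_mem _ (hz trivial) (hz' trivial)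

theorem span_range_comp_semilinear (f : M →ₛₗ[φ] N) (hf : Submodule.span T (Set.range f) = ⊤)
    {t : Type*} {w : t → M} (hw : Submodule.span S (Set.range w) = ⊤) :
    Submodule.span T (Set.range (f ∘ w)) = ⊤ := by
  rw [← hf]
  refine le_antisymm (Submodule.span_mono ?_) (Submodule.span_le.2 ?_)
  · rintro _ ⟨l, rfl⟩; exact ⟨w l, rfl⟩
  · rintro _ ⟨m, rfl⟩
    have hm : m ∈ Submodule.span S (Set.range w) := by rw [hw]; trivial
    induction hm using Submodule.span_induction with
    | mem x hx => obtain ⟨l, rfl⟩ := hx; exact Submodule.subset_span ⟨l, rfl⟩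
    | zero => rw [map_zero]; exact Submodule.zero_mem _
    | add x y _ _ hx hy => rw [map_add]; exact Submodule.add_mem _ hx hy
    | smul s x _ hx => rw [map_smulₛₗ]; exact Submodule.smul_mem _ _ hx

theorem span_range_of_lift_surjective {f : M →ₛₗ[φ] N}
    (hf : Function.Surjective (ExtendScalars.lift f)) : Submodule.span T (Set.range f) = ⊤ := by
  have h1 := congrArg (Submodule.map (ExtendScalars.lift f))
    (ExtendScalars.span_range_unit (φ := φ) (M := M))
  rw [Submodule.map_top, LinearMap.range_eq_top.2 hf, Submodule.map_span, ← Set.range_comp] at h1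
  rw [← h1]
  congr 2
  ext m
  exact (ExtendScalars.lift_unit f m).symm

/-- S/Ann(w) embeds in M by 1 ↦ w. By flatness T ⊗ S/Ann(w), which maps to T/T·φ(Ann(w)) by 1 ⊗ 1 ↦
1, embeds in T ⊗ M. There 1 ⊗ 1 becomes 1 ⊗ w, which vanishes because `τ w = 0` and the lift of τ is
injective. -/
theorem one_mem_span_of_rightFlat {S T : Type u} [Ring S] [Ring T] {φ : S →+* T} (hφ : RightFlat φ)
    {M : Type v} {N : Type*} [AddCommGroup M] [Module S M] [AddCommGroup N] [Module T N]
    [Module.Finite S M] {τ : M →ₛₗ[φ] N} (hτ : Function.Injective (ExtendScalars.lift τ)) {w : M}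
    (hw : τ w = 0) : (1 : T) ∈ Submodule.span T (φ '' {s | s • w = 0}) := by
  obtain ⟨t, f, hf⟩ := Module.Finite.exists_fin' S M
  -- Flatness only tests modules in the universe of S, so M is replaced by an isomorphic quotient of
  -- S^t.
  let M₂ := (Fin t → S) ⧸ LinearMap.ker f
  let e : M₂ ≃ₗ[S] M := f.quotKerEquivOfSurjective hf
  let J : Submodule S S := LinearMap.ker (LinearMap.toSpanSingleton S M₂ (e.symm w))
  let g : (S ⧸ J) →ₗ[S] M₂ := J.liftQ (LinearMap.toSpanSingleton S M₂ (e.symm w)) le_rfl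
  have hg : Function.Injective g :=
    LinearMap.ker_eq_bot.1 (Submodule.ker_liftQ_eq_bot _ _ _ le_rfl)
  have h0 : ExtendScalars.unit φ M w = 0 := hτ (by
    rw [ExtendScalars.lift_unit, hw, map_zero])
  have h1 : ExtendScalars.unit φ M₂ (e.symm w) = 0 := by
    have h := ExtendScalars.lift_unit ((ExtendScalars.unit φ M₂).comp e.symm.toLinearMap) w
    rw [h0, map_zero] at h
    exact h.symm
  have h2 : ExtendScalars.unit φ (S ⧸ J) (Submodule.Quotient.mk 1) = 0 := by
    refine hφ _ _ g hg ?_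
    rw [ExtendScalars.lift_unit, map_zero]
    change ExtendScalars.unit φ M₂ ((1 : S) • e.symm w) = 0
    rw [one_smul, h1]
  set I := Submodule.span T (φ '' {s | s • w = 0})
  let τ₀ : S →ₛₗ[φ] T ⧸ I :=
    { toFun := fun s => Submodule.Quotient.mk (φ s)
      map_add' := fun x y => by rw [map_add, Submodule.Quotient.mk_add]
      map_smul' := fun x y => by
        rw [smul_eq_mul, map_mul, ← smul_eq_mul, Submodule.Quotient.mk_smul] }
  have hτ₀ : J ≤ LinearMap.ker τ₀ := by
    intro s hs
    have h3 : s • e.symm w = 0 := hs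
    rw [← map_smul, LinearEquiv.map_eq_zero_iff] at h3
    exact (Submodule.Quotient.mk_eq_zero I).2 (Submodule.subset_span ⟨s, h3, rfl⟩)
  have h4 := ExtendScalars.lift_unit (J.liftQ τ₀ hτ₀) (Submodule.Quotient.mk 1)
  rw [h2, map_zero] at h4
  have h5 : (Submodule.Quotient.mk (φ 1) : T ⧸ I) = 0 := h4.symm
  rw [map_one] at h5
  exact (Submodule.Quotient.mk_eq_zero I).1 h5

end ExtendScalarsLemmas

/-! ### Density and closedness for the canonical topology -/

section TopologicalModules

theorem denseRange_of_span_range {S T : Type*} [Ring S] [Ring T] [TopologicalSpace T]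
    {φ : S →+* T} (hφ : DenseRange φ) {M N : Type*} [AddCommGroup M] [Module S M] [AddCommGroup N]
    [Module T N] [TopologicalSpace N] [ContinuousAdd N] [ContinuousSMul T N] {f : M →ₛₗ[φ] N}
    (hf : Submodule.span T (Set.range f) = ⊤) : DenseRange f := by
  intro y
  have hy : y ∈ Submodule.span T (Set.range f) := by rw [hf]; trivial
  induction hy using Submodule.span_induction with
  | mem x hx => exact subset_closure hx
  | zero => exact subset_closure ⟨0, map_zero f⟩
  | add x y _ _ hx hy =>
    refine map_mem_closure₂ continuous_add hx hy ?_
    rintro _ ⟨a, rfl⟩ _ ⟨b, rfl⟩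
    exact ⟨a + b, map_add f a b⟩
  | smul t x _ hx =>
    refine map_mem_closure₂ continuous_smul (hφ t) hx ?_
    rintro _ ⟨a, rfl⟩ _ ⟨b, rfl⟩
    exact ⟨a • b, map_smulₛₗ f a b⟩

/-- If `1` lies in the ideal generated by the image of the annihilator of `w`, it can be approximated
by elements of a dense subring which almost annihilate `w`. -/
theorem one_zero_mem_closure {R S T : Type*} [Ring R] [Ring S] [Ring T] [TopologicalSpace S]
    [TopologicalSpace T] [IsTopologicalRing T] {φ : S →+* T} (hφ : Continuous φ)
    {ι : R →+* S} {ι' : R →+* T} (hι : DenseRange ι) (hι' : DenseRange ι')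
    (hcomp : ∀ r, φ (ι r) = ι' r) {N : Type*} [AddCommGroup N] [Module S N] [TopologicalSpace N]
    [ContinuousAdd N] [ContinuousSMul S N] {w : N}
    (hw : (1 : T) ∈ Submodule.span T (φ '' {s | s • w = 0})) :
    ((1, 0) : T × N) ∈ closure (Set.range fun r : R => (ι' r, ι r • w)) := by
  suffices key : ∀ x ∈ Submodule.span T (φ '' {s | s • w = 0}),
      ((x, 0) : T × N) ∈ closure (Set.range fun r : R => (ι' r, ι r • w)) from key 1 hw
  intro x hx
  induction hx using Submodule.span_induction with
  | mem x hx =>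
    obtain ⟨s, hs, rfl⟩ := hx
    have hs : s • w = 0 := hs
    rw [← hs]
    refine map_mem_closure (f := fun s : S => (φ s, s • w)) (by fun_prop) (hι s) ?_
    rintro _ ⟨r, rfl⟩
    exact ⟨r, by simp [hcomp]⟩
  | zero => exact subset_closure ⟨0, by simp⟩
  | add x y _ _ hx hy =>
    have h := map_mem_closure₂ (f := fun a b : T × N => a + b) (by fun_prop) hx hy
      (u := Set.range fun r : R => (ι' r, ι r • w)) (by
        rintro _ ⟨a, rfl⟩ _ ⟨b, rfl⟩
        exact ⟨a + b, by simp [add_smul]⟩)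
    simpa using h
  | smul t x _ hx =>
    have hr : ∀ r : R, ((ι' r * x, 0) : T × N) ∈ closure (Set.range fun r : R => (ι' r, ι r • w)) := by
      intro r
      have h := map_mem_closure (f := fun a : T × N => (ι' r * a.1, ι r • a.2))
        (t := Set.range fun r : R => (ι' r, ι r • w)) (by fun_prop) hx (by
          rintro _ ⟨a, rfl⟩
          exact ⟨r * a, by simp [mul_smul]⟩)
      simpa using h
    have h := map_mem_closure (f := fun a : T => ((a * x, 0) : T × N))
      (t := closure (Set.range fun r : R => (ι' r, ι r • w))) (by fun_prop) (hι' t) (by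
        rintro _ ⟨r, rfl⟩
        exact hr r)
    rwa [closure_closure] at h

variable {K : Type*} [NontriviallyNormedField K] {S : Type*} [NormedRing S] [NormedAlgebra K S]
  [CompleteSpace S] [IsNoetherianRing S] [IsUltrametricDist S]

variable (K S) in
include K in
theorem isCompletelyMetrizableSpace_of_finite (N : Type*) [ag : AddCommGroup N] [Module K N]
    [Module S N] [IsScalarTower K S N] [τ : TopologicalSpace N] [IsModuleTopology S N]
    [Module.Finite S N] : TopologicalSpace.IsCompletelyMetrizableSpace N := by
  obtain ⟨nag, rfl, rfl, hcomp, -⟩ := exists_banach_norm K S N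
  infer_instance

variable (K S) in
include K in
theorem t2Space_of_finite (N : Type*) [ag : AddCommGroup N] [Module K N]
    [Module S N] [IsScalarTower K S N] [τ : TopologicalSpace N] [IsModuleTopology S N]
    [Module.Finite S N] : T2Space N := by
  obtain ⟨nag, rfl, rfl, hcomp, -⟩ := exists_banach_norm K S N
  infer_instance

variable (K S) in
include K in
theorem isClosed_submodule_of_isModuleTopology {N : Type*} [ag : AddCommGroup N] [Module K N]
    [Module S N] [IsScalarTower K S N] [τ : TopologicalSpace N] [IsModuleTopology S N]
    [Module.Finite S N] (P : Submodule S N) : IsClosed (P : Set N) := by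
  obtain ⟨nag, rfl, rfl, hcomp, hult, hK, -⟩ := exists_banach_norm K S N
  let _ : NormedSpace K N := { norm_smul_le := hK }
  exact isClosed_submodule_of_finite K S P

/-- A module generated by vectors on which `B` acts nilpotently is finitely generated over `𝒜`. -/
theorem IsBanachTriangularDecomposition.exists_span_closureIn_eq_top [CompleteSpace K]
    {R : Type*} [Ring R] [Algebra K R] {𝒢 : ℤ → Submodule K R} [GradedAlgebra 𝒢] {d : R}
    {A B H : Subalgebra K R} {ι : R →ₐ[K] S}
    (hX : IsBanachTriangularDecomposition ι 𝒢 A B H d) {N : Type*} [AddCommGroup N]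
    [Module K N] [Module S N] [IsScalarTower K S N] [TopologicalSpace N] [IsModuleTopology S N]
    [Module.Finite S N] {t : ℕ} {w : Fin t → N}
    (hw : ∀ l, ∃ n : ℕ, ∀ k : ℕ, n < k → ∀ b ∈ B, b ∈ 𝒢 (-(k : ℤ)) → ι b • w l = 0)
    (hspan : Submodule.span S (Set.range w) = ⊤) : ∃ (t' : ℕ) (r : Fin t' → R),
      (∀ j, ∃ m : ℤ, r j ∈ 𝒢 m) ∧
      Submodule.span (closureIn ι A) (Set.range fun x : Fin t × Fin t' => ι (r x.2) • w x.1) = ⊤ := by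
  choose n hn using hw
  obtain ⟨t', r, hr, hrs⟩ := hX.algebraic.exists_homogeneous_span (Finset.univ.sup n)
  refine ⟨t', r, hr, eq_top_iff.2 fun y _ => ?_⟩
  have hy : y ∈ Submodule.span S (Set.range w) := by rw [hspan]; trivial
  obtain ⟨c, rfl⟩ := (Submodule.mem_span_range_iff_exists_fun _).1 hy
  refine Submodule.sum_mem _ fun l _ => ?_
  have h := hX.smul_mem_span hrs (w := w l) (fun k hk => hn l k
    ((Finset.le_sup (f := n) (Finset.mem_univ l)).trans_lt hk)) (c l)
  refine Submodule.span_mono ?_ h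
  rintro _ ⟨j, rfl⟩
  exact ⟨(l, j), rfl⟩

end TopologicalModules

/-! ### Transferring weights along maps injective on weight spaces -/

/-- Each base point ν is replaced by the first element of ν + ℕ lying in W, and discarded if there
is none. -/
theorem exists_finset_subset_of_bounded {K : Type*} [Field K] {W : Set K}
    (hW : ∃ s : Finset K, ∀ μ ∈ W, ∃ ν ∈ s, ∃ n : ℕ, μ = ν + (n : K)) :
    ∃ s : Finset K, (s : Set K) ⊆ W ∧ ∀ μ ∈ W, ∃ ν ∈ s, ∃ n : ℕ, μ = ν + (n : K) := by
  classical
  obtain ⟨s, hs⟩ := hW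
  let f : K → K := fun ν => if h : ∃ n : ℕ, ν + (n : K) ∈ W then ν + (Nat.find h : ℕ) else 0
  refine ⟨(s.filter fun ν => ∃ n : ℕ, ν + (n : K) ∈ W).image f, ?_, fun μ hμ => ?_⟩
  · intro x hx
    obtain ⟨ν, hν, rfl⟩ := Finset.mem_image.1 hx
    have h := (Finset.mem_filter.1 hν).2
    simp only [f, dif_pos h]
    exact Nat.find_spec h
  · obtain ⟨ν, hν, n, rfl⟩ := hs μ hμ
    have h : ∃ n : ℕ, ν + (n : K) ∈ W := ⟨n, hμ⟩
    refine ⟨f ν, Finset.mem_image_of_mem f (Finset.mem_filter.2 ⟨hν, h⟩), n - Nat.find h, ?_⟩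
    simp only [f, dif_pos h]
    rw [Nat.cast_sub (Nat.find_min' h hμ)]
    ring

theorem finiteDimensional_maxGenEigenspace_of_injOn {K V W : Type*} [Field K] [AddCommGroup V]
    [Module K V] [AddCommGroup W] [Module K W] {D : End K V} {D' : End K W} {f : V →ₗ[K] W}
    (h : ∀ v, f (D v) = D' (f v)) {μ : K} [FiniteDimensional K (D'.maxGenEigenspace μ)]
    (hf : ∀ v ∈ D.maxGenEigenspace μ, f v = 0 → v = 0) :
    FiniteDimensional K (D.maxGenEigenspace μ) := by
  refine FiniteDimensional.of_injective
    (f.restrict (q := D'.maxGenEigenspace μ) fun m hm => map_mem_maxGenEigenspace h hm)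
    ((injective_iff_map_eq_zero _).2 fun m hm => Subtype.ext ?_)
  exact hf _ m.2 (congrArg Subtype.val hm)

/-- A vector is a weight vector if all its images are, for a family of maps which is separating
on such vectors. -/
theorem mem_maxGenEigenspace_of_map_mem {K V : Type*} {J : Type*} {W : J → Type*} [Field K]
    [AddCommGroup V] [Module K V] [∀ j, AddCommGroup (W j)] [∀ j, Module K (W j)] {D : End K V}
    {D' : ∀ j, End K (W j)} {f : ∀ j, V →ₗ[K] W j} (h : ∀ j v, f j (D v) = D' j (f j v)) {μ : K}
    {j₀ : J} (hf : ∀ v, (∀ j, f j v ∈ (D' j).maxGenEigenspace μ) → f j₀ v = 0 → v = 0) {v : V}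
    (hv : ∀ j, f j v ∈ (D' j).maxGenEigenspace μ) : v ∈ D.maxGenEigenspace μ := by
  obtain ⟨k, hk⟩ := Module.End.mem_maxGenEigenspace _ _ _ |>.1 (hv j₀)
  refine (Module.End.mem_maxGenEigenspace _ _ _).2 ⟨k, ?_⟩
  have key : ∀ j, f j (((D - μ • 1) ^ k) v) = ((D' j - μ • 1) ^ k) (f j v) := fun j =>
    map_sub_smul_one_pow (f := f j) (by simp [h]) k v
  -- The exponent k is the one that works at j₀. The vector (D - μ)^k v still has weight vectors as
  -- images, and its image at j₀ is 0, so it vanishes.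
  refine hf _ (fun j => ?_) ((key j₀).trans hk)
  rw [key]
  have hc : Commute (D' j) ((D' j - μ • 1) ^ k) :=
    ((Commute.refl _).sub_right ((Commute.one_right _).smul_right μ)).pow_right k
  exact Module.End.mapsTo_maxGenEigenspace_of_comm hc μ (hv j)

theorem hasFiniteTypeWeightDecomposition_of_injOn {K V W : Type*} [Field K] [AddCommGroup V]
    [Module K V] [TopologicalSpace V] [AddCommGroup W] [Module K W] [TopologicalSpace W]
    {D : End K V} {D' : End K W} {f : V →ₗ[K] W} (h : ∀ v, f (D v) = D' (f v))
    (hf : ∀ μ, ∀ v ∈ D.maxGenEigenspace μ, f v = 0 → v = 0) (hD' : HasBoundedWeights D')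
    (hD : ∀ v, ∃ c : K → V, (∀ μ, c μ ∈ D.maxGenEigenspace μ) ∧ HasSum c v) :
    HasFiniteTypeWeightDecomposition D ∧
      ∃ s : Finset K, (s : Set K) ⊆ weights D ∧
        ∀ μ ∈ weights D, ∃ ν ∈ s, ∃ n : ℕ, μ = ν + (n : K) := by
  have hW : weights D ⊆ weights D' := by
    intro μ hμ
    obtain ⟨m, hm, h0⟩ := Submodule.exists_mem_ne_zero_of_ne_bot hμ
    exact mem_weights_of_ne_zero (map_mem_maxGenEigenspace h hm) fun h => h0 (hf μ m hm h)
  obtain ⟨s, hs⟩ := hD'.bounded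
  refine ⟨⟨weights D, hasWeightDecomposition_of_hasSum hD, ⟨s, fun μ hμ => ?_⟩, fun μ _ => ?_⟩,
    exists_finset_subset_of_bounded ⟨s, fun μ hμ => hs μ (hW hμ)⟩⟩
  · obtain ⟨ν, hν, n, hn⟩ := hs μ (hW hμ)
    exact ⟨ν, hν, n, by rw [hn]; simp⟩
  · have := hD'.finite μ
    exact finiteDimensional_maxGenEigenspace_of_injOn h (hf μ)

/-! ### Co-admissible modules: from condition (i) to condition (ii) -/

section FrechetModules

variable {K : Type w} [NontriviallyNormedField K]
  {X : ℕ → Type u} [∀ n, NormedRing (X n)] [∀ n, NormedAlgebra K (X n)]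
  {ρ : ∀ n, X (n + 1) →A[K] X n}

instance (M : CoherentModule.{u, v, w} ρ) (n : ℕ) : IsModuleTopology (X n) (M.obj n) := ⟨rfl⟩

instance (M : CoherentModule.{u, v, w} ρ) (n : ℕ) : Module.Finite (X n) (M.obj n) := M.finite n

instance (M : CoherentModule.{u, v, w} ρ) (n : ℕ) : IsTopologicalAddGroup (M.obj n) :=
  IsModuleTopology.topologicalAddGroup (X n) (M.obj n)

namespace CoherentModule

variable (M : CoherentModule.{u, v, w} ρ)

theorem transition_smul (n : ℕ) (a : K) (x : M.obj (n + 1)) :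
    M.transition n (a • x) = a • M.transition n x := by
  rw [← algebraMap_smul (X (n + 1)) a x, LinearMap.map_smulₛₗ, ← algebraMap_smul (X n) a]
  congr 1
  exact AlgHomClass.commutes (ρ n) a

/-- The transition maps, as `K`-linear maps. -/
def transitionLinear (n : ℕ) : M.obj (n + 1) →ₗ[K] M.obj n where
  toFun := M.transition n
  map_add' := map_add _
  map_smul' := M.transition_smul n

theorem continuous_transition (n : ℕ) : Continuous (M.transition n) :=
  IsModuleTopology.continuous_of_linearMapₛₗ (ρ n).continuous (M.transition n)

theorem span_range_transition (n : ℕ) :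
    Submodule.span (X n) (Set.range (M.transition n)) = ⊤ :=
  span_range_of_lift_surjective (M.bijective n).2

theorem denseRange_transition (hρ : IsFrechetStein ρ) (n : ℕ) : DenseRange (M.transition n) :=
  denseRange_of_span_range (hρ.dense n) (M.span_range_transition n)

/-- The canonical map from the limit to the `n`-th term. -/
def ev (n : ℕ) : M.limit →ₗ[K] M.obj n where
  toFun m := m.1 n
  map_add' _ _ := rfl
  map_smul' _ _ := rfl

theorem transition_ev (n : ℕ) (m : M.limit) : M.transition n (M.ev (n + 1) m) = M.ev n m := m.2 n

theorem continuous_ev (n : ℕ) : Continuous (M.ev n) :=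
  (continuous_apply n).comp continuous_subtype_val

theorem hasSum_limit {α : Type*} {c : α → M.limit} {v : M.limit}
    (h : ∀ n, HasSum (fun i => M.ev n (c i)) (M.ev n v)) : HasSum c v := by
  have hg : IsInducing (Submodule.subtype M.limit).toAddMonoidHom := IsInducing.subtypeVal
  exact (hg.hasSum_iff c v).1 (Pi.hasSum.2 h)

variable {R : Type*} [Ring R] [Algebra K R] (ι : R →ₐ[K] invLim ρ)

/-- The action of `r ∈ R` on the `n`-th term. -/
noncomputable abbrev actTerm (r : R) (n : ℕ) : End K (M.obj n) :=
  Algebra.lsmul K K (M.obj n) (((proj ρ n).comp ι) r)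

theorem ev_act (r : R) (n : ℕ) (m : M.limit) : M.ev n (M.act ι r m) = M.actTerm ι r n (M.ev n m) :=
  rfl

theorem transition_smul_term (r : R) (n : ℕ) (x : M.obj (n + 1)) :
    M.transition n (((proj ρ (n + 1)).comp ι) r • x) =
      ((proj ρ n).comp ι) r • M.transition n x := by
  rw [LinearMap.map_smulₛₗ]
  congr 1
  exact (ι r).2 n

variable {M ι} {d : R} {μ : K}

theorem transition_mem {n : ℕ} {x : M.obj (n + 1)}
    (hx : x ∈ (M.actTerm ι d (n + 1)).maxGenEigenspace μ) :
    M.transition n x ∈ (M.actTerm ι d n).maxGenEigenspace μ :=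
  map_mem_maxGenEigenspace (f := M.transitionLinear n) (M.transition_smul_term ι d n) hx

theorem ev_mem {n : ℕ} {m : M.limit} (hm : m ∈ (M.act ι d).maxGenEigenspace μ) :
    M.ev n m ∈ (M.actTerm ι d n).maxGenEigenspace μ :=
  map_mem_maxGenEigenspace (f := M.ev n) (M.ev_act ι d n) hm

variable {𝒢 : ℤ → Submodule K R} [GradedAlgebra 𝒢] {A B H : Subalgebra K R}
  [CompleteSpace K] [IsUltrametricDist K]

omit [CompleteSpace K] [IsUltrametricDist K] in
theorem InO.exists_weight_generators (hρ : IsFrechetStein ρ)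
    (hA : IsFrechetStein (closureTower ι A)) (h : M.InO ι A d) (n : ℕ) :
    ∃ (t : ℕ) (w : Fin t → M.obj n) (lam : Fin t → K),
      (∀ l, w l ∈ (M.actTerm ι d n).maxGenEigenspace (lam l)) ∧
      Submodule.span (closureTerm ι A n) (Set.range w) = ⊤ := by
  have := hρ.complete
  have := hρ.ultrametric
  have := hρ.noetherian
  have := hA.noetherian n
  obtain ⟨-, ⟨I, hI⟩, h2⟩ := h n
  exact TriangularO.exists_weight_generators hI

section Prime

variable (p : ℕ) [Fact p.Prime] [NormedAlgebra ℚ_[p] K]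

-- Flatness makes 1 a limit in X n of elements of R that nearly annihilate x, and the comparison
-- estimate then forces x = 0. Here X n is the completion measuring r, while X (n + 1) acts on x.
include p in
theorem eq_zero_of_transition_eq_zero (hρ : IsFrechetStein ρ)
    (hR : IsFrechetTriangularDecomposition ι 𝒢 A B H d) {n : ℕ}
    (hD : HasBoundedWeights (M.actTerm ι d (n + 1))) {x : M.obj (n + 1)}
    (hx : x ∈ (M.actTerm ι d (n + 1)).maxGenEigenspace μ) (h : M.transition n x = 0) : x = 0 := by
  have := hρ.complete
  have := hρ.ultrametric
  have := hρ.noetherian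
  refine (hR.banach n).eq_zero_of_mem_closure p hD hx ?_
  exact one_zero_mem_closure (φ := ((ρ n : X (n + 1) →ₐ[K] X n) : X (n + 1) →+* X n))
    (ι := ((proj ρ (n + 1)).comp ι : R →+* X (n + 1))) (ι' := ((proj ρ n).comp ι : R →+* X n))
    (ρ n).continuous (hR.banach (n + 1)).dense (hR.banach n).dense (fun r => (ι r).2 n)
    (one_mem_span_of_rightFlat (hρ.flat n) (M.bijective n).1 h)

include p in
theorem eq_zero_of_ev_zero (hρ : IsFrechetStein ρ)
    (hR : IsFrechetTriangularDecomposition ι 𝒢 A B H d)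
    (hD : ∀ n, HasBoundedWeights (M.actTerm ι d n)) {m : M.limit}
    (hm : ∀ n, M.ev n m ∈ (M.actTerm ι d n).maxGenEigenspace μ) (h : M.ev 0 m = 0) : m = 0 := by
  have h' : ∀ n, M.ev n m = 0 := by
    intro n
    induction n with
    | zero => exact h
    | succ n ih =>
      exact eq_zero_of_transition_eq_zero p hρ hR (hD _) (hm _) ((M.transition_ev n m).trans ih)
  exact Subtype.ext (funext h')

include p in
theorem mem_maxGenEigenspace_of_ev_mem (hρ : IsFrechetStein ρ)
    (hR : IsFrechetTriangularDecomposition ι 𝒢 A B H d)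
    (hD : ∀ n, HasBoundedWeights (M.actTerm ι d n)) {m : M.limit}
    (hm : ∀ n, M.ev n m ∈ (M.actTerm ι d n).maxGenEigenspace μ) :
    m ∈ (M.act ι d).maxGenEigenspace μ := by
  exact mem_maxGenEigenspace_of_map_mem (f := fun n => M.ev n) (fun n => M.ev_act ι d n) (j₀ := 0)
    (fun v hv h0 => eq_zero_of_ev_zero p hρ hR hD hv h0) hm

omit [CompleteSpace K] in
include p in
theorem InO.hasBoundedWeights (hρ : IsFrechetStein ρ)
    (hR : IsFrechetTriangularDecomposition ι 𝒢 A B H d)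
    (hA : IsFrechetStein (closureTower ι A)) (h : M.InO ι A d) (n : ℕ) :
    HasBoundedWeights (M.actTerm ι d n) := by
  have := hρ.complete
  have := hρ.ultrametric
  have := hρ.noetherian
  obtain ⟨t, w, lam, hw, hs⟩ := h.exists_weight_generators hρ hA n
  exact (hR.banach n).hasBoundedWeights p hw hs

-- Transition maps are continuous and preserve weights, so uniqueness of components at level n shows
-- that the components at all levels form threads. Convergence in the limit is convergence at each
-- level.
include p in
theorem exists_hasSum_of_boundedWeights (hρ : IsFrechetStein ρ)
    (hR : IsFrechetTriangularDecomposition ι 𝒢 A B H d)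
    (hD : ∀ n, HasBoundedWeights (M.actTerm ι d n)) (v : M.limit) :
    ∃ c : K → M.limit, (∀ μ, c μ ∈ (M.act ι d).maxGenEigenspace μ) ∧ HasSum c v := by
  choose c hc hcs using fun n => (hD n).decomp (M.ev n v)
  have hT : ∀ n μ, M.transition n (c (n + 1) μ) = c n μ := by
    intro n μ
    have h1 := (hcs (n + 1)).map (M.transition n) (M.continuous_transition n)
    rw [M.transition_ev] at h1
    have := hρ.complete
    have := hρ.ultrametric
    have := hρ.noetherian
    have h2 := (hD n).eq_zero (c := fun μ => M.transition n (c (n + 1) μ) - c n μ)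
      (fun μ => Submodule.sub_mem _ (transition_mem (hc _ μ)) (hc n μ)) (by
        have := h1.sub (hcs n)
        rwa [sub_self] at this) μ
    exact sub_eq_zero.1 h2
  refine ⟨fun μ => ⟨fun n => c n μ, fun n => hT n μ⟩, fun μ => ?_, M.hasSum_limit hcs⟩
  exact mem_maxGenEigenspace_of_ev_mem p hρ hR hD fun n => hc n μ

include p in
theorem InO.inOws (hρ : IsFrechetStein ρ)
    (hR : IsFrechetTriangularDecomposition ι 𝒢 A B H d)
    (hA : IsFrechetStein (closureTower ι A)) (h : M.InO ι A d) :
    M.InOws ι d ∧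
      ∃ s : Finset K, (s : Set K) ⊆ TriangularO.weights (V := M.limit) (M.act ι d) ∧
        ∀ μ ∈ TriangularO.weights (V := M.limit) (M.act ι d), ∃ ν ∈ s, ∃ n : ℕ, μ = ν + (n : K) := by
  have hD := h.hasBoundedWeights p hρ hR hA
  exact hasFiniteTypeWeightDecomposition_of_injOn (f := M.ev 0) (M.ev_act ι d 0)
    (fun μ m hm h => eq_zero_of_ev_zero p hρ hR hD (fun n => ev_mem hm) h) (hD 0)
    (exists_hasSum_of_boundedWeights p hρ hR hD)

end Prime

end CoherentModule

end FrechetModules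

/-! ### Local nilpotence of B, and the way back to condition (i) -/

/-- An element of degree -k sends weight l to l - k, which is no weight for large k; a general m is
a finite sum of weight vectors. -/
theorem exists_smul_eq_zero_of_mem_weightPart {K S N : Type*} [Field K] [CharZero K] [Ring S]
    [Algebra K S] [AddCommGroup N] [Module K N] [Module S N] [IsScalarTower K S N] {δ : S}
    (hb : ∃ s : Finset K, ∀ μ ∈ weights (Algebra.lsmul K K N δ : End K N),
      ∃ ν ∈ s, ∃ n : ℕ, μ = ν + (n : K)) {m : N}
    (hm : m ∈ weightPart (Algebra.lsmul K K N δ : End K N)) :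
    ∃ n : ℕ, ∀ k : ℕ, n < k → ∀ b : S, δ * b - b * δ = (-(k : K)) • b → b • m = 0 := by
  refine Submodule.iSup_induction _ (motive := fun m => ∃ n : ℕ, ∀ k : ℕ, n < k →
    ∀ b : S, δ * b - b * δ = (-(k : K)) • b → b • m = 0) hm (fun l m hm => ?_)
    ⟨0, fun _ _ _ _ => smul_zero _⟩ ?_
  · obtain ⟨k₀, hk₀⟩ := exists_maxGenEigenspace_sub_eq_bot hb l
    refine ⟨k₀, fun k hk b hb => ?_⟩
    have h := smul_mem_maxGenEigenspace hb hm
    rwa [← sub_eq_add_neg, hk₀ k hk, Submodule.mem_bot] at h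
  · rintro x y ⟨n, hn⟩ ⟨n', hn'⟩
    refine ⟨max n n', fun k hk b hb => ?_⟩
    rw [smul_add, hn k (lt_of_le_of_lt (le_max_left _ _) hk) b hb,
      hn' k (lt_of_le_of_lt (le_max_right _ _) hk) b hb, add_zero]

section FrechetModules

variable {K : Type w} [NontriviallyNormedField K]
  {X : ℕ → Type u} [∀ n, NormedRing (X n)] [∀ n, NormedAlgebra K (X n)]
  {ρ : ∀ n, X (n + 1) →A[K] X n}

namespace CoherentModule

variable {M : CoherentModule.{u, v, w} ρ} {R : Type*} [Ring R] [Algebra K R] {ι : R →ₐ[K] invLim ρ}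
  {d : R} {μ : K} {𝒢 : ℤ → Submodule K R} [GradedAlgebra 𝒢] {A B H : Subalgebra K R}

theorem locallyNilpotent_of_bounded [CharZero K]
    (hR : IsFrechetTriangularDecomposition ι 𝒢 A B H d)
    (hb : ∃ s : Finset K, ∀ μ ∈ weights (V := M.limit) (M.act ι d),
      ∃ ν ∈ s, ∃ n : ℕ, μ = ν + (n : K)) : M.LocallyNilpotent ι 𝒢 B d := by
  intro m hm
  obtain ⟨n, hn⟩ := exists_smul_eq_zero_of_mem_weightPart (S := invLim ρ) (N := M.limit) hb hm
  refine ⟨n, fun k hk b _ hbk => hn k hk (ι b) ?_⟩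
  have h := ((hR.banach 0).algebraic.inner _ b).1 hbk
  rw [← map_mul, ← map_mul, ← map_sub, h, map_smul]
  simp

/-- The images of the weight vectors of the limit generate each term. -/
theorem span_ev_weightVectors_eq_top [CompleteSpace K] [IsUltrametricDist K]
    (hρ : IsFrechetStein ρ) {I : Set K}
    (hI : HasWeightDecomposition (V := M.limit) (M.act ι d) I) (n : ℕ) :
    Submodule.span (X n) {x : M.obj n | ∃ m : M.limit,
      (∃ μ, m ∈ (M.act ι d).maxGenEigenspace μ) ∧ M.ev n m = x} = ⊤ := by
  have := hρ.complete
  have := hρ.ultrametric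
  have := hρ.noetherian
  have := fun k => isCompletelyMetrizableSpace_of_finite K (X k) (M.obj k)
  set P := Submodule.span (X n) {x : M.obj n | ∃ m : M.limit,
      (∃ μ, m ∈ (M.act ι d).maxGenEigenspace μ) ∧ M.ev n m = x} with hP
  have hcl : IsClosed (P : Set (M.obj n)) := isClosed_submodule_of_isModuleTopology K (X n) P
  -- The values of threads are dense by Mittag-Leffler, and each is a limit of sums of images of
  -- weight vectors, so lies in the closed submodule P.
  have hd : Dense (P : Set (M.obj n)) := by
    refine (dense_thread_values (fun k => M.transition k) M.continuous_transition
      (M.denseRange_transition hρ) n).mono ?_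
    rintro _ ⟨m, hm, rfl⟩
    obtain ⟨c, hc, hs⟩ := hI.2 ⟨m, hm⟩
    have h := hs.map (M.ev n) (M.continuous_ev n)
    exact hcl.mem_of_tendsto h (Eventually.of_forall fun s => Submodule.sum_mem _ fun i _ =>
      Submodule.subset_span ⟨c i, ⟨i, hc i⟩, rfl⟩)
  refine SetLike.coe_injective ?_
  rw [Submodule.top_coe, ← hcl.closure_eq, hd.closure_eq]

/-- Finitely many weight vectors w_l coming from the limit generate M(n) over X n. As B is nilpotent
on them, suitable products r_j w_l with r_j homogeneous generate over 𝒜(n), and these are again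
weight vectors, of weight lam l + deg r_j. -/
theorem LocallyNilpotent.exists_weight_generators [CompleteSpace K] [IsUltrametricDist K]
    (h : M.LocallyNilpotent ι 𝒢 B d) (hρ : IsFrechetStein ρ)
    (hR : IsFrechetTriangularDecomposition ι 𝒢 A B H d) {I : Set K}
    (hI : HasWeightDecomposition (V := M.limit) (M.act ι d) I) (n : ℕ) :
    ∃ (t : ℕ) (w : Fin t → M.obj n) (lam : Fin t → K),
      (∀ l, w l ∈ (M.actTerm ι d n).maxGenEigenspace (lam l)) ∧
      Submodule.span (closureTerm ι A n) (Set.range w) = ⊤ := by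
  have := hρ.complete
  have := hρ.ultrametric
  have := hρ.noetherian
  obtain ⟨t, w, hw, hs⟩ := exists_fin_generators (span_ev_weightVectors_eq_top (ι := ι) hρ hI n)
  choose m hm hmw using hw
  choose lam hlam using hm
  have hnil : ∀ l, ∃ n₀ : ℕ, ∀ k : ℕ, n₀ < k → ∀ b ∈ B, b ∈ 𝒢 (-(k : ℤ)) →
      ((proj ρ n).comp ι) b • w l = 0 := by
    intro l
    obtain ⟨n₀, hn₀⟩ := h (m l) (Submodule.mem_iSup_of_mem (lam l) (hlam l))
    refine ⟨n₀, fun k hk b hb hbk => ?_⟩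
    have h := congrArg (M.ev n) (hn₀ k hk b hb hbk)
    rwa [M.ev_act, map_zero, hmw l] at h
  obtain ⟨t', r, hr, hrs⟩ := (hR.banach n).exists_span_closureIn_eq_top hnil hs
  choose i hi using hr
  let e : Fin (t * t') ≃ Fin t × Fin t' := finProdFinEquiv.symm
  refine ⟨t * t', fun j => ((proj ρ n).comp ι) (r (e j).2) • w (e j).1,
    fun j => lam (e j).1 + (i (e j).2 : K), fun j => ?_, ?_⟩
  · refine smul_mem_maxGenEigenspace ?_ ?_
    · rw [← map_mul, ← map_mul, ← map_sub, ((hR.banach n).algebraic.inner _ _).1 (hi _), map_smul]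
    · rw [← hmw]
      exact ev_mem (hlam _)
  · rw [← hrs]
    congr 1
    exact e.surjective.range_comp fun x : Fin t × Fin t' => ((proj ρ n).comp ι) (r x.2) • w x.1

theorem LocallyNilpotent.inO (p : ℕ) [Fact p.Prime] [NormedAlgebra ℚ_[p] K] [CompleteSpace K]
    [IsUltrametricDist K] (h : M.LocallyNilpotent ι 𝒢 B d) (hρ : IsFrechetStein ρ)
    (hR : IsFrechetTriangularDecomposition ι 𝒢 A B H d) {I : Set K}
    (hI : HasWeightDecomposition (V := M.limit) (M.act ι d) I) : M.InO ι A d := by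
  intro n
  have := hρ.complete
  have := hρ.ultrametric
  have := hρ.noetherian
  obtain ⟨t, w, lam, hw, hs⟩ := h.exists_weight_generators hρ hR hI n
  refine ⟨M.finite n, ⟨_, hasWeightDecomposition_of_hasSum
    ((hR.banach n).hasBoundedWeights p hw hs).decomp⟩, ⟨hs ▸ Submodule.fg_span (Set.finite_range w)⟩⟩

end CoherentModule

end FrechetModules

theorem ExtendScalars.lift_surjective {S T : Type*} [Ring S] [Ring T] {φ : S →+* T} {M N : Type*}
    [AddCommGroup M] [Module S M] [AddCommGroup N] [Module T N] {f : M →ₛₗ[φ] N}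
    (hf : Submodule.span T (Set.range f) = ⊤) : Function.Surjective (ExtendScalars.lift f) := by
  rw [← LinearMap.range_eq_top, eq_top_iff, ← hf, Submodule.span_le]
  rintro _ ⟨m, rfl⟩
  exact ⟨_, ExtendScalars.lift_unit f m⟩

/-! ### Co-admissibility over the closure of A -/

section FrechetModules

variable {K : Type w} [NontriviallyNormedField K]
  {X : ℕ → Type u} [∀ n, NormedRing (X n)] [∀ n, NormedAlgebra K (X n)]
  {ρ : ∀ n, X (n + 1) →A[K] X n}

namespace CoherentModule

variable {M : CoherentModule.{u, v, w} ρ} {R : Type*} [Ring R] [Algebra K R] {ι : R →ₐ[K] invLim ρ}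
  {d : R} {μ : K} {𝒢 : ℤ → Submodule K R} [GradedAlgebra 𝒢] {A B H : Subalgebra K R}

variable (M ι A) in
/-- The transition maps over the tower `𝒜(n)`. -/
noncomputable def closureTransition (n : ℕ) : M.obj (n + 1) →ₛₗ[((closureTower ι A n :
    closureTerm ι A (n + 1) →ₐ[K] closureTerm ι A n) :
      closureTerm ι A (n + 1) →+* closureTerm ι A n)] M.obj n where
  toFun := M.transition n
  map_add' := map_add _
  map_smul' a x := (M.transition n).map_smulₛₗ (a : X (n + 1)) x

variable (p : ℕ) [Fact p.Prime] [NormedAlgebra ℚ_[p] K] [CompleteSpace K] [IsUltrametricDist K]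

-- M(n) is generated over 𝒜(n) by vectors r • T(w), with r ∈ R, w a weight generator of M(n+1) and T
-- the transition map. Since R acts compatibly on both levels, these equal T(r • w).
include p in
theorem InO.span_range_closureTransition (h : M.InO ι A d) (hρ : IsFrechetStein ρ)
    (hR : IsFrechetTriangularDecomposition ι 𝒢 A B H d)
    (hA : IsFrechetStein (closureTower ι A)) (n : ℕ) :
    Submodule.span (closureTerm ι A n) (Set.range (M.closureTransition ι A n)) = ⊤ := by
  have := hρ.complete
  have := hρ.ultrametric
  have := hρ.noetherian
  have : CharZero K := charZero_of_padic p
  obtain ⟨t, w, lam, hw, hs⟩ := h.exists_weight_generators hρ hA (n + 1)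
  have hs' : Submodule.span (X (n + 1)) (Set.range w) = ⊤ := by
    refine eq_top_iff.2 fun x _ => ?_
    have hx : x ∈ Submodule.span (closureTerm ι A (n + 1)) (Set.range w) := by rw [hs]; trivial
    exact Submodule.span_le_restrictScalars (closureTerm ι A (n + 1)) (X (n + 1)) _ hx
  have hnil : ∀ l, ∃ n₀ : ℕ, ∀ k : ℕ, n₀ < k → ∀ b ∈ B, b ∈ 𝒢 (-(k : ℤ)) →
      ((proj ρ n).comp ι) b • (M.transition n ∘ w) l = 0 := by
    intro l
    obtain ⟨n₀, hn₀⟩ := exists_maxGenEigenspace_sub_eq_bot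
      (h.hasBoundedWeights p hρ hR hA (n + 1)).bounded (lam l)
    refine ⟨n₀, fun k hk b _ hbk => ?_⟩
    have h1 : ((proj ρ (n + 1)).comp ι) b • w l ∈
        (M.actTerm ι d (n + 1)).maxGenEigenspace (lam l + (-(k : K))) := by
      refine smul_mem_maxGenEigenspace ?_ (hw l)
      rw [← map_mul, ← map_mul, ← map_sub, ((hR.banach n).algebraic.inner _ _).1 hbk, map_smul]
      simp
    rw [← sub_eq_add_neg, hn₀ k hk, Submodule.mem_bot] at h1
    rw [Function.comp_apply, ← transition_smul_term, h1, map_zero]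
  obtain ⟨t', r, -, hrs⟩ := (hR.banach n).exists_span_closureIn_eq_top hnil
    (span_range_comp_semilinear _ (M.span_range_transition n) hs')
  rw [eq_top_iff, ← hrs]
  refine Submodule.span_mono ?_
  rintro _ ⟨x, rfl⟩
  exact ⟨((proj ρ (n + 1)).comp ι) (r x.2) • w x.1, M.transition_smul_term ι _ _ _⟩

-- An element of 𝒜(n) ⊗ M(n+1) is a convergent sum of elements 1 ⊗ y_μ with y_μ a weight vector of
-- M(n+1). If it maps to 0 in M(n), uniqueness of components kills the image of each y_μ, and
-- injectivity on weight spaces kills y_μ itself.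
include p in
theorem InO.injective_closureTransition (h : M.InO ι A d) (hρ : IsFrechetStein ρ)
    (hR : IsFrechetTriangularDecomposition ι 𝒢 A B H d)
    (hA : IsFrechetStein (closureTower ι A)) (n : ℕ) :
    Function.Injective (ExtendScalars.lift (M.closureTransition ι A n)) := by
  have := hρ.complete
  have := hρ.ultrametric
  have := hρ.noetherian
  have := hA.complete
  have := hA.ultrametric
  have := hA.noetherian
  have : CharZero K := charZero_of_padic p
  obtain ⟨t, w, lam, hw, hs⟩ := h.exists_weight_generators hρ hA (n + 1)
  set σ := ((closureTower ι A n : closureTerm ι A (n + 1) →ₐ[K] closureTerm ι A n) :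
      closureTerm ι A (n + 1) →+* closureTerm ι A n)
  let P := ExtendScalars σ (M.obj (n + 1))
  let u := ExtendScalars.unit σ (M.obj (n + 1))
  -- P is finite over the noetherian Banach algebra 𝒜(n), so its canonical topology is Hausdorff and
  -- sums in it are unique.
  let _ : TopologicalSpace P := moduleTopology (closureTerm ι A n) P
  have : IsModuleTopology (closureTerm ι A n) P := ⟨rfl⟩
  have : IsTopologicalAddGroup P := IsModuleTopology.topologicalAddGroup (closureTerm ι A n) P
  have : ContinuousSMul (closureTerm ι A n) P := IsModuleTopology.toContinuousSMul _ _
  have hus : Submodule.span (closureTerm ι A n) (Set.range (u ∘ w)) = ⊤ :=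
    span_range_comp_semilinear _ ExtendScalars.span_range_unit hs
  have : Module.Finite (closureTerm ι A n) P := ⟨hus ▸ Submodule.fg_span (Set.finite_range _)⟩
  have : T2Space P := t2Space_of_finite K (closureTerm ι A n) P
  have hcont : Continuous (ExtendScalars.lift (M.closureTransition ι A n)) :=
    IsModuleTopology.continuous_of_linearMap _
  refine (injective_iff_map_eq_zero _).2 fun x hx => ?_
  obtain ⟨a, rfl⟩ := (Submodule.mem_span_range_iff_exists_fun _).1
    (hus ▸ Submodule.mem_top : x ∈ Submodule.span (closureTerm ι A n) (Set.range (u ∘ w)))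
  have hn := hR.banach n
  choose c hc hcs using fun l => exists_graded_hasSum hn.algebraic.inner hn.algebraic.graded_A
    hn.injective hn.decomp_A hn.ws_A (a l)
  have hcA : ∀ l κ, c l κ ∈ A := fun l κ => by
    by_cases h0 : c l κ = 0
    · rw [h0]; exact A.zero_mem
    · obtain ⟨i, -, h1, -⟩ := hc l κ h0
      exact h1
  let a' : Fin t → K → closureTerm ι A n := fun l κ => ⟨((proj ρ n).comp ι) (c l κ),
    mem_closureIn (hcA l κ)⟩
  let a'' : Fin t → K → closureTerm ι A (n + 1) := fun l κ => ⟨((proj ρ (n + 1)).comp ι) (c l κ),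
    mem_closureIn (hcA l κ)⟩
  have ha : ∀ l κ, σ (a'' l κ) = a' l κ := fun l κ => Subtype.ext ((ι (c l κ)).2 n)
  -- The homogeneous components of the a_l lie in A, hence also in 𝒜(n+1), so they can be moved
  -- across the tensor product to act on w_l in M(n+1).
  let y : K → M.obj (n + 1) := fun μ => ∑ l, a'' l (μ - lam l) • w l
  have hy : ∀ μ, y μ ∈ (M.actTerm ι d (n + 1)).maxGenEigenspace μ := by
    intro μ
    refine Submodule.sum_mem _ fun l _ => ?_
    by_cases h0 : c l (μ - lam l) = 0
    · have : a'' l (μ - lam l) = 0 := Subtype.ext (by simp [a'', h0])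
      rw [this, zero_smul]
      exact Submodule.zero_mem _
    · obtain ⟨i, hi, -, hci⟩ := hc l _ h0
      have h1 := smul_mem_maxGenEigenspace (δ := ((proj ρ (n + 1)).comp ι) d)
        (x := ((proj ρ (n + 1)).comp ι) (c l (μ - lam l))) (n := (i : K)) (by
          rw [← map_mul, ← map_mul, ← map_sub, (hn.algebraic.inner _ _).1 hci, map_smul]) (hw l)
      rwa [← hi, add_sub_cancel] at h1
  have hsum : HasSum (fun μ => u (y μ)) (∑ l, a l • (u ∘ w) l) := by
    have h1 : ∀ l, HasSum (fun μ => u (a'' l (μ - lam l) • w l)) (a l • (u ∘ w) l) := by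
      intro l
      have hg : IsInducing (closureIn ((proj ρ n).comp ι) A).val := IsInducing.subtypeVal
      have h2 : HasSum (a' l) (a l) := (hg.hasSum_iff (a' l) (a l)).1 (hcs l)
      have h3 := h2.smul_const (u (w l))
      have h4 := (Equiv.subRight (lam l)).hasSum_iff.2 h3
      convert h4 using 2 with μ
      rw [map_smulₛₗ, Function.comp_apply, Equiv.subRight_apply, ← ha]
      rfl
    have h2 := hasSum_sum (s := Finset.univ) fun l _ => h1 l
    simpa only [y, map_sum] using h2
  have hsum' : HasSum (fun μ => M.transition n (y μ)) 0 := by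
    have h1 := hsum.map (ExtendScalars.lift (M.closureTransition ι A n)) hcont
    rw [hx] at h1
    convert h1 using 2 with μ
    exact (ExtendScalars.lift_unit (M.closureTransition ι A n) (y μ)).symm
  have hy0 : ∀ μ, y μ = 0 := fun μ =>
    eq_zero_of_transition_eq_zero p hρ hR (h.hasBoundedWeights p hρ hR hA (n + 1)) (hy μ)
      ((h.hasBoundedWeights p hρ hR hA n).eq_zero (fun μ => transition_mem (hy μ)) hsum' μ)
  simp only [hy0, map_zero] at hsum
  exact hsum.unique hasSum_zero

include p in
/-- Restriction of a module in `𝒪⌢` to the Fréchet–Stein algebra `𝒜`. -/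
theorem InO.coadmissibleOver (h : M.InO ι A d) (hρ : IsFrechetStein ρ)
    (hR : IsFrechetTriangularDecomposition ι 𝒢 A B H d)
    (hA : IsFrechetStein (closureTower ι A)) : M.CoadmissibleOver ι A := by
  let N : CoherentModule.{u, v, w} (closureTower ι A) :=
    { obj := M.obj
      finite := fun n => (h n).2.2
      transition := M.closureTransition ι A
      bijective := fun n => ⟨h.injective_closureTransition p hρ hR hA n,
        ExtendScalars.lift_surjective (h.span_range_closureTransition p hρ hR hA n)⟩ }
  let _ : Module (invLim (closureTower ι A)) M.limit :=
    Module.compHom M.limit (closureInclusion ι A).toRingHom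
  exact ⟨N, ⟨{ toFun := fun m => ⟨m.1, m.2⟩
               invFun := fun m => ⟨m.1, m.2⟩
               map_add' := fun _ _ => rfl
               map_smul' := fun _ _ => rfl
               left_inv := fun _ => rfl
               right_inv := fun _ => rfl }⟩⟩

end CoherentModule

end FrechetModules

end TriangularO

/-! ### Assembling the equivalences -/

theorem mainTheorem3 (p : ℕ) [Fact p.Prime]
    {K : Type*} [NontriviallyNormedField K] [NormedAlgebra ℚ_[p] K] [CompleteSpace K]
    [IsUltrametricDist K]
    (hK : ∃ π : K, 0 < ‖π‖ ∧ ‖π‖ < 1 ∧ ∀ x : K, x ≠ 0 → ∃ n : ℤ, ‖x‖ = ‖π‖ ^ n)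
    {X : ℕ → Type*} [∀ n, NormedRing (X n)] [∀ n, NormedAlgebra K (X n)]
    (ρ : ∀ n, X (n + 1) →A[K] X n) (hρ : TriangularO.IsFrechetStein ρ)
    {R : Type*} [Ring R] [Algebra K R] (𝒢 : ℤ → Submodule K R) [GradedAlgebra 𝒢]
    (A B H : Subalgebra K R) (d : R) (ι : R →ₐ[K] TriangularO.invLim ρ)
    (hR : TriangularO.IsFrechetTriangularDecomposition ι 𝒢 A B H d)
    (hA : TriangularO.IsFrechetStein (TriangularO.closureTower ι A))
    (hB : TriangularO.IsFrechetStein (TriangularO.closureTower ι B))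
    (M : TriangularO.CoherentModule ρ) :
    List.TFAE
      [ M.InO ι A d,
        M.InOws ι d ∧
          ∃ s : Finset K, (s : Set K) ⊆ TriangularO.weights (V := M.limit) (M.act ι d) ∧
            ∀ μ ∈ TriangularO.weights (V := M.limit) (M.act ι d), ∃ ν ∈ s, ∃ n : ℕ, μ = ν + (n : K),
        M.InOws ι d ∧
          M.LocallyNilpotent ι 𝒢 B d ] ∧
    (M.InO ι A d → M.CoadmissibleOver ι A) := by
  have : CharZero K := TriangularO.charZero_of_padic p
  refine ⟨?_, fun h => h.coadmissibleOver p hρ hR hA⟩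
  tfae_have 1 → 2 := fun h => h.inOws p hρ hR hA
  tfae_have 2 → 3 := fun ⟨h, s, _, hs⟩ =>
    ⟨h, TriangularO.CoherentModule.locallyNilpotent_of_bounded hR ⟨s, hs⟩⟩
  tfae_have 3 → 1 := fun ⟨⟨_, hI, _⟩, h⟩ => h.inO p hρ hR hI
  tfae_finish
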